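/- Let $A$ be a unital commutative associative $\mathbb{C}$-algebra with identity $e$, and let $B$ be a vertex $A$-algebroid: a complex vector space with a bilinear map $A\times B\to B$, $(a,v)\mapsto a*v$, with $e*v=v$; a (left) Leibniz bracket $[\cdot,\cdot]$ on $B$; a homomorphism of Leibniz algebras $\pi:B\to\mathrm{Der}(A)$; a symmetric bilinear pairing $\langle\cdot,\cdot\rangle:B\times B\to A$; and a linear map $\partial:A\to B$ with $\pi\circ\partial=0$, such that for $a,a'\in A$, $u,v,v_1,v_2\in B$ $$a*(a'*v)-(aa')*v=\pi(v)(a)*\partial a'+\pi(v)(a')*\partial a,\quad [u,a*v]=\pi(u)(a)*v+a*[u,v],\quad [u,v]+[v,u]=\partial\langle u,v\rangle,$$ $$\pi(a*v)=a\,\pi(v),\quad \langle a*u,v\rangle=a\langle u,v\rangle-\pi(u)(\pi(v)(a)),\quad \pi(v)\langle v_1,v_2\rangle=\langle[v,v_1],v_2\rangle+\langle v_1,[v,v_2]\rangle,$$ $$\partial(aa')=a*\partial a'+a'*\partial a,\quad [v,\partial a]=\partial(\pi(v)(a)),\quad \langle v,\partial a\rangle=\pi(v)(a).$$ Let $\mathcal{L}$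 be the quotient of $(A\oplus B)\otimes\mathbb{C}[t,t^{-1}]$ by the subspace spanned by the elements $\partial a\otimes t^n+n\,a\otimes t^{n-1}$ $(a\in A,\ n\in\mathbb{Z})$. Writing $u(n)$ for the class of $u\otimes t^n$, it is a Lie algebra with $[u(m),v(n)]=(u_0v)(m+n)+m\,(u_1v)(m+n-1)$, where for $a,a'\in A$, $b,b'\in B$ one sets $b_0a=\pi(b)(a)=-a_0b$, $b_0b'=[b,b']$, $b_1b'=\langle b,b'\rangle$, and all other products are zero. Let $\mathcal{L}^{\ge0}$ be the span of the $u(n)$ with $n\ge0$, and let $V_{\mathcal{L}}=U(\mathcal{L})\otimes_{U(\mathcal{L}^{\ge0})}\mathbb{C}$ be the associated vertex algebra, with vacuum $\mathbf{1}=1\otimes1$ and $Y(u(-1)\mathbf{1},x)=\sum_n u(n)x^{-n-1}$ for $u\in A\oplus B$, graded by $\deg\mathbf{1}=0$, $\deg a(n)=-n-1$, $\deg b(n)=-n$ $(a\in A,\ b\in B)$. Identify $u\in A\oplus B$ with $u(-1)\mathbf{1}$. Let $\mathcal{D}$ be the operator $v\mapsto v_{-2}\mathbf{1}$ and let $V_B=V_{\mathcal{L}}/I_B$,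 where $I_B=U(\mathcal{L})\,\mathbb{C}[\mathcal{D}]\,E$ and $E$ is the span of the vectors $e-\mathbf{1}$, $a(-1)a'-aa'$, $a(-1)b-a*b$ $(a,a'\in A,\ b\in B)$, with the induced grading $V_B=\coprod_k (V_B)_{(k)}$. Let $A\partial A\subset B$ be the span of the elements $a*\partial a'$. Then $B/A\partial A$ is a Lie $A$-algebroid (Lie–Rinehart algebra) with the bracket and the $A$-action induced by $[\cdot,\cdot]$ and $*$, acting on $A$ through $\pi$. A module for a Lie $A$-algebroid $\mathfrak g$ is a vector space that is both an $A$-module and a $\mathfrak g$-module, with $u(aw)-a(uw)=(ua)w$ and $a(uw)=(au)w$ for $a\in A$, $u\in\mathfrak g$; it is simple if it is nonzero and has no subspaces stable under $A$ and $\mathfrak g$ other than $0$ and itself. Let $W=\coprod_{n\in\mathbb{N}}W(n)$ be an $\mathbb{N}$-graded $V_B$-module, i.e. a $V_B$-module with $v_mW(n)\subset W(k+n-m-1)$ for $v\in(V_B)_{(k)}$, $m\in\mathbb{Z}$, $n\in\mathbb{N}$ (where $W(j)=0$ for $j<0$), and suppose $W(0)\neq0$. Then $W(0)$ is an $A$-module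 with $aw=a_{-1}w$ $(a\in A,\ w\in W(0))$ and a module for the Lie algebra $B/A\partial A$ with $(b+A\partial A)w=b_0w$ $(b\in B,\ w\in W(0))$, and with these two structures $W(0)$ is a module for the Lie $A$-algebroid $B/A\partial A$. If moreover $W$ is graded simple (that is, nonzero and without graded $V_B$-submodules other than $0$ and $W$), then $W(0)$ is a simple module for the Lie $A$-algebroid $B/A\partial A$. -/

import Mathlib

noncomputable section

/-- The Jacobi identity for the pair `u, v` of states, written in coefficients: comparing the
coefficients of `x₀^{-l-1} x₁^{-m-1} x₂^{-n-1}` on both sides of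
`x₀⁻¹ δ((x₁ - x₂)/x₀) Y(u,x₁) Y(v,x₂) w - x₀⁻¹ δ((x₂ - x₁)/(-x₀)) Y(v,x₂) Y(u,x₁) w
  = x₂⁻¹ δ((x₁ - x₀)/x₂) Y(Y(u,x₀)v, x₂) w`.
Here `YV u n v` is the vector `u_n v` of `V` and `YW u n` is the operator `u_n` on `W`.
By the truncation condition all the sums have only finitely many nonzero terms. -/
def JacobiIdentity {V W : Type*} [AddCommGroup V] [Module ℂ V] [AddCommGroup W] [Module ℂ W]
    (YV : V →ₗ[ℂ] (ℤ → Module.End ℂ V)) (YW : V →ₗ[ℂ] (ℤ → Module.End ℂ W)) : Prop :=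
  ∀ (u v : V) (w : W) (l m n : ℤ),
    ∑ᶠ i : ℕ, ((-1) ^ i * Ring.choose l i) •
        (YW u (m + l - i) (YW v (n + i) w) -
          (l.negOnePow : ℤ) • YW v (n + l - i) (YW u (m + i) w)) =
      ∑ᶠ i : ℕ, Ring.choose m i • YW (YV u (l + i) v) (m + n - i) w

/-- A vertex algebra structure on the complex vector space `V`: a linear map
`Y : V → (End V)[[x, x⁻¹]]`, `Y(v,x) = ∑ v_n x^{-n-1}`, `v_n = Y v n`, and a vacuum vector. -/
class VertexAlgebra (V : Type*) [AddCommGroup V] [Module ℂ V] where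
  vac : V
  Y : V →ₗ[ℂ] (ℤ → Module.End ℂ V)
  trunc : ∀ u v : V, ∃ N : ℤ, ∀ n : ℤ, N ≤ n → Y u n v = 0
  vac_left : ∀ (n : ℤ) (v : V), Y vac n v = if n = -1 then v else 0
  vac_right : ∀ (v : V) (n : ℤ), 0 ≤ n → Y v n vac = 0
  creation : ∀ v : V, Y v (-1) vac = v
  jacobi : JacobiIdentity Y Y

/-- A module structure on `W` for the vertex algebra `V`; `Y v n` is the operator `v_n` on `W`. -/
class VertexModule (V : Type*) [AddCommGroup V] [Module ℂ V] [VertexAlgebra V]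
    (W : Type*) [AddCommGroup W] [Module ℂ W] where
  Y : V →ₗ[ℂ] (ℤ → Module.End ℂ W)
  trunc : ∀ (v : V) (w : W), ∃ N : ℤ, ∀ n : ℤ, N ≤ n → Y v n w = 0
  vac_left : ∀ (n : ℤ) (w : W), Y VertexAlgebra.vac n w = if n = -1 then w else 0
  jacobi : JacobiIdentity VertexAlgebra.Y Y


/-- The binomially weighted sum `∑_{i ≥ 0} (p choose i) f i` of a sequence that vanishes eventually. -/
def bsum {V : Type*} [AddCommGroup V] (p : ℤ) (f : ℕ → V) : V :=
  ∑ᶠ i : ℕ, Ring.choose p i • f i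

section BSum

variable {V : Type*} [AddCommGroup V]

theorem finsum_eq_range {f : ℕ → V} (N : ℕ) (h : ∀ i, N ≤ i → f i = 0) :
    ∑ᶠ i, f i = ∑ i ∈ Finset.range N, f i := by
  apply finsum_eq_sum_of_support_subset
  intro i hi
  simp only [Finset.coe_range, Set.mem_Iio]
  by_contra hc
  exact hi (h i (not_lt.mp hc))

theorem bsum_eq_range (p : ℤ) {f : ℕ → V} (N : ℕ) (h : ∀ i, N ≤ i → f i = 0) :
    bsum p f = ∑ i ∈ Finset.range N, Ring.choose p i • f i :=
  finsum_eq_range N fun i hi => by rw [h i hi, smul_zero]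

theorem bsum_zero (p : ℤ) : bsum p (fun _ => (0 : V)) = 0 := by simp [bsum]

theorem bsum_map {W : Type*} [AddCommGroup W] (L : V →+ W) (p : ℤ) {f : ℕ → V} (N : ℕ)
    (h : ∀ i, N ≤ i → f i = 0) : L (bsum p f) = bsum p fun i => L (f i) := by
  rw [bsum_eq_range p N h, bsum_eq_range p N (fun i hi => by rw [h i hi, map_zero]), map_sum]
  exact Finset.sum_congr rfl fun i _ => map_zsmul _ _ _

theorem bsum_add (p : ℤ) {f g : ℕ → V} (N : ℕ)
    (hf : ∀ i, N ≤ i → f i = 0) (hg : ∀ i, N ≤ i → g i = 0) :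
    bsum p (fun i => f i + g i) = bsum p f + bsum p g := by
  rw [bsum_eq_range p N hf, bsum_eq_range p N hg,
    bsum_eq_range p N (fun i hi => by rw [hf i hi, hg i hi, add_zero]), ← Finset.sum_add_distrib]
  exact Finset.sum_congr rfl fun i _ => smul_add _ _ _

theorem bsum_sub (p : ℤ) {f g : ℕ → V} (N : ℕ)
    (hf : ∀ i, N ≤ i → f i = 0) (hg : ∀ i, N ≤ i → g i = 0) :
    bsum p (fun i => f i - g i) = bsum p f - bsum p g := by
  rw [bsum_eq_range p N hf, bsum_eq_range p N hg,
    bsum_eq_range p N (fun i hi => by rw [hf i hi, hg i hi, sub_zero]), ← Finset.sum_sub_distrib]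
  exact Finset.sum_congr rfl fun i _ => smul_sub _ _ _

theorem bsum_succ (p : ℤ) {f : ℕ → V} (N : ℕ) (h : ∀ i, N ≤ i → f i = 0) :
    bsum (p + 1) f = bsum p f + bsum p fun i => f (i + 1) := by
  rw [bsum_eq_range (p + 1) (N + 1) (fun i hi => h i (by omega)),
    bsum_eq_range p (N + 1) (fun i hi => h i (by omega)),
    bsum_eq_range p N (fun i hi => h (i + 1) (by omega)),
    Finset.sum_range_succ' _ N, Finset.sum_range_succ' _ N]
  simp only [Ring.choose_succ_succ, add_smul, Finset.sum_add_distrib, Ring.choose_zero_right]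
  abel

theorem bsum_weight (p : ℤ) {f : ℕ → V} (N : ℕ) (h : ∀ i, N ≤ i → f i = 0) :
    bsum p (fun i => (i : ℤ) • f i) = p • bsum (p - 1) fun i => f (i + 1) := by
  rw [bsum_eq_range p (N + 1) (fun i hi => by rw [h i (by omega), smul_zero]),
    bsum_eq_range (p - 1) N (fun i hi => h (i + 1) (by omega)),
    Finset.sum_range_succ' _ N, Finset.smul_sum]
  simp only [Nat.cast_zero, zero_smul, smul_zero, add_zero]
  refine Finset.sum_congr rfl fun i _ => ?_
  rw [smul_smul, smul_smul]
  congr 1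
  have h2 := Ring.choose_smul_choose (p : ℤ) (n := i + 1) (k := 1) (by omega)
  simpa [Ring.choose_one_right, mul_comm] using h2

theorem bsum_comm (p q : ℤ) {f : ℕ → ℕ → V} (N : ℕ)
    (h1 : ∀ i j, N ≤ i → f i j = 0) (h2 : ∀ i j, N ≤ j → f i j = 0) :
    (bsum p fun i => bsum q fun j => f i j) = bsum q fun j => bsum p fun i => f i j := by
  rw [bsum_eq_range p N fun i hi => by simp only [h1 i _ hi, bsum_zero],
    bsum_eq_range q N fun j hj => by simp only [h2 _ j hj, bsum_zero]]
  simp_rw [bsum_eq_range q N (h2 _), bsum_eq_range p N (fun i => h1 i _), Finset.smul_sum]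
  rw [Finset.sum_comm]
  exact Finset.sum_congr rfl fun i _ => Finset.sum_congr rfl fun j _ => smul_comm _ _ _

theorem bsum_diag (p q : ℤ) {h : ℕ → V} (N : ℕ) (hN : ∀ i, N ≤ i → h i = 0) :
    (bsum p fun i => bsum q fun j => h (i + j)) = bsum (p + q) h := by
  rw [bsum_eq_range (p + q) N hN, bsum_eq_range p N fun i hi => by
    simp only [hN _ (Nat.le_add_right_of_le hi), bsum_zero]]
  have e : ∀ i ∈ Finset.range N, Ring.choose p i • bsum q (fun j => h (i + j)) =
      ∑ j ∈ Finset.range (N - i), (Ring.choose p i * Ring.choose q j) • h (i + j) := by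
    intro i _
    rw [bsum_eq_range q (N - i) fun j hj => hN _ (by omega), Finset.smul_sum]
    exact Finset.sum_congr rfl fun j _ => smul_smul _ _ _
  rw [Finset.sum_congr rfl e, ← Finset.sum_range_diag_flip N fun i j =>
    (Ring.choose p i * Ring.choose q j) • h (i + j)]
  refine Finset.sum_congr rfl fun r _ => ?_
  rw [Ring.add_choose_eq r (Commute.all p q), Finset.sum_smul,
    Finset.Nat.sum_antidiagonal_eq_sum_range_succ fun i j => (Ring.choose p i * Ring.choose q j) • h r]
  refine Finset.sum_congr rfl fun i hi => ?_
  rw [Nat.add_sub_cancel' (by simpa [Nat.lt_succ_iff] using hi)]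

theorem bsum_trinom (p : ℤ) {f : ℕ → ℕ → V} (N : ℕ)
    (h1 : ∀ s j, N ≤ s → f s j = 0) (h2 : ∀ s j, N ≤ j → f s j = 0) :
    (bsum p fun j => bsum (j : ℤ) fun s => f s j) =
      bsum p fun s => bsum (p - s) fun j => f s (s + j) := by
  rw [bsum_eq_range p N fun j hj => by simp only [h2 _ j hj, bsum_zero],
    bsum_eq_range p N fun s hs => by simp only [h1 s _ hs, bsum_zero]]
  have e : ∀ s ∈ Finset.range N, Ring.choose p s • bsum (p - s) (fun j => f s (s + j)) =
      ∑ j ∈ Finset.range (N - s),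
        (Ring.choose p (s + j) * ((s + j).choose s : ℤ)) • f s (s + j) := by
    intro s _
    rw [bsum_eq_range _ (N - s) fun j hj => h2 _ _ (by omega), Finset.smul_sum]
    refine Finset.sum_congr rfl fun j _ => ?_
    rw [smul_smul]
    congr 1
    have := Ring.choose_smul_choose (p : ℤ) (n := s + j) (k := s) (by omega)
    simp only [nsmul_eq_mul, Nat.add_sub_cancel_left] at this
    rw [← this, mul_comm]
  rw [Finset.sum_congr rfl e, ← Finset.sum_range_diag_flip N fun s j =>
    (Ring.choose p (s + j) * ((s + j).choose s : ℤ)) • f s (s + j)]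
  refine Finset.sum_congr rfl fun j _ => ?_
  have e2 : bsum (j : ℤ) (fun s => f s j) =
      ∑ s ∈ Finset.range (j + 1), Ring.choose (j : ℤ) s • f s j := by
    unfold bsum
    apply finsum_eq_range
    intro s hs
    rw [Ring.choose_natCast, Nat.choose_eq_zero_of_lt hs]
    simp
  rw [e2, Finset.smul_sum]
  refine Finset.sum_congr rfl fun s hs => ?_
  rw [smul_smul, Ring.choose_natCast, Nat.add_sub_cancel' (by simpa [Nat.lt_succ_iff] using hs)]

theorem bsum_weight' (p : ℤ) {f : ℕ → V} (N : ℕ) (h : ∀ i, N ≤ i → f i = 0) :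
    bsum p (fun i => (p - i) • f i) = p • bsum (p - 1) f := by
  have h1 := bsum_weight p N h
  have h2 := bsum_succ (p - 1) N h
  rw [sub_add_cancel] at h2
  have h3 : (bsum p fun i => (p - i) • f i) = p • bsum p f - bsum p fun i => (i : ℤ) • f i := by
    have h4 := bsum_map (DistribSMul.toAddMonoidHom V p) p N h
    simp only [DistribSMul.toAddMonoidHom_apply] at h4
    rw [h4, ← bsum_sub p N (fun i hi => by rw [h i hi, smul_zero])
      (fun i hi => by rw [h i hi, smul_zero])]
    simp only [sub_smul]
  rw [h3, h1, h2, smul_add]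
  abel

theorem bsum_natCast (P : ℕ) (f : ℕ → V) :
    bsum (P : ℤ) f = ∑ i ∈ Finset.range (P + 1), (P.choose i : ℤ) • f i := by
  unfold bsum
  rw [finsum_eq_range (P + 1) fun s hs => by
    rw [Ring.choose_natCast, Nat.choose_eq_zero_of_lt hs]; simp]
  simp only [Ring.choose_natCast]

theorem bsum_zero_left (f : ℕ → V) : bsum 0 f = f 0 := by
  have := bsum_natCast 0 f
  simpa using this

theorem bsum_natCast_reflect (P : ℕ) (f : ℕ → V) :
    bsum (P : ℤ) f = bsum (P : ℤ) fun i => f (P - i) := by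
  rw [bsum_natCast, bsum_natCast, ← Finset.sum_range_reflect]
  refine Finset.sum_congr rfl fun i hi => ?_
  have : i ≤ P := by simpa [Nat.lt_succ_iff] using hi
  rw [show P + 1 - 1 - i = P - i by omega, Nat.choose_symm this]

theorem bsum_congr_nat (P : ℕ) {f h : ℕ → V} (hfh : ∀ i, i ≤ P → f i = h i) :
    bsum (P : ℤ) f = bsum (P : ℤ) h := by
  rw [bsum_natCast, bsum_natCast]
  refine Finset.sum_congr rfl fun i hi => ?_
  rw [hfh i (by simpa [Nat.lt_succ_iff] using hi)]

theorem bsum_smul (p c : ℤ) {f : ℕ → V} (N : ℕ) (h : ∀ i, N ≤ i → f i = 0) :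
    c • bsum p f = bsum p fun i => c • f i := by
  have h4 := bsum_map (DistribSMul.toAddMonoidHom V c) p N h
  simpa only [DistribSMul.toAddMonoidHom_apply] using h4

theorem choose_neg_one (i : ℕ) : Ring.choose (-1 : ℤ) i = (-1) ^ i := by
  have h := Ring.choose_neg (1 : ℤ) i
  rw [h, Int.negOnePow_def]
  simp [Units.smul_def, Ring.choose_natCast]

theorem bsum_neg_one_shift {f : ℕ → V} (k N : ℕ) (h : ∀ i, N ≤ i → f i = 0)
    (hk : ∀ i, i < k → f i = 0) :
    bsum (-1) f = (-1 : ℤ) ^ k • bsum (-1) fun i => f (k + i) := by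
  rw [bsum_eq_range _ (k + N) (fun i hi => h i (by omega)),
    bsum_eq_range _ N (fun i hi => h _ (by omega)), Finset.sum_range_add,
    Finset.sum_eq_zero (fun i hi => by rw [hk i (by simpa using hi), smul_zero]), zero_add,
    Finset.smul_sum]
  refine Finset.sum_congr rfl fun i _ => ?_
  rw [choose_neg_one, choose_neg_one, smul_smul, pow_add]

end BSum


/-- Operators `g u n` (`u : C`, `n : ℤ`) on `V` generating `V` from a vacuum vector, with the
commutation relations of a `1`-truncated conformal algebra `C` and a translation operator `D`. -/
structure GenSys (C V : Type*) [AddCommGroup V] [Module ℂ V] where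
  op0 : C → C → C
  op1 : C → C → C
  g : C → ℤ → Module.End ℂ V
  vac : V
  D : Module.End ℂ V
  comm : ∀ u v m n x, g u m (g v n x) - g v n (g u m x) =
    g (op0 u v) (m + n) x + m • g (op1 u v) (m + n - 1) x
  trunc : ∀ u x, ∃ N : ℕ, ∀ n : ℤ, N ≤ n → g u n x = 0
  g_vac : ∀ u n, 0 ≤ n → g u n vac = 0
  D_g : ∀ u n x, D (g u n x) - g u n (D x) = -(n • g u (n - 1) x)
  D_vac : D vac = 0
  ind : ∀ S : Submodule ℂ V, vac ∈ S → (∀ u n x, x ∈ S → g u n x ∈ S) → ∀ x, x ∈ S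

namespace GenSys

variable {C V : Type*} [AddCommGroup V] [Module ℂ V] (S : GenSys C V)

/-- Right part of the action of `g u p` on linear maps `V → V[[z, z⁻¹]]`. -/
def R (u : C) (p : ℤ) : (V →ₗ[ℂ] (ℤ → V)) →ₗ[ℂ] (V →ₗ[ℂ] (ℤ → V)) where
  toFun φ :=
    { toFun := fun v n => bsum p fun j => φ (S.g u j v) (p + n - j)
      map_add' := fun v w => by
        funext n
        obtain ⟨N, hN⟩ := S.trunc u v
        obtain ⟨N', hN'⟩ := S.trunc u w
        simp only [map_add, Pi.add_apply]
        exact bsum_add p (max N N')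
          (fun i hi => by rw [hN i (by omega)]; simp) (fun i hi => by rw [hN' i (by omega)]; simp)
      map_smul' := fun c v => by
        funext n
        obtain ⟨N, hN⟩ := S.trunc u v
        simp only [map_smul, Pi.smul_apply, RingHom.id_apply]
        exact (bsum_map (DistribSMul.toAddMonoidHom V c) p N
          (fun i hi => by rw [hN i (by omega)]; simp)).symm }
  map_add' φ ψ := by
    ext v n
    obtain ⟨N, hN⟩ := S.trunc u v
    simp only [LinearMap.add_apply, Pi.add_apply, LinearMap.coe_mk, AddHom.coe_mk]
    exact bsum_add p N
      (fun i hi => by rw [hN i (by omega)]; simp) (fun i hi => by rw [hN i (by omega)]; simp)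
  map_smul' c φ := by
    ext v n
    obtain ⟨N, hN⟩ := S.trunc u v
    simp only [LinearMap.smul_apply, Pi.smul_apply, LinearMap.coe_mk, AddHom.coe_mk,
      RingHom.id_apply]
    exact (bsum_map (DistribSMul.toAddMonoidHom V c) p N
      (fun i hi => by rw [hN i (by omega)]; simp)).symm

theorem R_apply (u : C) (p : ℤ) (φ : V →ₗ[ℂ] (ℤ → V)) (v : V) (n : ℤ) :
    S.R u p φ v n = bsum p fun j => φ (S.g u j v) (p + n - j) := rfl

/-- Left part of the action of `g u p` on linear maps `V → V[[z, z⁻¹]]`. -/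
def Lft (u : C) (p : ℤ) : (V →ₗ[ℂ] (ℤ → V)) →ₗ[ℂ] (V →ₗ[ℂ] (ℤ → V)) where
  toFun φ := (LinearMap.pi fun n => S.g u p ∘ₗ LinearMap.proj n) ∘ₗ φ
  map_add' φ ψ := by ext; simp
  map_smul' c φ := by ext; simp

theorem Lft_apply (u : C) (p : ℤ) (φ : V →ₗ[ℂ] (ℤ → V)) (v : V) (n : ℤ) :
    S.Lft u p φ v n = S.g u p (φ v n) := rfl

/-- The action of `g u p` on linear maps `V → V[[z, z⁻¹]]`. -/
def G (u : C) (p : ℤ) : Module.End ℂ (V →ₗ[ℂ] (ℤ → V)) := S.Lft u p - S.R u p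

theorem G_apply (u : C) (p : ℤ) (φ : V →ₗ[ℂ] (ℤ → V)) (v : V) (n : ℤ) :
    S.G u p φ v n = S.g u p (φ v n) - bsum p fun j => φ (S.g u j v) (p + n - j) := rfl

theorem R_Lft (u v : C) (p q : ℤ) (φ : V →ₗ[ℂ] (ℤ → V)) :
    S.R u p (S.Lft v q φ) = S.Lft v q (S.R u p φ) := by
  ext x n
  obtain ⟨N, hN⟩ := S.trunc u x
  simp only [R_apply, Lft_apply]
  exact (bsum_map (S.g v q).toAddMonoidHom p N
    (fun i hi => by rw [hN i (by omega)]; simp)).symm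

/-- A common bound for the vanishing of `g u i` on the vectors `g v j x`, `j ≥ 0`. -/
theorem trunc₂ (u v : C) (x : V) : ∃ N : ℕ, (∀ i j : ℕ, N ≤ i → S.g u i (S.g v j x) = 0) ∧
    (∀ i j : ℕ, N ≤ j → S.g u i (S.g v j x) = 0) := by
  obtain ⟨N, hN⟩ := S.trunc v x
  choose M hM using fun j : ℕ => S.trunc u (S.g v j x)
  refine ⟨N + ∑ j ∈ Finset.range N, M j, fun i j hi => ?_, fun i j hj => ?_⟩
  · by_cases hj : j < N
    · have := Finset.single_le_sum (f := M) (fun _ _ => Nat.zero_le _) (Finset.mem_range.mpr hj)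
      exact hM j i (by omega)
    · rw [hN j (by omega), map_zero]
  · rw [hN j (by omega), map_zero]

theorem R_comm (u v : C) (p q : ℤ) (φ : V →ₗ[ℂ] (ℤ → V)) :
    S.R v q (S.R u p φ) - S.R u p (S.R v q φ) =
      S.R (S.op0 u v) (p + q) φ + p • S.R (S.op1 u v) (p + q - 1) φ := by
  ext x n
  obtain ⟨N, h1, h2⟩ := S.trunc₂ u v x
  obtain ⟨N', h1', h2'⟩ := S.trunc₂ v u x
  obtain ⟨N0, h0⟩ := S.trunc (S.op0 u v) x
  obtain ⟨N1, h1''⟩ := S.trunc (S.op1 u v) x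
  simp only [LinearMap.sub_apply, LinearMap.add_apply, LinearMap.smul_apply, Pi.sub_apply,
    Pi.add_apply, Pi.smul_apply, R_apply]
  set K := N + N' with hK
  rw [bsum_comm q p K (f := fun j i => φ (S.g u i (S.g v j x)) (p + (q + n - j) - i))
    (fun j i hj => by rw [h2 i j (by omega)]; simp)
    (fun j i hi => by rw [h1 i j (by omega)]; simp)]
  rw [← bsum_sub p K
    (fun i hi => by
      simp only [h1 i _ (show N ≤ i by omega), map_zero, Pi.zero_apply, bsum_zero])
    (fun i hi => by
      simp only [h2' _ i (show N' ≤ i by omega), map_zero, Pi.zero_apply, bsum_zero])]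
  have key : ∀ i : ℕ, ((bsum q fun j => φ (S.g u i (S.g v j x)) (p + (q + n - j) - i)) -
      bsum q fun j => φ (S.g v j (S.g u i x)) (q + (p + n - i) - j)) =
      (bsum q fun j => φ (S.g (S.op0 u v) ((i + j : ℕ) : ℤ) x) (p + q + n - ((i + j : ℕ) : ℤ))) +
      (i : ℤ) • bsum q fun j =>
        φ (S.g (S.op1 u v) (((i + j : ℕ) : ℤ) - 1) x) (p + q + n - ((i + j : ℕ) : ℤ)) := by
    intro i
    rw [← bsum_sub q K (fun j hj => by rw [h2 i j (by omega)]; simp)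
      (fun j hj => by rw [h1' j i (by omega)]; simp)]
    have hm := bsum_map (DistribSMul.toAddMonoidHom V (i : ℤ)) q (N1 + 1)
      (f := fun j => φ (S.g (S.op1 u v) (((i + j : ℕ) : ℤ) - 1) x) (p + q + n - ((i + j : ℕ) : ℤ)))
      (fun j hj => by rw [h1'' _ (by push_cast; omega)]; simp)
    simp only [DistribSMul.toAddMonoidHom_apply] at hm
    rw [hm, ← bsum_add q (N0 + N1 + 1) (fun j hj => by rw [h0 _ (by push_cast; omega)]; simp)
      (fun j hj => by rw [h1'' _ (by push_cast; omega)]; simp)]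
    congr 1
    funext j
    have hc := S.comm u v i j x
    rw [show p + (q + n - j) - (i : ℤ) = p + q + n - ((i + j : ℕ) : ℤ) by push_cast; ring,
      show q + (p + n - i) - (j : ℤ) = p + q + n - ((i + j : ℕ) : ℤ) by push_cast; ring,
      ← Pi.sub_apply, ← map_sub, hc, map_add, map_zsmul]
    push_cast
    rfl
  simp_rw [key]
  rw [bsum_add p (N0 + N1 + 1)
    (fun i hi => by
      have : ∀ j : ℕ, S.g (S.op0 u v) ((i + j : ℕ) : ℤ) x = 0 :=
        fun j => h0 _ (by push_cast; omega)
      simp only [this, map_zero, Pi.zero_apply, bsum_zero])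
    (fun i hi => by
      have : ∀ j : ℕ, S.g (S.op1 u v) (((i + j : ℕ) : ℤ) - 1) x = 0 :=
        fun j => h1'' _ (by push_cast; omega)
      simp only [this, map_zero, Pi.zero_apply, bsum_zero, smul_zero])]
  congr 1
  · exact bsum_diag p q (h := fun r : ℕ => φ (S.g (S.op0 u v) r x) (p + q + n - r)) N0
      (fun i hi => by rw [h0 _ (by omega)]; simp)
  · rw [bsum_weight p (N1 + 1) (fun i hi => by
      have : ∀ j : ℕ, S.g (S.op1 u v) (((i + j : ℕ) : ℤ) - 1) x = 0 :=
        fun j => h1'' _ (by push_cast; omega)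
      simp only [this, map_zero, Pi.zero_apply, bsum_zero])]
    congr 1
    have := bsum_diag (p - 1) q
      (h := fun r : ℕ => φ (S.g (S.op1 u v) r x) (p + q - 1 + n - r)) N1
      (fun i hi => by rw [h1'' _ (by omega)]; simp)
    rw [show p + q - 1 = p - 1 + q by ring] at this ⊢
    rw [← this]
    congr 1; funext i; congr 1; funext j
    push_cast
    rw [show (i : ℤ) + 1 + j - 1 = i + j by ring,
      show p + q + n - ((i : ℤ) + 1 + j) = p - 1 + q + n - (i + j) by ring]

theorem G_comm (u v : C) (p q : ℤ) (φ : V →ₗ[ℂ] (ℤ → V)) :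
    S.G u p (S.G v q φ) - S.G v q (S.G u p φ) =
      S.G (S.op0 u v) (p + q) φ + p • S.G (S.op1 u v) (p + q - 1) φ := by
  have hR := S.R_comm u v p q φ
  have hL : S.Lft u p (S.Lft v q φ) - S.Lft v q (S.Lft u p φ) =
      S.Lft (S.op0 u v) (p + q) φ + p • S.Lft (S.op1 u v) (p + q - 1) φ := by
    ext x n
    simp only [LinearMap.sub_apply, LinearMap.add_apply, LinearMap.smul_apply, Pi.sub_apply,
      Pi.add_apply, Pi.smul_apply, Lft_apply]
    exact S.comm u v p q _
  simp only [G, LinearMap.sub_apply, map_sub, R_Lft]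
  rw [smul_sub]
  linear_combination (norm := module) hL - hR

/-- The divided power `D ^ k / k!`, extended by zero to negative `k`. -/
def E (k : ℤ) : Module.End ℂ V :=
  if 0 ≤ k then ((k.toNat.factorial : ℂ)⁻¹) • S.D ^ k.toNat else 0

theorem E_neg {k : ℤ} (h : k < 0) : S.E k = 0 := by simp [E, not_le.mpr h]

theorem E_zero : S.E 0 = 1 := by simp [E]

theorem D_E (k : ℤ) (x : V) : S.D (S.E k x) = (k + 1) • S.E (k + 1) x := by
  rcases lt_trichotomy k (-1) with h | h | h
  · rw [E_neg _ (by omega), E_neg _ (by omega)]; simp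
  · subst h; rw [E_neg _ (by omega)]; simp
  · obtain ⟨n, rfl⟩ := Int.eq_ofNat_of_zero_le (show 0 ≤ k by omega)
    have h1 : (0 : ℤ) ≤ (n : ℤ) + 1 := by omega
    simp only [E, Int.natCast_nonneg, h1, if_true, Int.toNat_natCast,
      show ((n : ℤ) + 1).toNat = n + 1 by omega, LinearMap.smul_apply, map_smul]
    rw [pow_succ', Module.End.mul_apply, ← Int.cast_smul_eq_zsmul ℂ, smul_smul]
    congr 1
    rw [Nat.factorial_succ]
    have : ((n : ℂ) + 1) ≠ 0 := by exact_mod_cast Nat.succ_ne_zero n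
    push_cast
    field_simp

theorem E_vac (k : ℤ) : S.E k S.vac = if k = 0 then S.vac else 0 := by
  rcases lt_trichotomy k 0 with h | h | h
  · rw [E_neg _ h, if_neg h.ne]; rfl
  · subst h; simp [E_zero]
  · obtain ⟨n, rfl⟩ := Int.eq_ofNat_of_zero_le h.le
    obtain ⟨m, rfl⟩ := Nat.exists_eq_succ_of_ne_zero (n := n) (by omega)
    simp only [E]
    rw [if_neg h.ne', if_pos h.le, LinearMap.smul_apply, Int.toNat_natCast, Nat.succ_eq_add_one,
      pow_succ, Module.End.mul_apply, S.D_vac, map_zero, smul_zero]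

theorem zsmul_cancel {n : ℤ} (hn : n ≠ 0) {x y : V} (h : n • x = n • y) : x = y := by
  rw [← Int.cast_smul_eq_zsmul ℂ, ← Int.cast_smul_eq_zsmul ℂ] at h
  exact (smul_right_injective V (show (n : ℂ) ≠ 0 by exact_mod_cast hn)) h

theorem E_E (i j : ℕ) (x : V) : S.E i (S.E j x) = ((i + j).choose i : ℤ) • S.E (i + j) x := by
  induction i with
  | zero => simp [E_zero]
  | succ i ih =>
    have h := S.D_E i (S.E j x)
    rw [ih, map_zsmul, D_E] at h
    refine zsmul_cancel (n := (i : ℤ) + 1) (by omega) ?_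
    push_cast
    rw [← h, smul_smul, smul_smul, show (i : ℤ) + 1 + j = i + j + 1 by ring]
    congr 1
    have := Nat.add_one_mul_choose_eq (i + j) i
    rw [show i + 1 + j = i + j + 1 by ring]
    push_cast [← @Nat.cast_inj ℤ] at this
    linarith

/-- The commutation of a translation covariant family of operators with the divided powers. -/
theorem cov_E {f : ℤ → Module.End ℂ V}
    (hf : ∀ n x, S.D (f n x) - f n (S.D x) = -(n • f (n - 1) x)) (k : ℕ) (q : ℤ) (x : V) :
    f q (S.E k x) = bsum q fun t => S.E (k - t) (f (q - t) x) := by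
  induction k generalizing q with
  | zero =>
    rw [bsum_eq_range q 1 fun i hi => by rw [E_neg _ (by push_cast; omega)]; rfl]
    simp [E_zero]
  | succ k ih =>
    refine zsmul_cancel (n := (k : ℤ) + 1) (by omega) ?_
    have h1 := S.D_E k x
    have h2 := hf q (S.E k x)
    have hz : ∀ i : ℕ, k + 1 ≤ i → S.E (k - i) (f (q - i) x) = 0 :=
      fun i hi => by rw [E_neg _ (by omega)]; rfl
    have hz2 : ∀ i : ℕ, k + 2 ≤ i → S.E (k + 1 - i) (f (q - i) x) = 0 :=
      fun i hi => by rw [E_neg _ (by omega)]; rfl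
    push_cast
    rw [← map_zsmul, ← h1, show f q (S.D (S.E k x)) = S.D (f q (S.E k x)) + q • f (q - 1) (S.E k x)
      by rw [sub_eq_iff_eq_add] at h2; rw [h2]; abel, ih, ih]
    have e1 := bsum_map S.D.toAddMonoidHom q (k + 1) hz
    simp only [LinearMap.toAddMonoidHom_coe, D_E] at e1
    have e2 := bsum_weight q (f := fun t : ℕ => S.E (k + 1 - t) (f (q - t) x)) (k + 2) hz2
    have e3 := bsum_map (DistribSMul.toAddMonoidHom V ((k : ℤ) + 1)) q (k + 2) hz2
    simp only [DistribSMul.toAddMonoidHom_apply] at e3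
    rw [e1, e3]
    have e4 : (q • bsum (q - 1) fun t => S.E (k - t) (f (q - 1 - t) x)) =
        bsum q fun i => (i : ℤ) • S.E (k + 1 - i) (f (q - i) x) := by
      rw [e2]
      congr 2
      funext t
      push_cast
      rw [show (k : ℤ) + 1 - (t + 1) = k - t by ring, show q - ((t : ℤ) + 1) = q - 1 - t by ring]
    rw [e4, ← bsum_add q (k + 2)
      (fun i hi => by rw [E_neg _ (by omega)]; simp) (fun i hi => by rw [hz2 i hi, smul_zero])]
    congr 1
    funext t
    rw [show (k : ℤ) - t + 1 = k + 1 - t by ring, ← add_smul]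
    congr 1
    ring

theorem cov_E' {f : ℤ → Module.End ℂ V}
    (hf : ∀ n x, S.D (f n x) - f n (S.D x) = -(n • f (n - 1) x)) (k : ℕ) (q : ℤ) (x : V) :
    S.E k (f q x) = bsum q fun t => (-1 : ℤ) ^ t • f (q - t) (S.E (k - t) x) := by
  induction k generalizing q with
  | zero =>
    rw [bsum_eq_range q 1 fun i hi => by rw [E_neg _ (by push_cast; omega)]; simp]
    simp [E_zero]
  | succ k ih =>
    refine zsmul_cancel (n := (k : ℤ) + 1) (by omega) ?_
    have hz : ∀ i : ℕ, k + 1 ≤ i → (-1 : ℤ) ^ i • f (q - i) (S.E (k - i) x) = 0 :=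
      fun i hi => by rw [E_neg _ (by omega)]; simp
    have hz2 : ∀ i : ℕ, k + 2 ≤ i → (-1 : ℤ) ^ i • f (q - i) (S.E (k + 1 - i) x) = 0 :=
      fun i hi => by rw [E_neg _ (by omega)]; simp
    have hz3 : ∀ i : ℕ, k + 1 ≤ i →
        ((-1 : ℤ) ^ i * (q - i)) • f (q - i - 1) (S.E (k - i) x) = 0 :=
      fun i hi => by rw [E_neg _ (by omega)]; simp
    push_cast
    rw [← S.D_E k, ih]
    have e1 := bsum_map S.D.toAddMonoidHom q (k + 1) hz
    simp only [LinearMap.toAddMonoidHom_coe, map_zsmul] at e1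
    have e3 := bsum_map (DistribSMul.toAddMonoidHom V ((k : ℤ) + 1)) q (k + 2) hz2
    simp only [DistribSMul.toAddMonoidHom_apply] at e3
    rw [e1, e3]
    have e5 : ∀ i : ℕ, (-1 : ℤ) ^ i • S.D (f (q - i) (S.E (k - i) x)) =
        ((-1 : ℤ) ^ i * (k + 1 - i)) • f (q - i) (S.E (k + 1 - i) x) -
        ((-1 : ℤ) ^ i * (q - i)) • f (q - i - 1) (S.E (k - i) x) := by
      intro i
      have h2 := hf (q - i) (S.E (k - i) x)
      rw [D_E, map_zsmul, sub_eq_iff_eq_add] at h2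
      rw [h2, show (k : ℤ) - i + 1 = k + 1 - i by ring, smul_add, smul_smul, smul_neg, smul_smul]
      abel
    simp_rw [e5]
    rw [bsum_sub q (k + 2) (fun i hi => by rw [E_neg _ (by omega)]; simp)
      (fun i hi => hz3 i (by omega))]
    have e6 : (bsum q fun i => ((-1 : ℤ) ^ i * (q - i)) • f (q - i - 1) (S.E (k - i) x)) =
        - bsum q fun i => (i : ℤ) • ((-1 : ℤ) ^ i • f (q - i) (S.E (k + 1 - i) x)) := by
      rw [bsum_weight q (k + 2) hz2, bsum_eq_range q (k + 1) hz3,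
        bsum_eq_range (q - 1) (k + 1) (fun i hi => hz2 (i + 1) (by omega)), Finset.smul_sum,
        ← Finset.sum_neg_distrib]
      refine Finset.sum_congr rfl fun i _ => ?_
      push_cast
      rw [show (k : ℤ) + 1 - (i + 1) = k - i by ring, show q - ((i : ℤ) + 1) = q - i - 1 by ring]
      simp only [smul_smul]
      rw [← neg_smul]
      congr 1
      have hc := Ring.choose_smul_choose (q : ℤ) (n := i + 1) (k := 1) (by omega)
      have hc' := Ring.choose_smul_choose (q : ℤ) (n := i + 1) (k := i) (by omega)
      simp only [Ring.choose_one_right, nsmul_eq_mul, Nat.choose_one_right, Nat.cast_one,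
        Nat.add_sub_cancel, Nat.choose_succ_self_right, Nat.add_sub_cancel_left] at hc hc'
      rw [pow_succ]
      linear_combination (-1 : ℤ) ^ i * (hc - hc')
    rw [e6, sub_neg_eq_add, ← bsum_add q (k + 2)
      (fun i hi => by rw [E_neg _ (by omega)]; simp)
      (fun i hi => by rw [hz2 i hi, smul_zero])]
    congr 1
    funext t
    rw [smul_smul, smul_smul, ← add_smul]
    congr 1
    ring
end GenSys


namespace GenSys

variable {C V : Type*} [AddCommGroup V] [Module ℂ V] (S : GenSys C V)

/-- The map `v ↦ e^{zD} v`. -/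
def phi0 : V →ₗ[ℂ] (ℤ → V) := LinearMap.pi fun n => S.E (-1 - n)

theorem G_phi0 (u : C) (p : ℤ) (hp : 0 ≤ p) : S.G u p S.phi0 = 0 := by
  obtain ⟨P, rfl⟩ := Int.eq_ofNat_of_zero_le hp
  ext v n
  rw [G_apply]
  simp only [phi0, LinearMap.pi_apply, LinearMap.zero_apply, Pi.zero_apply]
  rw [sub_eq_zero]
  rcases lt_or_ge (-1 - n) 0 with h | h
  · rw [E_neg _ h, bsum_natCast]
    simp only [LinearMap.zero_apply, map_zero]
    refine (Finset.sum_eq_zero fun i hi => ?_).symm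
    have : i < P + 1 := by simpa using hi
    rw [E_neg _ (by omega)]
    simp
  · obtain ⟨k, hk⟩ := Int.eq_ofNat_of_zero_le h
    rw [hk, S.cov_E (f := S.g u) (S.D_g u), bsum_natCast_reflect]
    refine bsum_congr_nat P fun i hi => ?_
    rw [Nat.cast_sub hi, show (P : ℤ) - (P - i) = i by ring,
      show -1 - ((P : ℤ) + n - i) = k - (P - i) by omega]

end GenSys

/-- A generating system together with the associated state-field correspondence, `F w v n` being
the vector `v_n w`. -/
structure FieldSys (C V : Type*) [AddCommGroup V] [Module ℂ V] extends GenSys C V where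
  F : V →ₗ[ℂ] V →ₗ[ℂ] (ℤ → V)
  F_vac : F vac = toGenSys.phi0
  F_g : ∀ u p w, F (g u p w) = toGenSys.G u p (F w)

namespace FieldSys

variable {C V : Type*} [AddCommGroup V] [Module ℂ V] (S : FieldSys C V)

/-- The state-field correspondence. -/
def Y : V →ₗ[ℂ] (ℤ → Module.End ℂ V) :=
  LinearMap.pi fun n => (LinearMap.compRight ℂ (LinearMap.proj n) ∘ₗ S.F).flip

theorem Y_apply (v : V) (n : ℤ) (w : V) : S.Y v n w = S.F w v n := rfl

theorem Y_vac (v : V) (n : ℤ) : S.Y v n S.vac = S.E (-1 - n) v := by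
  rw [Y_apply, S.F_vac]; rfl

theorem Y_g (v : V) (n : ℤ) (u : C) (p : ℤ) (w : V) : S.Y v n (S.g u p w) =
    S.g u p (S.Y v n w) - bsum p fun j => S.Y (S.g u j v) (p + n - j) w := by
  rw [Y_apply, S.F_g]; rfl

theorem Y_trunc (v w : V) : ∃ N : ℕ, ∀ n : ℤ, N ≤ n → S.Y v n w = 0 := by
  let T : Submodule ℂ V :=
    { carrier := {w | ∀ v, ∃ N : ℕ, ∀ n : ℤ, N ≤ n → S.Y v n w = 0}
      add_mem' := by
        intro a b ha hb v
        obtain ⟨N, hN⟩ := ha v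
        obtain ⟨M, hM⟩ := hb v
        exact ⟨N + M, fun n hn => by
          rw [map_add, hN n (by push_cast at hn; omega), hM n (by push_cast at hn; omega), add_zero]⟩
      zero_mem' := fun v => ⟨0, fun n _ => map_zero _⟩
      smul_mem' := by
        intro c a ha v
        obtain ⟨N, hN⟩ := ha v
        exact ⟨N, fun n hn => by rw [map_smul, hN n hn, smul_zero]⟩ }
  refine S.ind T ?_ ?_ w v
  · intro v
    exact ⟨0, fun n hn => by rw [Y_vac, S.E_neg (by push_cast at hn; omega)]; rfl⟩
  · intro u p w hw v
    obtain ⟨N, hN⟩ := hw v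
    obtain ⟨L, hL⟩ := S.trunc u v
    choose M hM using fun j : ℕ => hw (S.g u j v)
    refine ⟨N + (∑ j ∈ Finset.range L, M j) + p.natAbs + L, fun n hn => ?_⟩
    push_cast at hn
    have hp1 := abs_nonneg p
    have hp2 := neg_abs_le p
    rw [Y_g, hN n (by have : 0 ≤ ∑ j ∈ Finset.range L, (M j : ℤ) :=
        Finset.sum_nonneg fun _ _ => Int.natCast_nonneg _
                      omega), map_zero, zero_sub, neg_eq_zero,
      bsum_eq_range p L fun i hi => by rw [hL i (by omega)]; simp]
    refine Finset.sum_eq_zero fun j hj => ?_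
    have h1 := Finset.single_le_sum (f := fun j => (M j : ℤ))
      (fun _ _ => Int.natCast_nonneg _) hj
    have h2 : j < L := by simpa using hj
    rw [hM j _ (by omega), smul_zero]

/-- Uniform truncation along the vectors `g u j v`, `j ≥ 0`. -/
theorem Y_trunc_g (u : C) (v w : V) :
    ∃ N : ℕ, ∀ (j : ℕ) (n : ℤ), N ≤ n → S.Y (S.g u j v) n w = 0 := by
  obtain ⟨L, hL⟩ := S.trunc u v
  choose M hM using fun j : ℕ => S.Y_trunc (S.g u j v) w
  refine ⟨∑ j ∈ Finset.range L, M j, fun j n hn => ?_⟩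
  by_cases hj : j < L
  · have h1 := Finset.single_le_sum (f := M) (fun _ _ => Nat.zero_le _) (Finset.mem_range.mpr hj)
    exact hM j n (by omega)
  · rw [hL j (by omega)]; simp

theorem D_Y (v : V) (n : ℤ) (w : V) :
    S.D (S.Y v n w) - S.Y v n (S.D w) = -(n • S.Y v (n - 1) w) := by
  let T : Submodule ℂ V :=
    { carrier := {w | ∀ v n, S.D (S.Y v n w) - S.Y v n (S.D w) = -(n • S.Y v (n - 1) w)}
      add_mem' := by
        intro a b ha hb v n
        simp only [map_add, smul_add, neg_add]
        rw [← ha, ← hb]; abel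
      zero_mem' := fun v n => by simp
      smul_mem' := by
        intro c a ha v n
        simp only [map_smul]
        rw [← smul_sub, ha, smul_neg, smul_comm] }
  refine S.ind T ?_ ?_ w v n
  · intro v n
    rw [S.D_vac, map_zero, Y_vac, Y_vac, S.D_E, show -1 - n + 1 = -1 - (n - 1) by ring, sub_zero,
      ← neg_smul]
    congr 1; ring
  · intro u p w hw v n
    obtain ⟨L, hL⟩ := S.trunc u v
    have hz : ∀ (x : V) (a b : ℤ) (i : ℕ), L ≤ i → S.Y (S.g u i v) (a + b - i) x = 0 :=
      fun x a b i hi => by rw [hL i (by omega)]; simp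
    have h1 := S.D_g u p w
    have h1' : S.g u p (S.D w) + -(p • S.g u (p - 1) w) = S.D (S.g u p w) := by rw [← h1]; abel
    have h2 := S.D_g u p (S.Y v n w)
    have h3 := hw v n
    rw [← h1', map_add, map_neg, map_zsmul, Y_g, Y_g, Y_g, Y_g, map_sub,
      show S.D (bsum p fun j => S.Y (S.g u j v) (p + n - j) w) = _ from
        bsum_map S.D.toAddMonoidHom p L (hz w p n)]
    have h4 : (bsum p fun j => S.D (S.Y (S.g u j v) (p + n - j) w)) -
        (bsum p fun j => S.Y (S.g u j v) (p + n - j) (S.D w)) =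
        -(n • bsum p fun j => S.Y (S.g u j v) (p + (n - 1) - j) w) -
        p • bsum (p - 1) fun j => S.Y (S.g u j v) (p - 1 + n - j) w := by
      rw [← bsum_sub p L (fun i hi => by rw [hz w p n i hi, map_zero]) (hz _ p n),
        ← bsum_weight' p L (hz w (p - 1) n), bsum_smul p n L (hz w p (n - 1)), ← neg_add',
        ← bsum_add p L (fun i hi => by rw [hz w p (n - 1) i hi, smul_zero])
          (fun i hi => by rw [hz w (p - 1) n i hi, smul_zero]),
        ← neg_one_smul ℤ, bsum_smul p (-1) L (fun i hi => by
          rw [hz w (p - 1) n i hi, hz w p (n - 1) i hi, smul_zero, smul_zero, add_zero])]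
      congr 1
      funext j
      rw [hw (S.g u j v) (p + n - j), show p + n - (j : ℤ) - 1 = p + (n - 1) - j by ring,
        show p - 1 + n - (j : ℤ) = p + (n - 1) - j by ring, ← add_smul, neg_one_smul]
      congr 2
      ring
    simp only [LinearMap.toAddMonoidHom_coe]
    have h3' := congrArg (S.g u p) h3
    rw [map_sub, map_neg, map_zsmul] at h3'
    linear_combination (norm := module) h2 + h3' - h4

theorem Y_gen (u : C) (n : ℤ) (w : V) : S.Y (S.g u (-1) S.vac) n w = S.g u n w := by
  let T : Submodule ℂ V :=
    { carrier := {w | ∀ u n, S.Y (S.g u (-1) S.vac) n w = S.g u n w}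
      add_mem' := by intro a b ha hb u n; rw [map_add, map_add, ha, hb]
      zero_mem' := fun v n => by simp
      smul_mem' := by intro c a ha u n; rw [map_smul, map_smul, ha] }
  have hD : ∀ (u : C) (k : ℕ), S.E k (S.g u (-1) S.vac) = S.g u (-1 - k) S.vac := by
    intro u k
    induction k with
    | zero => simp [S.E_zero]
    | succ k ih =>
      have h1 := S.D_E k (S.g u (-1) S.vac)
      have h2 := S.D_g u (-1 - k) S.vac
      rw [S.D_vac, map_zero, sub_zero, ← neg_smul] at h2
      rw [ih, h2] at h1
      refine GenSys.zsmul_cancel (n := (k : ℤ) + 1) (by omega) ?_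
      push_cast
      rw [← h1, show -(-1 - (k : ℤ)) = k + 1 by ring, show -1 - (k : ℤ) - 1 = -1 - (k + 1) by ring]
  refine S.ind T ?_ ?_ w u n
  · intro u n
    rw [Y_vac]
    rcases lt_or_ge (-1 - n) 0 with h | h
    · rw [S.E_neg h, S.g_vac u n (by omega)]; rfl
    · obtain ⟨k, hk⟩ := Int.eq_ofNat_of_zero_le h
      rw [hk, hD]; congr 2; omega
  · intro a p w hw u n
    have hj : ∀ j : ℕ, S.g a j (S.g u (-1) S.vac) =
        S.g (S.op0 a u) (j - 1) S.vac + (j : ℤ) • S.g (S.op1 a u) (j - 2) S.vac := by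
      intro j
      have := S.comm a u j (-1) S.vac
      rw [S.g_vac a j (by omega), map_zero, sub_zero] at this
      rw [this]; congr 3; ring_nf
    rw [Y_g, hw u n, bsum_eq_range p 2 fun i hi => by
      rw [hj, S.g_vac _ _ (by omega), S.g_vac _ _ (by omega)]; simp]
    have h0 : S.g a (0 : ℕ) (S.g u (-1) S.vac) = S.g (S.op0 a u) (-1) S.vac := by
      rw [hj]; simp
    have h1 : S.g a (1 : ℕ) (S.g u (-1) S.vac) = S.g (S.op1 a u) (-1) S.vac := by
      rw [hj, S.g_vac _ _ (by simp)]; simp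
    have hc := S.comm a u p n w
    rw [Finset.sum_range_succ, Finset.sum_range_one, h0, h1, hw, hw]
    simp only [Ring.choose_zero_right, Ring.choose_one_right, one_smul, Nat.cast_zero, sub_zero,
      Nat.cast_one]
    rw [← hc]; abel

end FieldSys


namespace FieldSys

variable {C V : Type*} [AddCommGroup V] [Module ℂ V] (S : FieldSys C V)

/-- The coefficient `∑ (-1)^i (l choose i) x_{m+l-i} y_{n+i} w`. -/
def X (x y : V) (l m n : ℤ) (w : V) : V :=
  bsum l fun i => (-1 : ℤ) ^ i • S.Y x (m + l - i) (S.Y y (n + i) w)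

/-- The difference of the two sides of the coefficient form of the Jacobi identity. -/
def K (x y : V) (l m n : ℤ) (w : V) : V :=
  S.X x y l m n w - (l.negOnePow : ℤ) • S.X y x l n m w -
    bsum m fun i => S.Y (S.Y x (l + i) y) (m + n - i) w

theorem X_rec (x y : V) (l m n : ℤ) (w : V) :
    S.X x y (l + 1) m n w = S.X x y l (m + 1) n w - S.X x y l m (n + 1) w := by
  obtain ⟨N, hN⟩ := S.Y_trunc y w
  have hz : ∀ (a b : ℤ) (i : ℕ), N + n.natAbs ≤ i →
      (-1 : ℤ) ^ i • S.Y x a (S.Y y (n + i) w) = 0 :=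
    fun a b i hi => by rw [hN _ (by omega)]; simp
  have hz' : ∀ (a b : ℤ) (i : ℕ), N + n.natAbs ≤ i →
      (-1 : ℤ) ^ i • S.Y x a (S.Y y (n + 1 + i) w) = 0 :=
    fun a b i hi => by rw [hN _ (by omega)]; simp
  unfold X
  rw [bsum_succ l (N + n.natAbs) (fun i hi => hz _ 0 i hi), sub_eq_add_neg, ← neg_one_smul ℤ (bsum l _),
    bsum_smul l (-1) (N + n.natAbs) (fun i hi => hz' _ 0 i hi)]
  congr 1
  · congr 1; funext i; rw [show m + (l + 1) - (i : ℤ) = m + 1 + l - i by ring]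
  · congr 1; funext i
    push_cast
    rw [show m + (l + 1) - ((i : ℤ) + 1) = m + l - i by ring,
      show n + ((i : ℤ) + 1) = n + 1 + i by ring, smul_smul, pow_succ']

theorem K_rec (x y : V) (l m n : ℤ) (w : V) :
    S.K x y l (m + 1) n w = S.K x y (l + 1) m n w + S.K x y l m (n + 1) w := by
  obtain ⟨N, hN⟩ := S.Y_trunc x y
  have h := bsum_succ m (f := fun i => S.Y (S.Y x (l + i) y) (m + 1 + n - i) w) (N + l.natAbs)
    (fun i hi => by rw [hN _ (by omega)]; simp)
  unfold K
  rw [X_rec, X_rec, h, Int.negOnePow_succ]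
  have e1 : (bsum m fun i : ℕ => S.Y (S.Y x (l + (i + 1 : ℕ)) y) (m + 1 + n - (i + 1 : ℕ)) w) =
      bsum m fun i => S.Y (S.Y x (l + 1 + i) y) (m + n - i) w := by
    congr 1; funext i; push_cast
    rw [show l + ((i : ℤ) + 1) = l + 1 + i by ring,
      show m + 1 + n - ((i : ℤ) + 1) = m + n - i by ring]
  have e2 : (bsum m fun i : ℕ => S.Y (S.Y x (l + i) y) (m + 1 + n - i) w) =
      bsum m fun i => S.Y (S.Y x (l + i) y) (m + (n + 1) - i) w := by
    congr 1; funext i; rw [show m + 1 + n - (i : ℤ) = m + (n + 1) - i by ring]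
  rw [e1, e2]
  push_cast
  module

theorem X_g (x y : V) (l m n : ℤ) (u : C) (p : ℤ) (w : V) :
    S.X x y l m n (S.g u p w) = S.g u p (S.X x y l m n w) -
      ((bsum p fun j => S.X (S.g u j x) y l (m + p - j) n w) +
        bsum p fun j => S.X x (S.g u j y) l m (n + p - j) w) := by
  obtain ⟨N, hN⟩ := S.Y_trunc y w
  obtain ⟨N', hN'⟩ := S.Y_trunc_g u y w
  obtain ⟨L, hL⟩ := S.trunc u x
  obtain ⟨L', hL'⟩ := S.trunc u y
  set M := N + N' + L + L' + n.natAbs + p.natAbs with hM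
  have z1 : ∀ (i : ℕ) (a : ℤ), M ≤ i → (-1 : ℤ) ^ i • S.Y x a (S.Y y (n + i) w) = 0 :=
    fun i a hi => by rw [hN _ (by omega)]; simp
  have z2 : ∀ (i j : ℕ) (a : ℤ), M ≤ i →
      (-1 : ℤ) ^ i • S.Y (S.g u j x) a (S.Y y (n + i) w) = 0 :=
    fun i j a hi => by rw [hN _ (by omega)]; simp
  have z3 : ∀ (i j : ℕ) (a : ℤ), M ≤ j →
      (-1 : ℤ) ^ i • S.Y (S.g u j x) a (S.Y y (n + i) w) = 0 :=
    fun i j a hi => by rw [hL _ (by omega)]; simp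
  have z4 : ∀ (i j : ℕ) (a : ℤ), M ≤ i →
      (-1 : ℤ) ^ i • S.Y x a (S.Y (S.g u j y) (n + p - j + i) w) = 0 := fun i j a hi => by
    by_cases hj : L' ≤ j
    · rw [hL' _ (by omega)]; simp
    · rw [hN' _ _ (by omega)]; simp
  have z5 : ∀ (i j : ℕ) (a : ℤ), M ≤ j →
      (-1 : ℤ) ^ i • S.Y x a (S.Y (S.g u j y) (n + p - j + i) w) = 0 :=
    fun i j a hi => by rw [hL' _ (by omega)]; simp
  have key : ∀ i : ℕ, (-1 : ℤ) ^ i • S.Y x (m + l - i) (S.Y y (n + i) (S.g u p w)) =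
      S.g u p ((-1 : ℤ) ^ i • S.Y x (m + l - i) (S.Y y (n + i) w)) -
      ((bsum p fun j => (-1 : ℤ) ^ i • S.Y (S.g u j x) (m + p - j + l - i) (S.Y y (n + i) w)) +
      bsum p fun j => (-1 : ℤ) ^ i • S.Y x (m + l - i) (S.Y (S.g u j y) (n + p - j + i) w)) := by
    intro i
    have e1 := bsum_map (S.Y x (m + l - i)).toAddMonoidHom p
      (f := fun j => S.Y (S.g u j y) (p + (n + i) - j) w) L'
      (fun j hj => by rw [hL' _ (by omega)]; simp)
    simp only [LinearMap.toAddMonoidHom_coe] at e1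
    rw [Y_g, map_sub, Y_g, e1,
      ← bsum_smul p ((-1) ^ i) L (fun j hj => by rw [hL _ (by omega)]; simp),
      ← bsum_smul p ((-1) ^ i) L' (fun j hj => by rw [hL' _ (by omega)]; simp), map_zsmul,
      smul_sub, smul_sub, sub_sub]
    congr 2
    · congr 2; funext j; rw [show p + (m + l - (i : ℤ)) - j = m + p - j + l - i by ring]
    · congr 2; funext j; rw [show p + (n + (i : ℤ)) - j = n + p - j + i by ring]
  unfold X
  simp_rw [key]
  have hb : ∀ i : ℕ, M ≤ i →
      (bsum p fun j => (-1 : ℤ) ^ i • S.Y (S.g u j x) (m + p - j + l - i) (S.Y y (n + i) w)) = 0 :=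
    fun i hi => by simp only [z2 i _ _ hi, bsum_zero]
  have hb' : ∀ i : ℕ, M ≤ i →
      (bsum p fun j => (-1 : ℤ) ^ i • S.Y x (m + l - i) (S.Y (S.g u j y) (n + p - j + i) w)) = 0 :=
    fun i hi => by simp only [z4 i _ _ hi, bsum_zero]
  rw [bsum_sub l M (fun i hi => by rw [z1 i _ hi, map_zero])
    (fun i hi => by rw [hb i hi, hb' i hi, add_zero]), bsum_add l M hb hb',
    bsum_comm l p M (f := fun i j : ℕ =>
      (-1 : ℤ) ^ i • S.Y (S.g u j x) (m + p - j + l - i) (S.Y y (n + i) w))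
      (fun i j hi => z2 i j _ hi) (fun i j hj => z3 i j _ hj),
    bsum_comm l p M (f := fun i j : ℕ =>
      (-1 : ℤ) ^ i • S.Y x (m + l - i) (S.Y (S.g u j y) (n + p - j + i) w))
      (fun i j hi => z4 i j _ hi) (fun i j hj => z5 i j _ hj)]
  congr 1
  exact (bsum_map (S.g u p).toAddMonoidHom l M (fun i hi => z1 i _ hi)).symm

/-- The modes `g u p` move through the iterate side of the Jacobi identity. -/
theorem H_g (x y : V) (l m n : ℤ) (u : C) (p : ℤ) (w : V) :
    (bsum m fun i => S.Y (S.Y x (l + i) y) (m + n - i) (S.g u p w)) =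
      S.g u p (bsum m fun i => S.Y (S.Y x (l + i) y) (m + n - i) w) -
      ((bsum p fun j => bsum (m + p - j) fun i =>
          S.Y (S.Y (S.g u j x) (l + i) y) (m + p - j + n - i) w) +
        bsum p fun j => bsum m fun i => S.Y (S.Y x (l + i) (S.g u j y)) (m + (n + p - j) - i) w) := by
  obtain ⟨N, hN⟩ := S.Y_trunc x y
  obtain ⟨N', hN'⟩ := S.Y_trunc_g u x y
  obtain ⟨L, hL⟩ := S.trunc u x
  obtain ⟨L', hL'⟩ := S.trunc u y
  choose Q hQ using fun j : ℕ => S.Y_trunc x (S.g u j y)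
  set M := N + N' + L + L' + l.natAbs + ∑ j ∈ Finset.range L', Q j with hM
  have z1 : ∀ (i : ℕ) (a : ℤ), M ≤ i → S.Y (S.Y x (l + i) y) a w = 0 :=
    fun i a hi => by rw [hN _ (by omega)]; simp
  have z2 : ∀ (i j : ℕ) (a : ℤ), M ≤ j → S.Y (S.Y x (l + i) (S.g u j y)) a w = 0 :=
    fun i j a hi => by rw [hL' _ (by omega)]; simp
  have z3 : ∀ (i j : ℕ) (a : ℤ), M ≤ i → S.Y (S.Y x (l + i) (S.g u j y)) a w = 0 := by
    intro i j a hi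
    by_cases hj : j < L'
    · have h1 := Finset.single_le_sum (f := Q) (fun _ _ => Nat.zero_le _) (Finset.mem_range.mpr hj)
      rw [hQ j _ (by omega)]; simp
    · rw [hL' _ (by omega)]; simp
  have z4 : ∀ (s r : ℕ) (a : ℤ), M ≤ r → S.Y (S.Y (S.g u s x) (l + r) y) a w = 0 :=
    fun s r a hr => by rw [hN' _ _ (by omega)]; simp
  have z5 : ∀ (s : ℕ) (a b : ℤ), M ≤ s → S.Y (S.Y (S.g u s x) a y) b w = 0 :=
    fun s a b hr => by rw [hL _ (by omega)]; simp
  -- the contribution of a fixed `i`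
  have key : ∀ i : ℕ, S.Y (S.Y x (l + i) y) (m + n - i) (S.g u p w) =
      S.g u p (S.Y (S.Y x (l + i) y) (m + n - i) w) -
      ((bsum p fun s => bsum (p - s) fun j =>
        S.Y (S.Y (S.g u s x) (l + (i + j : ℕ)) y) (m + p - s + n - (i + j : ℕ)) w) +
      bsum p fun j => S.Y (S.Y x (l + i) (S.g u j y)) (m + (n + p - j) - i) w) := by
    intro i
    have e0 : ∀ j : ℕ, S.Y (S.g u j (S.Y x (l + i) y)) (p + (m + n - i) - j) w =
        (bsum (j : ℤ) fun s =>
          S.Y (S.Y (S.g u s x) (j + (l + i) - s) y) (p + (m + n - i) - j) w) +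
        S.Y (S.Y x (l + i) (S.g u j y)) (m + (n + p - j) - i) w := by
      intro j
      have h1 := S.Y_g x (l + i) u j y
      have h2 := bsum_map ((LinearMap.applyₗ w) ∘ₗ (LinearMap.proj (p + (m + n - i) - j)) ∘ₗ
        S.Y).toAddMonoidHom (j : ℤ) (f := fun s => S.Y (S.g u s x) (j + (l + i) - s) y) L
        (fun s hs => by rw [hL _ (by omega)]; simp)
      simp only [LinearMap.toAddMonoidHom_coe, LinearMap.coe_comp, Function.comp_apply,
        LinearMap.proj_apply, LinearMap.applyₗ_apply_apply] at h2
      rw [← h2, show m + (n + p - j) - (i : ℤ) = p + (m + n - i) - j by ring, ← LinearMap.add_apply,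
        ← Pi.add_apply, ← map_add, h1]
      congr 3
      abel_nf
    have zz : ∀ j : ℕ, M + i + L + L' ≤ j →
        S.Y (S.Y x (l + i) (S.g u j y)) (m + (n + p - j) - i) w = 0 :=
      fun j hj => z2 i j _ (by omega)
    have zt : ∀ (s j : ℕ), M + i + L + L' ≤ s →
        S.Y (S.Y (S.g u s x) (j + (l + i) - s) y) (p + (m + n - i) - j) w = 0 :=
      fun s j hs => z5 s _ _ (by omega)
    have zt' : ∀ (s j : ℕ), M + i + L + L' ≤ j →
        S.Y (S.Y (S.g u s x) (j + (l + i) - s) y) (p + (m + n - i) - j) w = 0 := by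
      intro s j hj
      by_cases hs : s < L
      · rw [hN' _ _ (by omega)]; simp
      · rw [hL _ (by omega)]; simp
    rw [Y_g]
    simp_rw [e0]
    rw [bsum_add p (M + i + L + L') (fun j hj => by simp only [zt' _ j hj, bsum_zero]) zz,
      bsum_trinom p (M + i + L + L') zt zt']
    congr 3
    funext s
    congr 1
    funext j
    push_cast
    rw [show (s : ℤ) + j + (l + i) - s = l + (i + j) by ring,
      show p + (m + n - (i : ℤ)) - (s + j) = m + p - s + n - (i + j) by ring]
  simp_rw [key]
  have y1 : ∀ i : ℕ, M ≤ i → (bsum p fun s => bsum (p - s) fun j =>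
        S.Y (S.Y (S.g u s x) (l + (i + j : ℕ)) y) (m + p - s + n - (i + j : ℕ)) w) = 0 := by
    intro i hi
    have : ∀ s j : ℕ,
        S.Y (S.Y (S.g u s x) (l + (i + j : ℕ)) y) (m + p - s + n - (i + j : ℕ)) w = 0 :=
      fun s j => z4 _ _ _ (by omega)
    simp only [this, bsum_zero]
  have y2 : ∀ i : ℕ, M ≤ i →
      (bsum p fun j => S.Y (S.Y x (l + i) (S.g u j y)) (m + (n + p - j) - i) w) = 0 :=
    fun i hi => by simp only [z3 i _ _ hi, bsum_zero]
  rw [bsum_sub m M (fun i hi => by rw [z1 i _ hi, map_zero])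
    (fun i hi => by rw [y1 i hi, y2 i hi, add_zero]), bsum_add m M y1 y2]
  have c1 := bsum_map (S.g u p).toAddMonoidHom m M
    (f := fun i => S.Y (S.Y x (l + i) y) (m + n - i) w) (fun i hi => z1 i _ hi)
  have c2 := bsum_comm m p M (f := fun i j : ℕ =>
      S.Y (S.Y x (l + i) (S.g u j y)) (m + (n + p - j) - i) w)
      (fun i j hi => z3 i j _ hi) (fun i j hj => z2 i j _ hj)
  have c3 := bsum_comm m p M (f := fun i s : ℕ => bsum (p - s) fun j =>
      S.Y (S.Y (S.g u s x) (l + (i + j : ℕ)) y) (m + p - s + n - (i + j : ℕ)) w)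
      (fun i s hi => by
        have : ∀ j : ℕ,
            S.Y (S.Y (S.g u s x) (l + (i + j : ℕ)) y) (m + p - s + n - (i + j : ℕ)) w = 0 :=
          fun j => z4 _ _ _ (by omega)
        simp only [this, bsum_zero])
      (fun i s hs => by simp only [z5 s _ _ hs, bsum_zero])
  simp only [LinearMap.toAddMonoidHom_coe] at c1
  rw [c1, c2, c3]
  congr 3
  funext s
  rw [bsum_diag m (p - s) (h := fun r : ℕ =>
    S.Y (S.Y (S.g u s x) (l + r) y) (m + p - s + n - r) w) M (fun r hr => z4 _ _ _ hr),
    show m + (p - (s : ℤ)) = m + p - s by ring]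

theorem K_g (x y : V) (l m n : ℤ) (u : C) (p : ℤ) (w : V)
    (h0 : S.K x y l m n w = 0)
    (h1 : ∀ j : ℕ, S.K (S.g u j x) y l (m + p - j) n w = 0)
    (h2 : ∀ j : ℕ, S.K x (S.g u j y) l m (n + p - j) w = 0) :
    S.K x y l m n (S.g u p w) = 0 := by
  obtain ⟨L, hL⟩ := S.trunc u x
  obtain ⟨L', hL'⟩ := S.trunc u y
  have zX : ∀ (y : V) (l m n : ℤ), S.X 0 y l m n w = 0 := fun y l m n => by
    simp [X, bsum_zero]
  have zX' : ∀ (y : V) (l m n : ℤ), S.X y 0 l m n w = 0 := fun y l m n => by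
    simp [X, bsum_zero]
  have e : ∀ (f1 f2 f3 : ℕ → V) (N : ℕ) (_ : ∀ i, N ≤ i → f1 i = 0) (_ : ∀ i, N ≤ i → f2 i = 0)
      (_ : ∀ i, f1 i - (l.negOnePow : ℤ) • f2 i - f3 i = 0),
      bsum p f1 - (l.negOnePow : ℤ) • bsum p f2 - bsum p f3 = 0 := by
    intro f1 f2 f3 N a1 a2 a3
    rw [bsum_smul p _ N a2, ← bsum_sub p N a1 (fun i hi => by rw [a2 i hi, smul_zero]), sub_eq_zero]
    congr 1
    funext i
    exact sub_eq_zero.mp (a3 i)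
  have e1 := e (fun j => S.X (S.g u j x) y l (m + p - j) n w)
    (fun j => S.X y (S.g u j x) l n (m + p - j) w) _ L
    (fun j hj => by rw [hL _ (by omega), zX]) (fun j hj => by rw [hL _ (by omega), zX']) h1
  have e2 := e (fun j => S.X x (S.g u j y) l m (n + p - j) w)
    (fun j => S.X (S.g u j y) x l (n + p - j) m w) _ L'
    (fun j hj => by rw [hL' _ (by omega), zX']) (fun j hj => by rw [hL' _ (by omega), zX]) h2
  have h0' := congrArg (S.g u p) h0
  unfold K at h0' ⊢
  rw [map_sub, map_sub, map_zsmul, map_zero] at h0'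
  rw [X_g, X_g, H_g]
  linear_combination (norm := module) h0' - e1 - e2

end FieldSys

theorem K_propagate {V : Type*} [AddCommGroup V] (K : ℤ → ℤ → ℤ → V)
    (hrec : ∀ l m n, K l (m + 1) n = K (l + 1) m n + K l m (n + 1))
    (h0 : ∀ l n, K l 0 n = 0) (h1 : ∀ m n, K 0 m n = 0) (l m n : ℤ) : K l m n = 0 := by
  induction l using Int.induction_on generalizing m n with
  | zero => exact h1 m n
  | succ l ih =>
    have := hrec l m n
    rw [ih, ih, add_zero] at this
    exact this.symm
  | pred l ih =>
    have hr : ∀ m n, K (-l - 1) (m + 1) n = K (-l - 1) m (n + 1) := by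
      intro m n
      rw [hrec, sub_add_cancel, ih, zero_add]
    induction m using Int.induction_on generalizing n with
    | zero => exact h0 _ n
    | succ m ihm => rw [hr, ihm]
    | pred m ihm =>
      have := hr (-m - 1) (n - 1)
      rw [sub_add_cancel, sub_add_cancel, ihm] at this
      exact this.symm


namespace FieldSys

variable {C V : Type*} [AddCommGroup V] [Module ℂ V] (S : FieldSys C V)

theorem X_vac (x y : V) (l m n : ℤ) :
    S.X x y l m n S.vac = bsum l fun i => (-1 : ℤ) ^ i • S.Y x (m + l - i) (S.E (-1 - n - i) y) := by
  unfold X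
  congr 1; funext i
  rw [Y_vac, show -1 - (n + (i : ℤ)) = -1 - n - i by ring]

theorem X_vac_of_nonneg (x y : V) (l m n : ℤ) (hn : 0 ≤ n) : S.X x y l m n S.vac = 0 := by
  rw [X_vac]
  have : ∀ i : ℕ, (-1 : ℤ) ^ i • S.Y x (m + l - i) (S.E (-1 - n - i) y) = 0 := fun i => by
    rw [S.E_neg (by omega)]; simp
  simp only [this, bsum_zero]

theorem X_vac_zero (x y : V) (l n : ℤ) : S.X x y l 0 n S.vac = S.E (-1 - n) (S.Y x l y) := by
  rcases lt_or_ge (-1 - n) 0 with h | h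
  · rw [X_vac_of_nonneg _ _ _ _ _ _ (by omega), S.E_neg h]; rfl
  · obtain ⟨k, hk⟩ := Int.eq_ofNat_of_zero_le h
    rw [X_vac, hk, S.cov_E' (f := S.Y x) (S.D_Y x)]
    simp only [zero_add]

theorem K_vac_zero (x y : V) (l n : ℤ) : S.K x y l 0 n S.vac = 0 := by
  unfold K
  rw [X_vac_zero, X_vac_of_nonneg _ _ _ _ _ _ le_rfl, bsum_zero_left, Y_vac]
  simp

theorem K_zero_gen (u : C) (y : V) (m n : ℤ) (w : V) :
    S.K (S.g u (-1) S.vac) y 0 m n w = 0 := by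
  have h := S.Y_g y n u m w
  unfold K X
  rw [bsum_zero_left, bsum_zero_left]
  simp only [Y_gen, zero_add]
  simp only [pow_zero, one_smul, Nat.cast_zero, add_zero, sub_zero, Int.negOnePow_zero,
    Units.val_one]
  rw [h]
  abel

theorem K_add (x y : V) (l m n : ℤ) (a b : V) :
    S.K x y l m n (a + b) = S.K x y l m n a + S.K x y l m n b := by
  obtain ⟨N, hN⟩ := S.Y_trunc x a
  obtain ⟨N', hN'⟩ := S.Y_trunc x b
  obtain ⟨M, hM⟩ := S.Y_trunc y a
  obtain ⟨M', hM'⟩ := S.Y_trunc y b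
  obtain ⟨L, hL⟩ := S.Y_trunc x y
  unfold K X
  simp only [map_add, smul_add]
  rw [bsum_add l (M + M' + n.natAbs) (fun i hi => by rw [hM _ (by omega)]; simp)
      (fun i hi => by rw [hM' _ (by omega)]; simp),
    bsum_add l (N + N' + m.natAbs) (fun i hi => by rw [hN _ (by omega)]; simp)
      (fun i hi => by rw [hN' _ (by omega)]; simp),
    bsum_add m (L + l.natAbs) (fun i hi => by rw [hL _ (by omega)]; simp)
      (fun i hi => by rw [hL _ (by omega)]; simp)]
  module

theorem K_smul (x y : V) (l m n : ℤ) (c : ℂ) (a : V) :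
    S.K x y l m n (c • a) = c • S.K x y l m n a := by
  obtain ⟨N, hN⟩ := S.Y_trunc x a
  obtain ⟨M, hM⟩ := S.Y_trunc y a
  obtain ⟨L, hL⟩ := S.Y_trunc x y
  unfold K X
  have hs : ∀ (p : ℤ) (f : ℕ → V) (N : ℕ), (∀ i, N ≤ i → f i = 0) →
      (bsum p fun i => c • f i) = c • bsum p f := fun p f N h =>
    (bsum_map (DistribSMul.toAddMonoidHom V c) p N h).symm
  simp only [map_smul, smul_comm _ c]
  rw [hs l _ (M + n.natAbs) (fun i hi => by rw [hM _ (by omega)]; simp),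
    hs l _ (N + m.natAbs) (fun i hi => by rw [hN _ (by omega)]; simp),
    hs m _ (L + l.natAbs) (fun i hi => by rw [hL _ (by omega)]; simp)]
  module

theorem K_gen (u : C) (y : V) (l m n : ℤ) (w : V) : S.K (S.g u (-1) S.vac) y l m n w = 0 := by
  let T : Submodule ℂ V :=
    { carrier := {w | ∀ u y l m n, S.K (S.g u (-1) S.vac) y l m n w = 0}
      add_mem' := by intro a b ha hb u y l m n; rw [S.K_add, ha, hb, add_zero]
      zero_mem' := fun u y l m n => by
        have := S.K_smul (S.g u (-1) S.vac) y l m n 0 0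
        simpa using this
      smul_mem' := by intro c a ha u y l m n; rw [S.K_smul, ha, smul_zero] }
  have zK : ∀ y l m n w, S.K 0 y l m n w = 0 := by
    intro y l m n w
    simp [K, X, bsum_zero]
  refine S.ind T ?_ ?_ w u y l m n
  · intro u y l m n
    exact K_propagate (fun l m n => S.K (S.g u (-1) S.vac) y l m n S.vac)
      (fun l m n => S.K_rec _ _ l m n _) (fun l n => S.K_vac_zero _ _ l n)
      (fun m n => S.K_zero_gen u y m n _) l m n
  · intro a p w hw u y l m n
    refine S.K_g _ _ _ _ _ _ _ _ (hw u y l m n) (fun j => ?_) (fun j => hw u _ _ _ _)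
    have hj := S.comm a u j (-1) S.vac
    rw [S.g_vac a j (by omega), map_zero, sub_zero] at hj
    rw [hj]
    rcases Nat.lt_trichotomy j 1 with h | h | h
    · obtain rfl : j = 0 := by omega
      simpa using hw (S.op0 a u) y l (m + p) n
    · subst h
      rw [S.g_vac _ _ (by simp)]
      simpa using hw (S.op1 a u) y l (m + p - 1) n
    · rw [S.g_vac _ _ (by omega), S.g_vac _ _ (by omega), smul_zero, add_zero, zK]

/-- The product formula for the modes of `g u p w`. -/
theorem Y_g_left (u : C) (p : ℤ) (w : V) (q : ℤ) (v : V) :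
    S.Y (S.g u p w) q v = (bsum p fun s => (-1 : ℤ) ^ s • S.g u (p - s) (S.Y w (q + s) v)) -
      (p.negOnePow : ℤ) • bsum p fun s => (-1 : ℤ) ^ s • S.Y w (q + p - s) (S.g u s v) := by
  have h := S.K_gen u w p 0 q v
  unfold K X at h
  rw [bsum_zero_left] at h
  simp only [Y_gen, zero_add, Nat.cast_zero, add_zero, sub_zero] at h
  exact (sub_eq_zero.mp h).symm

/-- The right-hand side of the skew symmetry formula. -/
def Sk (v : V) (n : ℤ) (w : V) : V :=
  -((n.negOnePow : ℤ) • bsum (-1) fun i => S.E i (S.Y w (n + i) v))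

theorem Sk_g (v : V) (n : ℤ) (u : C) (p : ℤ) (w : V) : S.Sk v n (S.g u p w) =
    S.g u p (S.Sk v n w) - bsum p fun s => S.Sk (S.g u s v) (p + n - s) w := by
  obtain ⟨N, hN⟩ := S.Y_trunc w v
  obtain ⟨L, hL⟩ := S.trunc u v
  choose Q hQ using fun s : ℕ => S.Y_trunc w (S.g u s v)
  set M := N + n.natAbs + L + p.natAbs + ∑ j ∈ Finset.range L, Q j with hM
  let f : ℕ → ℕ → ℕ → V := fun i s j =>
    (-1 : ℤ) ^ j • S.g u (p - j) (S.E (i + s - j) (S.Y w (n + i + s) v))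
  have f1 : ∀ i s j, M ≤ i → f i s j = 0 := fun i s j h => by
    simp only [f]; rw [hN _ (by omega)]; simp
  have f2 : ∀ i s j, M ≤ s → f i s j = 0 := fun i s j h => by
    simp only [f]; rw [hN _ (by omega)]; simp
  have f3 : ∀ i s j, M ≤ j → f i s j = 0 := fun i s j h => by
    simp only [f]
    by_cases hh : (i : ℤ) + s < j
    · rw [S.E_neg (by omega)]; simp
    · rw [hN _ (by omega)]; simp
  have q1 : ∀ (i s : ℕ) (a : ℤ), M ≤ s → S.Y w a (S.g u s v) = 0 :=
    fun i s a h => by rw [hL _ (by omega)]; simp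
  have q2 : ∀ (i s : ℕ), M ≤ i → S.Y w (n + p - s + i) (S.g u s v) = 0 := by
    intro i s h
    by_cases hs : s < L
    · have h1 := Finset.single_le_sum (f := Q) (fun _ _ => Nat.zero_le _) (Finset.mem_range.mpr hs)
      exact hQ s _ (by omega)
    · rw [hL _ (by omega)]; simp
  -- first half
  have A : (bsum (-1) fun i : ℕ => S.E i (bsum p fun s =>
      (-1 : ℤ) ^ s • S.g u (p - s) (S.Y w (n + i + s) v))) =
      S.g u p (bsum (-1) fun i => S.E i (S.Y w (n + i) v)) := by
    have a1 : ∀ i : ℕ, S.E i (bsum p fun s => (-1 : ℤ) ^ s • S.g u (p - s) (S.Y w (n + i + s) v)) =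
        bsum p fun j => bsum (j : ℤ) fun s => f i s j := by
      intro i
      have b1 := bsum_map (S.E i).toAddMonoidHom p
        (f := fun s => (-1 : ℤ) ^ s • S.g u (p - s) (S.Y w (n + i + s) v)) M
        (fun s hs => by rw [hN _ (by omega)]; simp)
      simp only [LinearMap.toAddMonoidHom_coe, map_zsmul] at b1
      rw [b1, bsum_trinom p M (fun s j h => f2 i s j h) (fun s j h => f3 i s j h)]
      congr 1; funext s
      rw [S.cov_E' (f := S.g u) (S.D_g u), bsum_smul _ _ (i + 1) (fun t ht => by
        rw [S.E_neg (by omega)]; simp)]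
      congr 1; funext t
      simp only [f]
      push_cast
      rw [smul_smul, pow_add, show p - ((s : ℤ) + t) = p - s - t by ring,
        show (i : ℤ) + s - (s + t) = i - t by ring]
    simp_rw [a1]
    rw [bsum_comm (-1) p M (f := fun i j => bsum (j : ℤ) fun s => f i s j)
      (fun i j h => by simp only [f1 i _ j h, bsum_zero])
      (fun i j h => by simp only [f3 i _ j h, bsum_zero])]
    have a2 : ∀ j : ℕ, (bsum (-1) fun i => bsum (j : ℤ) fun s => f i s j) =
        if j = 0 then S.g u p (bsum (-1) fun i => S.E i (S.Y w (n + i) v)) else 0 := by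
      intro j
      rw [bsum_comm (-1) (j : ℤ) M (f := fun i s => f i s j) (fun i s h => f1 i s j h)
        (fun i s h => f2 i s j h)]
      let Z : V := bsum (-1) fun r : ℕ => S.g u (p - j) (S.E r (S.Y w (n + j + r) v))
      have a3 : (bsum (j : ℤ) fun s => bsum (-1) fun i => f i s j) =
          bsum (j : ℤ) fun s => (-1 : ℤ) ^ s • Z := by
        refine bsum_congr_nat j fun s hs => ?_
        rw [bsum_neg_one_shift (j - s) M (fun i h => f1 i s j h) (fun i hi => by
          simp only [f]; rw [S.E_neg (by omega)]; simp)]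
        have a4 : ∀ r : ℕ, f (j - s + r) s j =
            (-1 : ℤ) ^ j • S.g u (p - j) (S.E r (S.Y w (n + j + r) v)) := by
          intro r
          simp only [f]
          push_cast [Nat.cast_sub hs]
          rw [show (j : ℤ) - s + r + s - j = r by ring,
            show n + ((j : ℤ) - s + r) + s = n + j + r by ring]
        simp_rw [a4]
        rw [← bsum_smul _ _ M (fun r hr => by rw [hN _ (by omega)]; simp), smul_smul]
        congr 1
        obtain ⟨d, rfl⟩ := Nat.exists_eq_add_of_le hs
        rw [show s + d - s = d by omega, ← pow_add, show d + (s + d) = s + 2 * d by ring, pow_add,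
          pow_mul]
        simp
      rw [a3, bsum_natCast]
      simp_rw [smul_smul]
      rw [← Finset.sum_smul]
      have a5 : ∑ i ∈ Finset.range (j + 1), ((j.choose i : ℤ) * (-1) ^ i) =
          if j = 0 then 1 else 0 := by
        rw [← Int.alternating_sum_range_choose]
        exact Finset.sum_congr rfl fun i _ => mul_comm _ _
      rw [a5]
      split_ifs with hj
      · subst hj
        rw [one_smul]
        have := bsum_map (S.g u p).toAddMonoidHom (-1)
          (f := fun i => S.E i (S.Y w (n + i) v)) M (fun i hi => by rw [hN _ (by omega)]; simp)
        simp only [LinearMap.toAddMonoidHom_coe] at this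
        rw [this]
        simp [Z]
      · rw [zero_smul]
    simp_rw [a2]
    rw [bsum_eq_range p 1 (fun i hi => if_neg (by omega))]
    simp
  -- second half
  have B : (bsum (-1) fun i : ℕ => S.E i (bsum p fun s =>
      (-1 : ℤ) ^ s • S.Y w (n + i + p - s) (S.g u s v))) =
      bsum p fun s : ℕ => (-1 : ℤ) ^ s • bsum (-1) fun i : ℕ =>
        S.E i (S.Y w (p + n - s + i) (S.g u s v)) := by
    have b0 : ∀ i : ℕ, S.E i (bsum p fun s => (-1 : ℤ) ^ s • S.Y w (n + i + p - s) (S.g u s v)) =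
        bsum p fun s => (-1 : ℤ) ^ s • S.E i (S.Y w (n + p - s + i) (S.g u s v)) := by
      intro i
      have b1 := bsum_map (S.E i).toAddMonoidHom p
        (f := fun s => (-1 : ℤ) ^ s • S.Y w (n + i + p - s) (S.g u s v)) M
        (fun s hs => by rw [q1 0 s _ hs, smul_zero])
      simp only [LinearMap.toAddMonoidHom_coe, map_zsmul] at b1
      rw [b1]
      congr 1; funext s
      rw [show n + (i : ℤ) + p - s = n + p - s + i by ring]
    simp_rw [b0]
    rw [bsum_comm (-1) p M (f := fun i s : ℕ =>
      (-1 : ℤ) ^ s • S.E i (S.Y w (n + p - s + i) (S.g u s v)))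
      (fun i s h => by rw [q2 i s h]; simp) (fun i s h => by rw [q1 0 s _ h]; simp)]
    congr 1; funext s
    rw [← bsum_smul _ _ M (fun i h => by rw [q2 i s h]; simp), add_comm n p]
  have z1 : ∀ i : ℕ, M ≤ i → (bsum p fun s =>
      (-1 : ℤ) ^ s • S.g u (p - s) (S.Y w (n + i + s) v)) = 0 := by
    intro i hi
    have : ∀ s : ℕ, S.Y w (n + i + s) v = 0 := fun s => hN _ (by omega)
    simp only [this, map_zero, smul_zero, bsum_zero]
  have z2 : ∀ i : ℕ, M ≤ i → (bsum p fun s =>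
      (-1 : ℤ) ^ s • S.Y w (n + i + p - s) (S.g u s v)) = 0 := by
    intro i hi
    have : ∀ s : ℕ, S.Y w (n + i + p - s) (S.g u s v) = 0 := fun s => by
      rw [show n + (i : ℤ) + p - s = n + p - s + i by ring, q2 i s hi]
    simp only [this, smul_zero, bsum_zero]
  have main : (bsum (-1) fun i : ℕ => S.E i (S.Y (S.g u p w) (n + i) v)) =
      S.g u p (bsum (-1) fun i => S.E i (S.Y w (n + i) v)) - (p.negOnePow : ℤ) •
      bsum p fun s : ℕ => (-1 : ℤ) ^ s • bsum (-1) fun i : ℕ =>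
        S.E i (S.Y w (p + n - s + i) (S.g u s v)) := by
    rw [← A, ← B, bsum_smul _ _ M (fun i hi => by rw [z2 i hi, map_zero]),
      ← bsum_sub _ M (fun i hi => by rw [z1 i hi, map_zero])
        (fun i hi => by rw [z2 i hi, map_zero, smul_zero])]
    congr 1; funext i
    rw [Y_g_left, map_sub, map_zsmul]
  unfold Sk
  rw [main, map_neg, map_zsmul, smul_sub, neg_sub, sub_eq_neg_add, sub_eq_add_neg]
  congr 1
  rw [smul_smul, ← neg_one_smul ℤ (bsum p _), bsum_smul p _ M (fun s hs => by
      simp only [q1 0 s _ hs, map_zero, bsum_zero, smul_zero]),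
    bsum_smul p _ M (fun s hs => by
      simp only [q1 0 s _ hs, map_zero, bsum_zero, smul_zero, neg_zero])]
  congr 1; funext s
  rw [neg_one_smul, neg_neg, smul_smul]
  congr 1
  rw [Int.negOnePow_sub, Int.negOnePow_add]
  push_cast
  rw [Int.negOnePow_def (s : ℤ), zpow_natCast]
  push_cast
  ring

theorem vac_Y (n : ℤ) (w : V) : S.Y S.vac n w = if n = -1 then w else 0 := by
  let T : Submodule ℂ V :=
    { carrier := {w | ∀ n, S.Y S.vac n w = if n = -1 then w else 0}
      add_mem' := by intro a b ha hb n; rw [map_add, ha, hb]; split_ifs <;> simp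
      zero_mem' := fun n => by simp
      smul_mem' := by intro c a ha n; rw [map_smul, ha]; split_ifs <;> simp }
  refine S.ind T ?_ ?_ w n
  · intro n
    rw [Y_vac, S.E_vac]
    congr 1
    simp only [eq_iff_iff]
    omega
  · intro u p w hw n
    have : ∀ j : ℕ, S.g u j S.vac = 0 := fun j => S.g_vac u j (by omega)
    rw [Y_g, hw]
    simp only [this, map_zero, Pi.zero_apply, LinearMap.zero_apply, bsum_zero, sub_zero]
    split_ifs <;> simp

/-- Skew symmetry. -/
theorem skew (v : V) (n : ℤ) (w : V) : S.Y v n w = S.Sk v n w := by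
  let T : Submodule ℂ V :=
    { carrier := {w | ∀ v n, S.Y v n w = S.Sk v n w}
      add_mem' := by
        intro a b ha hb v n
        obtain ⟨N, hN⟩ := S.Y_trunc a v
        obtain ⟨M, hM⟩ := S.Y_trunc b v
        rw [map_add, ha, hb]
        unfold Sk
        simp only [map_add, Pi.add_apply, LinearMap.add_apply]
        rw [bsum_add _ (N + M + n.natAbs) (fun i hi => by rw [hN _ (by omega)]; simp)
          (fun i hi => by rw [hM _ (by omega)]; simp)]
        module
      zero_mem' := fun v n => by simp [Sk, bsum_zero]
      smul_mem' := by
        intro c a ha v n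
        obtain ⟨N, hN⟩ := S.Y_trunc a v
        rw [map_smul, ha]
        unfold Sk
        simp only [map_smul, Pi.smul_apply, LinearMap.smul_apply]
        have := bsum_map (DistribSMul.toAddMonoidHom V c) (-1)
          (f := fun i => S.E i (S.Y a (n + i) v)) (N + n.natAbs)
          (fun i hi => by rw [hN _ (by omega)]; simp)
        simp only [DistribSMul.toAddMonoidHom_apply] at this
        rw [← this]
        module }
  refine S.ind T ?_ ?_ w v n
  · intro v n
    unfold Sk
    simp only [vac_Y]
    rw [Y_vac]
    rcases lt_or_ge (-1 - n) 0 with h | h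
    · have : ∀ i : ℕ, (if n + (i : ℤ) = -1 then v else 0) = 0 := fun i => if_neg (by omega)
      simp only [this, map_zero, bsum_zero]
      rw [S.E_neg h]
      simp
    · obtain ⟨k, hk⟩ := Int.eq_ofNat_of_zero_le h
      rw [bsum_neg_one_shift k (k + 1) (fun i hi => by rw [if_neg (by omega), map_zero])
        (fun i hi => by rw [if_neg (by omega), map_zero]),
        bsum_eq_range _ 1 (fun i hi => by rw [if_neg (by push_cast; omega), map_zero])]
      have : n = -1 - k := by omega
      subst this
      simp only [Finset.sum_range_one, Ring.choose_zero_right, one_smul, add_zero, sub_add_cancel,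
        if_true, smul_smul]
      rw [Int.negOnePow_sub]
      simp only [Int.negOnePow_def]
      rw [← neg_smul]
      have h1 : -((((-1 : ℤˣ) ^ (-1 : ℤ) * (-1 : ℤˣ) ^ (k : ℤ) : ℤˣ) : ℤ) * (-1) ^ k) = 1 := by
        push_cast
        simp only [zpow_natCast, zpow_neg_one]
        push_cast
        rw [show ((-1 : ℤˣ)⁻¹ : ℤˣ) = -1 by rfl]
        push_cast
        rw [neg_mul, one_mul, neg_mul, neg_neg, ← mul_pow]
        simp
      rw [h1, one_smul]
      congr 2
  · intro u p w hw v n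
    rw [Y_g, Sk_g, hw]
    congr 2
    funext s
    rw [hw]

theorem K_vac_nonneg (x y : V) (m : ℕ) : ∀ l n : ℤ, S.K x y l m n S.vac = 0 := by
  induction m with
  | zero => intro l n; exact S.K_vac_zero x y l n
  | succ m ih => intro l n; push_cast; rw [K_rec, ih, ih, add_zero]

theorem K_vac_neg (x y : V) (k : ℕ) (l : ℤ) : S.K x y l (-1 - k) 0 S.vac = 0 := by
  unfold K
  rw [X_vac_of_nonneg _ _ _ _ _ _ le_rfl, X_vac_zero, S.skew y l x]
  unfold Sk
  obtain ⟨N, hN⟩ := S.Y_trunc x y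
  have hz : ∀ i : ℕ, N + l.natAbs ≤ i → S.E i (S.Y x (l + i) y) = 0 :=
    fun i hi => by rw [hN _ (by omega)]; simp
  have e := bsum_map (S.E k).toAddMonoidHom (-1) _ hz
  simp only [LinearMap.toAddMonoidHom_coe] at e
  rw [show -1 - (-1 - (k : ℤ)) = k by ring, map_neg, map_zsmul, e, smul_neg, smul_smul,
    ← Units.val_mul, ← Int.negOnePow_add, Int.negOnePow_even _ ⟨l, rfl⟩, Units.val_one, one_smul,
    zero_sub, neg_neg, sub_eq_zero]
  unfold bsum
  congr 1
  funext i
  simp only [Y_vac, S.E_E, smul_smul]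
  congr 2
  · rw [choose_neg_one, show (-1 - (k : ℤ)) = -(k + 1) by ring, Ring.choose_neg,
      show (k : ℤ) + 1 + i - 1 = ((k + i : ℕ) : ℤ) by push_cast; ring, Ring.choose_natCast,
      Int.negOnePow_def, Units.smul_def, Nat.choose_symm_add]
    simp
  · rw [show -1 - (-1 - (k : ℤ) + 0 - i) = k + i by ring]

theorem K_vac (x y : V) (l m n : ℤ) : S.K x y l m n S.vac = 0 := by
  rcases le_or_gt 0 m with h | h
  · obtain ⟨k, rfl⟩ := Int.eq_ofNat_of_zero_le h
    exact S.K_vac_nonneg x y k l n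
  · have main : ∀ k : ℕ, ∀ l n : ℤ, S.K x y l (-k) n S.vac = 0 := by
      intro k
      induction k with
      | zero => intro l n; exact S.K_vac_nonneg x y 0 l n
      | succ k ih =>
        have hr : ∀ l n, S.K x y (l + 1) (-1 - k) n S.vac = -S.K x y l (-1 - k) (n + 1) S.vac := by
          intro l n
          have := S.K_rec x y l (-1 - k) n S.vac
          rw [show -1 - (k : ℤ) + 1 = -k by ring, ih] at this
          exact eq_neg_of_add_eq_zero_left this.symm
        intro l n
        rw [show (-((k + 1 : ℕ) : ℤ)) = -1 - k by push_cast; ring]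
        induction n using Int.induction_on generalizing l with
        | zero => exact S.K_vac_neg x y k l
        | succ n ihn => 
          have := hr l n
          rw [ihn] at this
          exact neg_eq_zero.mp this.symm
        | pred n ihn =>
          have := hr (l - 1) (-n - 1)
          rw [sub_add_cancel, sub_add_cancel, ihn, neg_zero] at this
          exact this
    obtain ⟨k, hk⟩ := Int.eq_ofNat_of_zero_le (show 0 ≤ -m by omega)
    rw [show m = -k by omega]
    exact main k l n

end FieldSys


namespace FieldSys

variable {C V : Type*} [AddCommGroup V] [Module ℂ V] (S : FieldSys C V)

theorem K_eq_zero (x y : V) (l m n : ℤ) (w : V) : S.K x y l m n w = 0 := by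
  let T : Submodule ℂ V :=
    { carrier := {w | ∀ x y l m n, S.K x y l m n w = 0}
      add_mem' := by intro a b ha hb x y l m n; rw [S.K_add, ha, hb, add_zero]
      zero_mem' := fun x y l m n => by
        have := S.K_smul x y l m n 0 0
        simpa using this
      smul_mem' := by intro c a ha x y l m n; rw [S.K_smul, ha, smul_zero] }
  refine S.ind T ?_ ?_ w x y l m n
  · intro x y l m n; exact S.K_vac x y l m n
  · intro a p w hw x y l m n
    exact S.K_g _ _ _ _ _ _ _ _ (hw _ _ _ _ _) (fun j => hw _ _ _ _ _) (fun j => hw _ _ _ _ _)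

theorem jacobi : JacobiIdentity S.Y S.Y := by
  intro u v w l m n
  have h := S.K_eq_zero u v l m n w
  unfold K X at h
  rw [sub_eq_zero] at h
  obtain ⟨N, hN⟩ := S.Y_trunc v w
  obtain ⟨M, hM⟩ := S.Y_trunc u w
  have z1 : ∀ i : ℕ, N + M + n.natAbs + m.natAbs ≤ i →
      (-1 : ℤ) ^ i • S.Y u (m + l - i) (S.Y v (n + i) w) = 0 :=
    fun i hi => by rw [hN _ (by omega)]; simp
  have z2 : ∀ i : ℕ, N + M + n.natAbs + m.natAbs ≤ i →
      (-1 : ℤ) ^ i • S.Y v (n + l - i) (S.Y u (m + i) w) = 0 :=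
    fun i hi => by rw [hM _ (by omega)]; simp
  rw [bsum_smul _ _ _ z2, ← bsum_sub l _ z1 (fun i hi => by rw [z2 i hi, smul_zero])] at h
  refine Eq.trans ?_ h
  unfold bsum
  congr 1
  funext i
  module

/-- The vertex algebra structure attached to a field system. -/
@[reducible] def vertexAlgebra : VertexAlgebra V where
  vac := S.vac
  Y := S.Y
  trunc u v := by
    obtain ⟨N, hN⟩ := S.Y_trunc u v
    exact ⟨N, hN⟩
  vac_left := S.vac_Y
  vac_right v n hn := by rw [Y_vac, S.E_neg (by omega)]; rfl
  creation v := by rw [Y_vac, sub_self, S.E_zero]; rfl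
  jacobi := S.jacobi

/-- A subspace stable under the generating modes and under translation is a two-sided ideal. -/
theorem left_ideal (I : Submodule ℂ V) (hI : ∀ u n x, x ∈ I → S.g u n x ∈ I)
    (v : V) (n : ℤ) (x : V) (hx : x ∈ I) : S.Y v n x ∈ I := by
  let T : Submodule ℂ V :=
    { carrier := {v | ∀ n x, x ∈ I → S.Y v n x ∈ I}
      add_mem' := by
        intro a b ha hb n x hx
        simp only [map_add, Pi.add_apply, LinearMap.add_apply]
        exact I.add_mem (ha n x hx) (hb n x hx)
      zero_mem' := fun n x _ => by simp
      smul_mem' := by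
        intro c a ha n x hx
        simp only [map_smul, Pi.smul_apply, LinearMap.smul_apply]
        exact I.smul_mem c (ha n x hx) }
  have hb : ∀ (p : ℤ) (f : ℕ → V), (∀ i, f i ∈ I) → bsum p f ∈ I := fun p f hf =>
    finsum_induction (· ∈ I) I.zero_mem (fun _ _ => I.add_mem) fun i =>
      I.toAddSubgroup.zsmul_mem (hf i) _
  refine S.ind T ?_ ?_ v n x hx
  · intro n x hx
    rw [vac_Y]
    split_ifs
    · exact hx
    · exact I.zero_mem
  · intro u p w hw n x hx
    rw [Y_g_left]
    refine I.sub_mem (hb _ _ fun i => I.toAddSubgroup.zsmul_mem (hI _ _ _ (hw _ _ hx)) _)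
      (I.toAddSubgroup.zsmul_mem (hb _ _ fun i =>
        I.toAddSubgroup.zsmul_mem (hw _ _ (hI _ _ _ hx)) _) _)

theorem right_ideal (I : Submodule ℂ V) (hI : ∀ u n x, x ∈ I → S.g u n x ∈ I)
    (hD : ∀ x ∈ I, S.D x ∈ I) (v : V) (n : ℤ) (x : V) (hx : x ∈ I) : S.Y x n v ∈ I := by
  have hb : ∀ (p : ℤ) (f : ℕ → V), (∀ i, f i ∈ I) → bsum p f ∈ I := fun p f hf =>
    finsum_induction (· ∈ I) I.zero_mem (fun _ _ => I.add_mem) fun i =>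
      I.toAddSubgroup.zsmul_mem (hf i) _
  have hE : ∀ (i : ℕ) y, y ∈ I → S.E i y ∈ I := by
    intro i y hy
    simp only [GenSys.E, Int.natCast_nonneg, if_true, Int.toNat_natCast, LinearMap.smul_apply]
    refine I.smul_mem _ ?_
    induction i with
    | zero => simpa using hy
    | succ i ih => rw [pow_succ', Module.End.mul_apply]; exact hD _ ih
  rw [S.skew]
  exact I.neg_mem (I.toAddSubgroup.zsmul_mem
    (hb _ _ fun i => hE i _ (S.left_ideal I hI _ _ _ hx)) _)

end FieldSys

namespace VertexAlgebra

/-- The quotient of a vertex algebra by a (two-sided) ideal. -/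
@[reducible] def quotient {V : Type*} [AddCommGroup V] [Module ℂ V] (𝒱 : VertexAlgebra V) (I : Submodule ℂ V)
    (hl : ∀ v n, ∀ x ∈ I, 𝒱.Y v n x ∈ I) (hr : ∀ v n, ∀ x ∈ I, 𝒱.Y x n v ∈ I) :
    VertexAlgebra (V ⧸ I) where
  vac := I.mkQ 𝒱.vac
  Y := LinearMap.pi fun n => I.liftQ
    { toFun := fun v => I.mapQ I (𝒱.Y v n) (hl v n)
      map_add' := fun v w => by ext; simp
      map_smul' := fun c v => by ext; simp }
    (fun x hx => by
      ext v
      simpa using hr v n x hx)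
  trunc u v := by
    induction u using Submodule.Quotient.induction_on with | _ u
    induction v using Submodule.Quotient.induction_on with | _ v
    obtain ⟨N, hN⟩ := 𝒱.trunc u v
    exact ⟨N, fun n hn => congrArg I.mkQ (hN n hn)⟩
  vac_left n v := by
    induction v using Submodule.Quotient.induction_on with | _ v
    refine (congrArg I.mkQ (𝒱.vac_left n v)).trans ?_
    split_ifs <;> simp
  vac_right v n hn := by
    induction v using Submodule.Quotient.induction_on with | _ v
    exact congrArg I.mkQ (𝒱.vac_right v n hn)
  creation v := by
    induction v using Submodule.Quotient.induction_on with | _ v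
    exact congrArg I.mkQ (𝒱.creation v)
  jacobi := by
    intro u v w l m n
    induction u using Submodule.Quotient.induction_on with | _ u
    induction v using Submodule.Quotient.induction_on with | _ v
    induction w using Submodule.Quotient.induction_on with | _ w
    obtain ⟨N, hN⟩ := 𝒱.trunc v w
    obtain ⟨M, hM⟩ := 𝒱.trunc u w
    obtain ⟨L, hL⟩ := 𝒱.trunc u v
    have h := congrArg I.mkQ.toAddMonoidHom (𝒱.jacobi u v w l m n)
    have fin : ∀ (f : ℕ → V) (k : ℕ), (∀ i, k ≤ i → f i = 0) → (Function.support f).Finite :=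
      fun f k hk => (Set.finite_lt_nat k).subset fun i hi => by
        by_contra hc
        exact hi (hk i (not_lt.mp hc))
    rw [AddMonoidHom.map_finsum _ (fin _ (N.natAbs + M.natAbs + m.natAbs + n.natAbs) fun i hi => by
        rw [hN _ (by omega), hM _ (by omega)]; simp),
      AddMonoidHom.map_finsum _ (fin _ (L.natAbs + l.natAbs) fun i hi => by
        rw [hL _ (by omega)]; simp)] at h
    refine Eq.trans ?_ (h.trans ?_)
    · congr 1
    · congr 1

end VertexAlgebra


/-- A vertex `A`-algebroid structure on the complex vector space `B`, where `A` is a unital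
commutative associative `ℂ`-algebra. -/
class VertexAlgebroid (A B : Type*) [CommRing A] [Algebra ℂ A] [AddCommGroup B] [Module ℂ B] where
  star : A →ₗ[ℂ] B →ₗ[ℂ] B
  one_star : ∀ v : B, star 1 v = v
  bracket : B →ₗ[ℂ] B →ₗ[ℂ] B
  leibniz : ∀ u v w : B, bracket u (bracket v w) = bracket (bracket u v) w + bracket v (bracket u w)
  π : B →ₗ[ℂ] Derivation ℂ A A
  π_bracket : ∀ u v : B, π (bracket u v) = ⁅π u, π v⁆
  pairing : B →ₗ[ℂ] B →ₗ[ℂ] A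
  pairing_symm : ∀ u v : B, pairing u v = pairing v u
  d : A →ₗ[ℂ] B
  π_d : ∀ a : A, π (d a) = 0
  star_star : ∀ (a a' : A) (v : B),
    star a (star a' v) - star (a * a') v = star (π v a) (d a') + star (π v a') (d a)
  bracket_star : ∀ (u v : B) (a : A), bracket u (star a v) = star (π u a) v + star a (bracket u v)
  bracket_add_bracket : ∀ u v : B, bracket u v + bracket v u = d (pairing u v)
  π_star : ∀ (a : A) (v : B), π (star a v) = a • π v
  pairing_star : ∀ (a : A) (u v : B), pairing (star a u) v = a * pairing u v - π u (π v a)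
  π_pairing : ∀ v v₁ v₂ : B,
    π v (pairing v₁ v₂) = pairing (bracket v v₁) v₂ + pairing v₁ (bracket v v₂)
  d_mul : ∀ a a' : A, d (a * a') = star a (d a') + star a' (d a)
  bracket_d : ∀ (v : B) (a : A), bracket v (d a) = d (π v a)
  pairing_d : ∀ (v : B) (a : A), pairing v (d a) = π v a

namespace VertexAlgebroid

section Construction

variable (A B : Type*) [CommRing A] [Algebra ℂ A] [AddCommGroup B] [Module ℂ B]
  [VertexAlgebroid A B]

theorem d_bracket (a : A) (v : B) : bracket A (d a : B) v = 0 := by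
  have h := bracket_add_bracket (A := A) v (d a)
  rw [bracket_d, pairing_d] at h
  exact add_eq_left.mp h

/-- The product `u_0 v` of the `1`-truncated conformal algebra `A ⊕ B`. -/
def op0 : A × B →ₗ[ℂ] A × B →ₗ[ℂ] A × B :=
  LinearMap.mk₂ ℂ (fun u v => (π u.2 v.1 - π v.2 u.1, bracket A u.2 v.2))
    (fun u u' v => by ext <;> simp; abel) (fun c u v => by ext <;> simp [smul_sub])
    (fun u v v' => by ext <;> simp; abel) (fun c u v => by ext <;> simp [smul_sub])

/-- The product `u_1 v` of the `1`-truncated conformal algebra `A ⊕ B`. -/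
def op1 : A × B →ₗ[ℂ] A × B →ₗ[ℂ] A × B :=
  LinearMap.mk₂ ℂ (fun u v => (pairing u.2 v.2, 0))
    (fun u u' v => by ext <;> simp) (fun c u v => by ext <;> simp)
    (fun u v v' => by ext <;> simp) (fun c u v => by ext <;> simp)

theorem op0_apply (u v : A × B) :
    op0 A B u v = (π u.2 v.1 - π v.2 u.1, bracket A u.2 v.2) := rfl

theorem op1_apply (u v : A × B) : op1 A B u v = (pairing u.2 v.2, 0) := rfl

/-- The loop space `L(A ⊕ B) = (A ⊕ B) ⊗ ℂ[t, t⁻¹]`; `Finsupp.single n u` is `u ⊗ t^n`. -/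
abbrev Loop : Type _ := ℤ →₀ (A × B)

/-- The product on `L(A ⊕ B)`:
`[u ⊗ t^m, v ⊗ t^n] = u_0 v ⊗ t^{m+n} + m (u_1 v ⊗ t^{m+n-1})`. -/
def loopBracket : Loop A B →ₗ[ℂ] Loop A B →ₗ[ℂ] Loop A B :=
  Finsupp.lsum ℂ fun m => (Finsupp.lsum ℂ).toLinearMap ∘ₗ LinearMap.pi fun n =>
    LinearMap.compRight ℂ (Finsupp.lsingle (m + n)) ∘ₗ op0 A B +
      m • (LinearMap.compRight ℂ (Finsupp.lsingle (m + n - 1)) ∘ₗ op1 A B)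

theorem loopBracket_single (u v : A × B) (m n : ℤ) :
    loopBracket A B (Finsupp.single m u) (Finsupp.single n v) =
      Finsupp.single (m + n) (op0 A B u v) + m • Finsupp.single (m + n - 1) (op1 A B u v) := by
  simp [loopBracket]

/-- The map `∂ ⊗ 1 + 1 ⊗ d/dt` from `L(A) = A ⊗ ℂ[t, t⁻¹]` to `L(A ⊕ B)`. -/
def dhat : (ℤ →₀ A) →ₗ[ℂ] Loop A B :=
  Finsupp.lsum ℂ fun n => Finsupp.lsingle n ∘ₗ LinearMap.inr ℂ A B ∘ₗ d +
    n • (Finsupp.lsingle (n - 1) ∘ₗ LinearMap.inl ℂ A B)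

theorem dhat_single (n : ℤ) (a : A) :
    dhat A B (Finsupp.single n a) =
      Finsupp.single n ((0, d a) : A × B) + n • Finsupp.single (n - 1) ((a, 0) : A × B) := by
  rw [dhat, Finsupp.lsum_single]
  rfl

theorem loopBracket_dhat_left (x : ℤ →₀ A) (y : Loop A B) :
    loopBracket A B (dhat A B x) y = 0 := by
  induction x using Finsupp.induction_linear with
  | zero => simp
  | add x x' hx hx' => simp [hx, hx']
  | single n a =>
    induction y using Finsupp.induction_linear with
    | zero => simp
    | add y y' hy hy' => rw [map_add, hy, hy', add_zero]
    | single m v =>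
      rw [dhat_single, map_add, map_zsmul, LinearMap.add_apply, LinearMap.smul_apply,
        loopBracket_single, loopBracket_single]
      have h1 : op0 A B (0, d a) v = 0 := by
        rw [op0_apply, π_d, d_bracket]; simp
      have h2 : op1 A B (a, 0) v = 0 := by rw [op1_apply]; simp
      have h3 : op0 A B (a, 0) v = -op1 A B (0, d a) v := by
        rw [op0_apply, op1_apply]
        simp only
        rw [pairing_symm, pairing_d]
        ext <;> simp
      rw [h1, h2, h3, show n - 1 + m = n + m - 1 by ring]
      simp

theorem loopBracket_dhat_right (x : ℤ →₀ A) (y : Loop A B) :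
    loopBracket A B y (dhat A B x) ∈ LinearMap.range (dhat A B) := by
  induction x using Finsupp.induction_linear with
  | zero => simp
  | add x x' hx hx' => rw [map_add, map_add]; exact Submodule.add_mem _ hx hx'
  | single n a =>
    induction y using Finsupp.induction_linear with
    | zero => simp
    | add y y' hy hy' => rw [map_add, LinearMap.add_apply]; exact Submodule.add_mem _ hy hy'
    | single m v =>
      refine ⟨Finsupp.single (m + n) (π v.2 a), ?_⟩
      rw [dhat_single, dhat_single, map_add, map_zsmul,
        loopBracket_single, loopBracket_single]
      have h1 : op0 A B v (0, d a) = (0, d (π v.2 a)) := by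
        rw [op0_apply]
        simp only
        rw [π_d, bracket_d]
        ext <;> simp
      have h2 : op1 A B v (a, 0) = 0 := by rw [op1_apply]; simp
      have h3 : op0 A B v (a, 0) = (π v.2 a, 0) := by rw [op0_apply]; simp
      have h4 : op1 A B v (0, d a) = (π v.2 a, 0) := by
        rw [op1_apply]
        simp only
        rw [pairing_d]
      rw [h1, h2, h3, h4, show m + (n - 1) = m + n - 1 by ring]
      rw [Finsupp.single_zero, smul_zero, add_zero]
      module

theorem loopBracket_skew (x y : Loop A B) :
    loopBracket A B x y + loopBracket A B y x ∈ LinearMap.range (dhat A B) := by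
  induction x using Finsupp.induction_linear with
  | zero => simp
  | add x x' hx hx' =>
    rw [map_add, map_add, LinearMap.add_apply, add_add_add_comm]
    exact Submodule.add_mem _ hx hx'
  | single m u =>
    induction y using Finsupp.induction_linear with
    | zero => simp
    | add y y' hy hy' =>
      rw [map_add, map_add, LinearMap.add_apply, add_add_add_comm]
      exact Submodule.add_mem _ hy hy'
    | single n v =>
      refine ⟨Finsupp.single (m + n) (pairing u.2 v.2), ?_⟩
      have h1 : op1 A B v u = op1 A B u v := by rw [op1_apply, op1_apply, pairing_symm]
      have h2 : op0 A B v u = (0, d (pairing u.2 v.2 : A)) - op0 A B u v := by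
        rw [← bracket_add_bracket (A := A) u.2 v.2, op0_apply, op0_apply]
        ext <;> simp
      rw [dhat_single, loopBracket_single, loopBracket_single, h1, h2, add_comm n m,
        show ((pairing u.2 v.2, 0) : A × B) = op1 A B u v from rfl, Finsupp.single_sub]
      module

theorem loopBracket_leibniz (x y z : Loop A B) :
    loopBracket A B x (loopBracket A B y z) =
      loopBracket A B (loopBracket A B x y) z + loopBracket A B y (loopBracket A B x z) := by
  induction x using Finsupp.induction_linear with
  | zero => simp
  | add x x' hx hx' => simp only [map_add, LinearMap.add_apply, hx, hx']; abel
  | single m u =>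
    induction y using Finsupp.induction_linear with
    | zero => simp
    | add y y' hy hy' => simp only [map_add, LinearMap.add_apply, hy, hy']; abel
    | single n v =>
      induction z using Finsupp.induction_linear with
      | zero => simp
      | add z z' hz hz' => simp only [map_add, hz, hz']; abel
      | single k w =>
        have c00 : op0 A B u (op0 A B v w) =
            op0 A B (op0 A B u v) w + op0 A B v (op0 A B u w) := by
          simp only [op0_apply, π_bracket, Derivation.commutator_apply, map_sub]
          ext
          · simp only [Prod.fst_add]; abel
          · exact leibniz _ _ _
        have c01 : op0 A B u (op1 A B v w) =
            op1 A B (op0 A B u v) w + op1 A B v (op0 A B u w) := by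
          simp only [op0_apply, op1_apply]
          ext
          · simp [π_pairing]
          · simp
        have c10 : op1 A B u (op0 A B v w) = op1 A B (op0 A B u v) w +
            op0 A B (op1 A B u v) w + op0 A B v (op1 A B u w) := by
          simp only [op0_apply, op1_apply]
          ext
          · have h := bracket_add_bracket (A := A) u.2 v.2
            have h2 := congrArg (fun b => pairing (A := A) b w.2) h
            simp only [map_add, LinearMap.add_apply] at h2
            rw [pairing_symm (d _) w.2, pairing_d] at h2
            simp only [Prod.fst_add, map_zero, Derivation.zero_apply, LinearMap.zero_apply,
              zero_sub, sub_zero, π_pairing]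
            rw [π_pairing] at h2
            linear_combination -h2
          · simp
        have c11 : op1 A B u (op1 A B v w) = 0 := by simp [op1_apply]
        have c11' : op1 A B (op1 A B u v) w = 0 := by simp [op1_apply]
        have c11'' : op1 A B v (op1 A B u w) = 0 := by simp [op1_apply]
        simp only [loopBracket_single, map_add, map_zsmul, LinearMap.add_apply,
          LinearMap.smul_apply, c00, c01, c10, c11, c11', c11'', Finsupp.single_add,
          Finsupp.single_zero, smul_zero, add_zero]
        rw [show m + (n + k) = m + n + k by ring, show n + (m + k) = m + n + k by ring,
          show m + (n + k - 1) = m + n + k - 1 by ring, show n + (m + k - 1) = m + n + k - 1 by ring,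
          show m + n - 1 + k = m + n + k - 1 by ring]
        module

/-- The Lie algebra `𝓛 = L(A ⊕ B) / (∂ ⊗ 1 + 1 ⊗ d/dt) L(A)`. -/
def LieL : Type _ := Loop A B ⧸ LinearMap.range (dhat A B)

instance : AddCommGroup (LieL A B) :=
  inferInstanceAs (AddCommGroup (Loop A B ⧸ LinearMap.range (dhat A B)))

instance : Module ℂ (LieL A B) :=
  inferInstanceAs (Module ℂ (Loop A B ⧸ LinearMap.range (dhat A B)))

/-- The projection `L(A ⊕ B) → 𝓛`. -/
def proj : Loop A B →ₗ[ℂ] LieL A B := (LinearMap.range (dhat A B)).mkQ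

variable {A B} in
theorem proj_surjective : Function.Surjective (proj A B) := Submodule.mkQ_surjective _

theorem proj_eq_zero {x : Loop A B} : proj A B x = 0 ↔ x ∈ LinearMap.range (dhat A B) :=
  Submodule.Quotient.mk_eq_zero _

/-- The bracket of `𝓛` as a bilinear map, induced by the product on `L(A ⊕ B)`. -/
def lieBracket : LieL A B →ₗ[ℂ] LieL A B →ₗ[ℂ] LieL A B :=
  (LinearMap.range (dhat A B)).liftQ
    { toFun := fun x => (LinearMap.range (dhat A B)).mapQ (LinearMap.range (dhat A B))
        (loopBracket A B x) (by rintro _ ⟨y, rfl⟩; exact loopBracket_dhat_right A B y x)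
      map_add' := fun x y => by
        apply LinearMap.ext; intro z
        obtain ⟨z, rfl⟩ := proj_surjective z
        change proj A B (loopBracket A B (x + y) z) = _
        rw [map_add]; rfl
      map_smul' := fun c x => by
        apply LinearMap.ext; intro z
        obtain ⟨z, rfl⟩ := proj_surjective z
        change proj A B (loopBracket A B (c • x) z) = _
        rw [map_smul]; rfl }
    (by
      rintro _ ⟨y, rfl⟩
      apply LinearMap.ext
      intro z
      obtain ⟨z, rfl⟩ := proj_surjective z
      have := loopBracket_dhat_left A B y z
      exact (congrArg (proj A B) this).trans (map_zero _))

theorem lieBracket_proj (x y : Loop A B) :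
    lieBracket A B (proj A B x) (proj A B y) = proj A B (loopBracket A B x y) := rfl

instance : LieRing (LieL A B) where
  bracket x y := lieBracket A B x y
  add_lie x y z := by
    change lieBracket A B (x + y) z = _
    rw [map_add]; rfl
  lie_add x y z := map_add _ y z
  lie_self x := by
    obtain ⟨x, rfl⟩ := proj_surjective x
    have h := (proj_eq_zero A B).mpr (loopBracket_skew A B x x)
    rw [map_add, ← two_smul ℂ] at h
    exact (smul_eq_zero.mp h).resolve_left two_ne_zero
  leibniz_lie x y z := by
    obtain ⟨x, rfl⟩ := proj_surjective x
    obtain ⟨y, rfl⟩ := proj_surjective y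
    obtain ⟨z, rfl⟩ := proj_surjective z
    have h := congrArg (proj A B) (loopBracket_leibniz A B x y z)
    rw [map_add] at h
    exact h

instance : LieAlgebra ℂ (LieL A B) where
  lie_smul c x y := map_smul (lieBracket A B x) c y

/-- The element `u(n)` of `𝓛`, the class of `u ⊗ t^n`. -/
def mode (u : A × B) (n : ℤ) : LieL A B := proj A B (Finsupp.single n u)

theorem mode_add (u v : A × B) (n : ℤ) : mode A B (u + v) n = mode A B u n + mode A B v n := by
  simp [mode]

theorem mode_smul (c : ℂ) (u : A × B) (n : ℤ) : mode A B (c • u) n = c • mode A B u n := by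
  rw [mode, mode, ← map_smul, Finsupp.smul_single]

theorem mode_d (a : A) (n : ℤ) : mode A B (0, d a) n = -(n • mode A B (a, 0) (n - 1)) := by
  have h := (proj_eq_zero A B).mpr ⟨Finsupp.single n a, rfl⟩
  rw [dhat_single, map_add, map_zsmul] at h
  exact eq_neg_of_add_eq_zero_left h

theorem lie_mode (u v : A × B) (m n : ℤ) : ⁅mode A B u m, mode A B v n⁆ =
    mode A B (op0 A B u v) (m + n) + m • mode A B (op1 A B u v) (m + n - 1) := by
  have h : ⁅mode A B u m, mode A B v n⁆ =
      proj A B (loopBracket A B (Finsupp.single m u) (Finsupp.single n v)) := rfl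
  rw [h, loopBracket_single, map_add, map_zsmul]
  rfl

attribute [local instance] LieRing.ofAssociativeRing

/-- The left ideal `U(𝓛) 𝓛^{≥ 0}` of `U(𝓛)`, where `𝓛^{≥ 0}` is spanned by the `u(n)`, `n ≥ 0`. -/
def annVac : Submodule (UniversalEnvelopingAlgebra ℂ (LieL A B))
    (UniversalEnvelopingAlgebra ℂ (LieL A B)) :=
  Submodule.span _ {x | ∃ (u : A × B) (n : ℤ), 0 ≤ n ∧
    x = UniversalEnvelopingAlgebra.ι ℂ (mode A B u n)}

/-- The induced module `V_𝓛 = U(𝓛) ⊗_{U(𝓛^{≥ 0})} ℂ = U(𝓛) / U(𝓛) 𝓛^{≥ 0}`. -/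
def VL : Type _ := UniversalEnvelopingAlgebra ℂ (LieL A B) ⧸ annVac A B

instance : AddCommGroup (VL A B) :=
  inferInstanceAs (AddCommGroup (UniversalEnvelopingAlgebra ℂ (LieL A B) ⧸ annVac A B))

instance : Module (UniversalEnvelopingAlgebra ℂ (LieL A B)) (VL A B) :=
  inferInstanceAs (Module _ (UniversalEnvelopingAlgebra ℂ (LieL A B) ⧸ annVac A B))

instance : Module ℂ (VL A B) :=
  inferInstanceAs (Module ℂ (UniversalEnvelopingAlgebra ℂ (LieL A B) ⧸ annVac A B))

instance : IsScalarTower ℂ (UniversalEnvelopingAlgebra ℂ (LieL A B)) (VL A B) :=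
  inferInstanceAs (IsScalarTower ℂ _ (UniversalEnvelopingAlgebra ℂ (LieL A B) ⧸ annVac A B))

namespace VL

/-- The projection `U(𝓛) → V_𝓛`. -/
def mk : UniversalEnvelopingAlgebra ℂ (LieL A B) →ₗ[UniversalEnvelopingAlgebra ℂ (LieL A B)]
    VL A B := (annVac A B).mkQ

/-- The vacuum vector, the class of `1`. -/
def vac : VL A B := mk A B 1

theorem mk_surjective : Function.Surjective (mk A B) := Submodule.mkQ_surjective _

theorem mk_eq (y : UniversalEnvelopingAlgebra ℂ (LieL A B)) : mk A B y = y • vac A B := by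
  rw [vac, ← map_smul, smul_eq_mul, mul_one]

/-- The operator `u(n)` on `V_𝓛`. -/
def g (u : A × B) (n : ℤ) : Module.End ℂ (VL A B) :=
  Algebra.lsmul ℂ ℂ (VL A B) (UniversalEnvelopingAlgebra.ι ℂ (mode A B u n))

theorem g_apply (u : A × B) (n : ℤ) (x : VL A B) :
    g A B u n x = UniversalEnvelopingAlgebra.ι ℂ (mode A B u n) • x := rfl

theorem g_add (u v : A × B) (n : ℤ) : g A B (u + v) n = g A B u n + g A B v n := by
  simp [g, mode_add]

theorem g_smul (c : ℂ) (u : A × B) (n : ℤ) : g A B (c • u) n = c • g A B u n := by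
  simp [g, mode_smul]

theorem g_d (a : A) (n : ℤ) : g A B (0, d a) n = -(n • g A B (a, 0) (n - 1)) := by
  simp [g, mode_d]

theorem g_comm (u v : A × B) (m n : ℤ) (x : VL A B) :
    g A B u m (g A B v n x) - g A B v n (g A B u m x) =
      g A B (op0 A B u v) (m + n) x + m • g A B (op1 A B u v) (m + n - 1) x := by
  have h := congrArg (UniversalEnvelopingAlgebra.ι ℂ) (lie_mode A B u v m n)
  rw [LieHom.map_lie, LieRing.of_associative_ring_bracket, map_add, map_zsmul] at h
  simp only [g_apply]
  rw [smul_smul, smul_smul, ← sub_smul, h, add_smul, smul_assoc]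

theorem g_vac (u : A × B) (n : ℤ) (hn : 0 ≤ n) : g A B u n (vac A B) = 0 := by
  rw [g_apply, ← mk_eq]
  exact (Submodule.Quotient.mk_eq_zero _).mpr (Submodule.subset_span ⟨u, n, hn, rfl⟩)

/-- A subspace stable under the modes `u(n)` is a `U(𝓛)`-submodule. -/
theorem smul_mem_of_stable (S : Submodule ℂ (VL A B))
    (hS : ∀ u n x, x ∈ S → g A B u n x ∈ S)
    (y : UniversalEnvelopingAlgebra ℂ (LieL A B)) : ∀ x ∈ S, y • x ∈ S := by
  let T : Subalgebra ℂ (UniversalEnvelopingAlgebra ℂ (LieL A B)) :=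
    { carrier := {y | ∀ x ∈ S, y • x ∈ S}
      mul_mem' := by intro a b ha hb x hx; rw [mul_smul]; exact ha _ (hb _ hx)
      add_mem' := by intro a b ha hb x hx; rw [add_smul]; exact S.add_mem (ha _ hx) (hb _ hx)
      algebraMap_mem' := by
        intro c x hx
        rw [Algebra.algebraMap_eq_smul_one, smul_assoc, one_smul]
        exact S.smul_mem c hx }
  have hι : ∀ z : LieL A B, UniversalEnvelopingAlgebra.ι ℂ z ∈ T := by
    intro z
    obtain ⟨z, rfl⟩ := proj_surjective z
    induction z using Finsupp.induction_linear with
    | zero => rw [map_zero, map_zero]; exact T.zero_mem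
    | add z z' h h' => rw [map_add, map_add]; exact T.add_mem h h'
    | single n u => intro x hx; exact hS u n x hx
  let φ : LieL A B →ₗ⁅ℂ⁆ T :=
    { toFun := fun z => ⟨UniversalEnvelopingAlgebra.ι ℂ z, hι z⟩
      map_add' := fun z z' => by ext; simp
      map_smul' := fun c z => by ext; simp
      map_lie' := by
        intro z z'
        ext
        simp [LieRing.of_associative_ring_bracket] }
  have h : T.val.comp (UniversalEnvelopingAlgebra.lift ℂ φ) = AlgHom.id ℂ _ := by
    apply UniversalEnvelopingAlgebra.hom_ext
    ext z
    simp [φ]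
  have hy := congrArg (fun f => f y) h
  simp only [AlgHom.comp_apply, AlgHom.id_apply] at hy
  exact hy ▸ (UniversalEnvelopingAlgebra.lift ℂ φ y).2

theorem ind (S : Submodule ℂ (VL A B)) (h1 : vac A B ∈ S)
    (hS : ∀ u n x, x ∈ S → g A B u n x ∈ S) (x : VL A B) : x ∈ S := by
  obtain ⟨y, rfl⟩ := mk_surjective A B x
  rw [mk_eq]
  exact smul_mem_of_stable A B S hS y _ h1

/-- The universal property of `V_𝓛`. -/
theorem exists_lift {M : Type*} [AddCommGroup M] [Module ℂ M]
    (G : A × B → ℤ → Module.End ℂ M)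
    (hadd : ∀ u v n, G (u + v) n = G u n + G v n) (hsmul : ∀ (c : ℂ) u n, G (c • u) n = c • G u n)
    (hd : ∀ a n, G (0, d a) n = -(n • G (a, 0) (n - 1)))
    (hcomm : ∀ u v m n x, G u m (G v n x) - G v n (G u m x) =
      G (op0 A B u v) (m + n) x + m • G (op1 A B u v) (m + n - 1) x)
    (m₀ : M) (h0 : ∀ u n, 0 ≤ n → G u n m₀ = 0) :
    ∃ f : VL A B →ₗ[ℂ] M, f (vac A B) = m₀ ∧ ∀ u n x, f (g A B u n x) = G u n (f x) := by
  let ρ₀ : Loop A B →ₗ[ℂ] Module.End ℂ M := Finsupp.lsum ℂ fun n =>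
    { toFun := fun u => G u n
      map_add' := fun u v => hadd u v n
      map_smul' := fun c u => hsmul c u n }
  have hρ₀ : ∀ n u, ρ₀ (Finsupp.single n u) = G u n := fun n u => by
    rw [show ρ₀ = _ from rfl, Finsupp.lsum_single]
    rfl
  let ρ₁ : LieL A B →ₗ[ℂ] Module.End ℂ M := (LinearMap.range (dhat A B)).liftQ ρ₀ (by
    rintro _ ⟨x, rfl⟩
    rw [LinearMap.mem_ker]
    induction x using Finsupp.induction_linear with
    | zero => simp
    | add x y hx hy => rw [map_add, map_add, hx, hy, add_zero]
    | single n a =>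
      rw [dhat_single, map_add, map_zsmul, hρ₀, hρ₀, hd]
      simp)
  have hρ₁ : ∀ x, ρ₁ (proj A B x) = ρ₀ x := fun x => rfl
  let ρ : LieL A B →ₗ⁅ℂ⁆ Module.End ℂ M :=
    { ρ₁ with
      map_lie' := by
        intro x y
        obtain ⟨x, rfl⟩ := proj_surjective x
        obtain ⟨y, rfl⟩ := proj_surjective y
        change ρ₀ (loopBracket A B x y) = ⁅ρ₀ x, ρ₀ y⁆
        induction x using Finsupp.induction_linear with
        | zero => simp
        | add x x' hx hx' => simp only [map_add, LinearMap.add_apply, hx, hx', add_lie]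
        | single m u =>
          induction y using Finsupp.induction_linear with
          | zero => simp
          | add y y' hy hy' => simp only [map_add, hy, hy', lie_add]
          | single n v =>
            rw [loopBracket_single, map_add, map_zsmul]
            simp only [hρ₀]
            ext x
            rw [LieRing.of_associative_ring_bracket]
            exact (hcomm u v m n x).symm }
  have hρ : ∀ u n, ρ (mode A B u n) = G u n := fun u n => hρ₀ n u
  let ψ : UniversalEnvelopingAlgebra ℂ (LieL A B) →ₐ[ℂ] Module.End ℂ M :=
    UniversalEnvelopingAlgebra.lift ℂ ρ
  have hψ : ∀ u n, ψ (UniversalEnvelopingAlgebra.ι ℂ (mode A B u n)) = G u n := fun u n => by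
    rw [UniversalEnvelopingAlgebra.lift_ι_apply, hρ]
  let f₀ : UniversalEnvelopingAlgebra ℂ (LieL A B) →ₗ[ℂ] M :=
    (LinearMap.applyₗ m₀) ∘ₗ ψ.toLinearMap
  have hker : (annVac A B).restrictScalars ℂ ≤ LinearMap.ker f₀ := by
    intro x hx
    rw [Submodule.restrictScalars_mem] at hx
    rw [LinearMap.mem_ker]
    induction hx using Submodule.span_induction with
    | mem x hx =>
      obtain ⟨u, n, hn, rfl⟩ := hx
      change ψ _ m₀ = 0
      rw [hψ, h0 u n hn]
    | zero => simp
    | add x y _ _ hx hy => rw [map_add, hx, hy, add_zero]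
    | smul c x _ hx =>
      change ψ (c * x) m₀ = 0
      rw [map_mul, Module.End.mul_apply, show ψ x m₀ = 0 from hx, map_zero]
  let f : VL A B →ₗ[ℂ] M := ((annVac A B).restrictScalars ℂ).liftQ f₀ hker ∘ₗ
    (Submodule.Quotient.restrictScalarsEquiv ℂ (annVac A B)).symm.toLinearMap
  have hf : ∀ y, f (mk A B y) = ψ y m₀ := fun y => rfl
  refine ⟨f, ?_, fun u n x => ?_⟩
  · rw [vac, hf, map_one]; rfl
  · obtain ⟨y, rfl⟩ := mk_surjective A B x
    rw [g_apply, ← map_smul, smul_eq_mul, hf, hf, map_mul, hψ]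
    rfl

theorem trunc (u : A × B) (x : VL A B) : ∃ N : ℕ, ∀ n : ℤ, N ≤ n → g A B u n x = 0 := by
  let T : Submodule ℂ (VL A B) :=
    { carrier := {x | ∀ u, ∃ N : ℕ, ∀ n : ℤ, N ≤ n → g A B u n x = 0}
      add_mem' := by
        intro a b ha hb u
        obtain ⟨N, hN⟩ := ha u
        obtain ⟨M, hM⟩ := hb u
        exact ⟨N + M, fun n hn => by
          rw [map_add, hN n (by push_cast at hn; omega), hM n (by push_cast at hn; omega), add_zero]⟩
      zero_mem' := fun v => ⟨0, fun n _ => map_zero _⟩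
      smul_mem' := by
        intro c a ha v
        obtain ⟨N, hN⟩ := ha v
        exact ⟨N, fun n hn => by rw [map_smul, hN n hn, smul_zero]⟩ }
  refine ind A B T ?_ ?_ x u
  · exact fun u => ⟨0, fun n hn => g_vac A B u n (by simpa using hn)⟩
  · intro v m x hx u
    obtain ⟨N, hN⟩ := hx u
    obtain ⟨N0, h0⟩ := hx (op0 A B u v)
    obtain ⟨N1, h1⟩ := hx (op1 A B u v)
    refine ⟨N + N0 + N1 + m.natAbs + 1, fun n hn => ?_⟩
    have h := g_comm A B u v n m x
    rw [hN n (by omega), h0 _ (by omega), h1 _ (by omega)] at h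
    simpa using h

theorem exists_D : ∃ D : Module.End ℂ (VL A B), D (vac A B) = 0 ∧
    ∀ u n x, D (g A B u n x) - g A B u n (D x) = -(n • g A B u (n - 1) x) := by
  obtain ⟨f, hf0, hf⟩ := exists_lift A B (M := VL A B × VL A B)
    (fun u n => LinearMap.prod (g A B u n ∘ₗ LinearMap.fst ℂ _ _)
      (g A B u n ∘ₗ LinearMap.snd ℂ _ _ - n • (g A B u (n - 1) ∘ₗ LinearMap.fst ℂ _ _)))
    (fun u v n => by
      apply LinearMap.ext; intro x
      ext
      · simp [g_add]
      · simp [g_add]; abel)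
    (fun c u n => by
      apply LinearMap.ext; intro x
      ext
      · simp [g_smul]
      · simp [g_smul, smul_sub, smul_comm c])
    (fun a n => by
      apply LinearMap.ext; intro x
      ext
      · simp [g_d]
      · simp [g_d]
        module)
    (fun u v m n x => by
      have h1 := g_comm A B u v m n x.1
      have h2 := g_comm A B u v m n x.2
      have h3 := g_comm A B u v (m - 1) n x.1
      have h4 := g_comm A B u v m (n - 1) x.1
      rw [show m - 1 + n = m + n - 1 by ring] at h3
      rw [show m + (n - 1) = m + n - 1 by ring] at h4
      ext
      · simpa using h1
      · change (g A B u m (g A B v n x.2 - n • g A B v (n - 1) x.1) -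
            m • g A B u (m - 1) (g A B v n x.1)) -
          (g A B v n (g A B u m x.2 - m • g A B u (m - 1) x.1) -
            n • g A B v (n - 1) (g A B u m x.1)) =
          (g A B (op0 A B u v) (m + n) x.2 - (m + n) • g A B (op0 A B u v) (m + n - 1) x.1) +
          m • (g A B (op1 A B u v) (m + n - 1) x.2 -
            (m + n - 1) • g A B (op1 A B u v) (m + n - 1 - 1) x.1)
        simp only [map_sub, map_zsmul]
        linear_combination (norm := module) h2 - m • h3 - n • h4)
    (vac A B, 0)
    (fun u n hn => by
      ext
      · simp [g_vac A B u n hn]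
      · change g A B u n 0 - n • g A B u (n - 1) (vac A B) = 0
        rw [map_zero, zero_sub, neg_eq_zero]
        rcases hn.eq_or_lt with h | h
        · rw [← h, zero_smul]
        · rw [g_vac A B u (n - 1) (by omega), smul_zero])
  have hfst : ∀ x, (f x).1 = x := by
    intro x
    let T : Submodule ℂ (VL A B) := LinearMap.eqLocus (LinearMap.fst ℂ _ _ ∘ₗ f) LinearMap.id
    refine ind A B T ?_ ?_ x
    · change (f (vac A B)).1 = vac A B
      rw [hf0]
    · intro u n x hx
      have hx : (f x).1 = x := hx
      change (f (g A B u n x)).1 = g A B u n x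
      rw [hf]
      simp [hx]
  refine ⟨LinearMap.snd ℂ _ _ ∘ₗ f, by simp [hf0], fun u n x => ?_⟩
  simp only [LinearMap.coe_comp, Function.comp_apply, hf]
  simp [hfst]

/-- The translation operator `𝓓` of `V_𝓛`: the linear operator with `𝓓 𝟏 = 0` and
`[𝓓, u(n)] = -n u(n-1)` for `u ∈ A ⊕ B`. -/
def D : Module.End ℂ (VL A B) := (exists_D A B).choose

/-- `V_𝓛` with the operators `u(n)` and `𝓓`. -/
def genSys : GenSys (A × B) (VL A B) where
  op0 u v := op0 A B u v
  op1 u v := op1 A B u v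
  g := g A B
  vac := vac A B
  D := D A B
  comm := g_comm A B
  trunc := trunc A B
  g_vac := g_vac A B
  D_g := (exists_D A B).choose_spec.2
  D_vac := (exists_D A B).choose_spec.1
  ind := ind A B

theorem exists_F : ∃ F : VL A B →ₗ[ℂ] VL A B →ₗ[ℂ] (ℤ → VL A B),
    F (vac A B) = (genSys A B).phi0 ∧
    ∀ u p w, F (g A B u p w) = (genSys A B).G u p (F w) := by
  refine exists_lift A B (genSys A B).G (fun u v p => ?_) (fun c u p => ?_) (fun a p => ?_)
    (genSys A B).G_comm _ (fun u p hp => (genSys A B).G_phi0 u p hp)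
  · apply LinearMap.ext; intro φ
    apply LinearMap.ext; intro x
    funext n
    obtain ⟨N, hN⟩ := trunc A B u x
    obtain ⟨M, hM⟩ := trunc A B v x
    simp only [LinearMap.add_apply, Pi.add_apply, GenSys.G_apply]
    simp only [genSys, g_add, LinearMap.add_apply, map_add, Pi.add_apply]
    rw [bsum_add p (N + M) (fun i hi => by rw [hN _ (by omega)]; simp)
      (fun i hi => by rw [hM _ (by omega)]; simp)]
    abel
  · apply LinearMap.ext; intro φ
    apply LinearMap.ext; intro x
    funext n
    obtain ⟨N, hN⟩ := trunc A B u x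
    simp only [LinearMap.smul_apply, Pi.smul_apply, GenSys.G_apply]
    simp only [genSys, g_smul, LinearMap.smul_apply, map_smul, Pi.smul_apply]
    have := bsum_map (DistribSMul.toAddMonoidHom (VL A B) c) p
      (f := fun i => φ (g A B u i x) (p + n - i)) N
      (fun i hi => by rw [hN _ (by omega)]; simp)
    simp only [DistribSMul.toAddMonoidHom_apply] at this
    rw [← this, smul_sub]
  · apply LinearMap.ext; intro φ
    apply LinearMap.ext; intro x
    funext n
    obtain ⟨N, hN⟩ := trunc A B (a, 0) x
    simp only [LinearMap.neg_apply, LinearMap.smul_apply, Pi.smul_apply, Pi.neg_apply,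
      GenSys.G_apply]
    simp only [genSys, g_d, LinearMap.smul_apply, LinearMap.neg_apply, map_neg, map_zsmul,
      Pi.smul_apply, Pi.neg_apply]
    have h1 := bsum_weight p (f := fun i : ℕ => φ (g A B (a, 0) (i - 1) x) (p + n - i)) (N + 1)
      (fun i hi => by rw [hN _ (by omega)]; simp)
    have h2 := bsum_smul p (-1) (f := fun i : ℕ => (i : ℤ) • φ (g A B (a, 0) (i - 1) x) (p + n - i))
      (N + 1) (fun i hi => by rw [hN _ (by omega)]; simp)
    simp only [neg_one_smul] at h2
    rw [← h2, h1, smul_sub]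
    have h3 : ∀ i : ℕ, φ (g A B (a, 0) (((i + 1 : ℕ) : ℤ) - 1) x) (p + n - ((i + 1 : ℕ) : ℤ)) =
        φ (g A B (a, 0) i x) (p - 1 + n - i) := by
      intro i
      push_cast
      rw [show (i : ℤ) + 1 - 1 = i by ring, show p + n - ((i : ℤ) + 1) = p - 1 + n - i by ring]
    simp only [h3]
    abel

/-- The state-field correspondence of `V_𝓛`. -/
def fieldSys : FieldSys (A × B) (VL A B) where
  toGenSys := genSys A B
  F := (exists_F A B).choose
  F_vac := (exists_F A B).choose_spec.1
  F_g := (exists_F A B).choose_spec.2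

/-- The vertex algebra `V_𝓛`: the vertex algebra structure on the vector space `V_𝓛` with vacuum
`𝟏` and `Y(u(-1)𝟏, x) = ∑ u(n) x^{-n-1}` for `u ∈ A ⊕ B`. -/
instance : VertexAlgebra (VL A B) := (fieldSys A B).vertexAlgebra

theorem vac_eq : (VertexAlgebra.vac : VL A B) = vac A B := rfl

theorem Y_mode (u : A × B) (n : ℤ) :
    VertexAlgebra.Y (g A B u (-1) (vac A B)) n = g A B u n :=
  LinearMap.ext fun w => (fieldSys A B).Y_gen u n w

end VL

end Construction

end VertexAlgebroid


namespace VertexAlgebroid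

section VertexAlgebraOfAlgebroid

variable (A B : Type*) [CommRing A] [Algebra ℂ A] [AddCommGroup B] [Module ℂ B]
  [VertexAlgebroid A B]

/-- The spanning vectors of the subspace `E` of `V_𝓛`, where `e` is the identity of `A` and `A ⊕ B`
is identified with a subspace of `V_𝓛` through `u ↦ u(-1)𝟏`:
`e - 𝟏`, `a(-1)a' - aa'` and `a(-1)b - a * b`. -/
inductive EGen : VL A B → Prop
  | one : EGen (VL.g A B (1, 0) (-1) (VL.vac A B) - VL.vac A B)
  | mul (a a' : A) : EGen (VL.g A B (a, 0) (-1) (VL.g A B (a', 0) (-1) (VL.vac A B)) -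
      VL.g A B (a * a', 0) (-1) (VL.vac A B))
  | star (a : A) (b : B) : EGen (VL.g A B (a, 0) (-1) (VL.g A B (0, b) (-1) (VL.vac A B)) -
      VL.g A B (0, VertexAlgebroid.star a b) (-1) (VL.vac A B))

/-- The subspace `I_B = U(𝓛) ℂ[𝓓] E` of `V_𝓛`. -/
def IB : Submodule ℂ (VL A B) :=
  (Submodule.span (UniversalEnvelopingAlgebra ℂ (LieL A B))
    {x | ∃ (k : ℕ) (e : VL A B), EGen A B e ∧ x = (VL.D A B ^ k) e}).restrictScalars ℂ

theorem g_mem_IB (u : A × B) (n : ℤ) (x : VL A B) (hx : x ∈ IB A B) :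
    VL.g A B u n x ∈ IB A B :=
  Submodule.smul_mem (Submodule.span _ _) _ hx

theorem D_mem_IB (x : VL A B) (hx : x ∈ IB A B) : VL.D A B x ∈ IB A B := by
  let S : Submodule ℂ (VL A B) := IB A B ⊓ (IB A B).comap (VL.D A B)
  have hS : ∀ u n x, x ∈ S → VL.g A B u n x ∈ S := by
    rintro u n x ⟨h1, h2⟩
    refine ⟨g_mem_IB A B u n x h1, ?_⟩
    have h := (VL.genSys A B).D_g u n x
    change VL.D A B (VL.g A B u n x) - VL.g A B u n (VL.D A B x) =
      -(n • VL.g A B u (n - 1) x) at h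
    change VL.D A B (VL.g A B u n x) ∈ IB A B
    rw [sub_eq_iff_eq_add.mp h]
    exact (IB A B).add_mem ((IB A B).neg_mem ((IB A B).toAddSubgroup.zsmul_mem
      (g_mem_IB A B u (n - 1) x h1) n)) (g_mem_IB A B u n _ h2)
  suffices h : x ∈ S from h.2
  have hx' : x ∈ Submodule.span (UniversalEnvelopingAlgebra ℂ (LieL A B))
    {x | ∃ (k : ℕ) (e : VL A B), EGen A B e ∧ x = (VL.D A B ^ k) e} := hx
  clear hx
  induction hx' using Submodule.span_induction with
  | mem x h =>
    obtain ⟨k, e, he, rfl⟩ := h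
    refine ⟨Submodule.subset_span ⟨k, e, he, rfl⟩, ?_⟩
    change VL.D A B ((VL.D A B ^ k) e) ∈ IB A B
    rw [← Module.End.mul_apply, ← pow_succ']
    exact Submodule.subset_span ⟨k + 1, e, he, rfl⟩
  | zero => exact S.zero_mem
  | add x y _ _ hx hy => exact S.add_mem hx hy
  | smul c x _ hx => exact VL.smul_mem_of_stable A B S hS c x hx

/-- The vertex algebra `V_B = V_𝓛 / I_B`. -/
def VB : Type _ := VL A B ⧸ IB A B

instance : AddCommGroup (VB A B) := inferInstanceAs (AddCommGroup (VL A B ⧸ IB A B))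

instance : Module ℂ (VB A B) := inferInstanceAs (Module ℂ (VL A B ⧸ IB A B))

instance : VertexAlgebra (VB A B) :=
  VertexAlgebra.quotient (inferInstanceAs (VertexAlgebra (VL A B))) (IB A B)
    (fun v n x hx => (VL.fieldSys A B).left_ideal (IB A B) (g_mem_IB A B) v n x hx)
    (fun v n x hx => (VL.fieldSys A B).right_ideal (IB A B) (g_mem_IB A B) (D_mem_IB A B) v n x hx)

/-- The projection `V_𝓛 → V_B`. -/
def toVB : VL A B →ₗ[ℂ] VB A B := (IB A B).mkQ

theorem toVB_vac : toVB A B VertexAlgebra.vac = VertexAlgebra.vac := rfl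

theorem toVB_Y (u v : VL A B) (n : ℤ) :
    VertexAlgebra.Y (toVB A B u) n (toVB A B v) = toVB A B (VertexAlgebra.Y u n v) := rfl

variable {A} in
/-- The image `a(-1)𝟏` of `a ∈ A` in `V_B`. -/
def ofA (a : A) : VB A B := toVB A B (VL.g A B (a, 0) (-1) (VL.vac A B))

variable {B} in
/-- The image `b(-1)𝟏` of `b ∈ B` in `V_B`. -/
def ofB (b : B) : VB A B := toVB A B (VL.g A B (0, b) (-1) (VL.vac A B))

/-- `VL.Monomial n x` says that `x` is a product of operators `a(m)` (of degree `-m-1`) and `b(m)`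
(of degree `-m`), of total degree `n`, applied to `𝟏`. -/
inductive VL.Monomial : ℤ → VL A B → Prop
  | vac : VL.Monomial 0 (VL.vac A B)
  | ofA (a : A) (m n : ℤ) (x : VL A B) : VL.Monomial n x →
      VL.Monomial (n - m - 1) (VL.g A B (a, 0) m x)
  | ofB (b : B) (m n : ℤ) (x : VL A B) : VL.Monomial n x →
      VL.Monomial (n - m) (VL.g A B (0, b) m x)

/-- The homogeneous subspace `(V_B)_(n)`, which is zero for `n < 0`. -/
def VB.weight (n : ℤ) : Submodule ℂ (VB A B) :=
  (Submodule.span ℂ {x | VL.Monomial A B n x}).map (toVB A B)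

end VertexAlgebraOfAlgebroid

section LieAlgebroid

variable (A B : Type*) [CommRing A] [Algebra ℂ A] [AddCommGroup B] [Module ℂ B]
  [VertexAlgebroid A B]

/-- The subspace `A∂A` of `B`, spanned by the elements `a * ∂a'`. -/
def AdA : Submodule ℂ B := Submodule.span ℂ {b | ∃ a a' : A, b = star a (d a')}

theorem star_d_mem (a a' : A) : star a (d a') ∈ AdA A B := Submodule.subset_span ⟨a, a', rfl⟩

theorem d_mem (a : A) : d a ∈ AdA A B := by
  rw [← one_star (A := A) (d a)]
  exact star_d_mem A B 1 a

theorem AdA_induction {p : B → Prop} (h0 : p 0) (hadd : ∀ x y, p x → p y → p (x + y))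
    (hsmul : ∀ (c : ℂ) x, p x → p (c • x)) (h : ∀ a a' : A, p (star a (d a'))) :
    ∀ b ∈ AdA A B, p b := by
  intro b hb
  induction hb using Submodule.span_induction with
  | mem x hx => obtain ⟨a, a', rfl⟩ := hx; exact h a a'
  | zero => exact h0
  | add x y _ _ hx hy => exact hadd x y hx hy
  | smul c x _ hx => exact hsmul c x hx

theorem star_mem (a : A) : ∀ b ∈ AdA A B, star a b ∈ AdA A B := by
  refine AdA_induction A B (by simp) (fun x y hx hy => ?_) (fun c x hx => ?_) (fun a' a'' => ?_)
  · rw [map_add]; exact Submodule.add_mem _ hx hy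
  · rw [map_smul]; exact Submodule.smul_mem _ c hx
  · have h := star_star a a' (d a'' : B)
    rw [π_d] at h
    simp only [Derivation.zero_apply, map_zero, LinearMap.zero_apply, add_zero] at h
    rw [sub_eq_zero.mp h]
    exact star_d_mem A B _ _

theorem bracket_mem (u : B) : ∀ b ∈ AdA A B, bracket A u b ∈ AdA A B := by
  refine AdA_induction A B (by simp) (fun x y hx hy => ?_) (fun c x hx => ?_) (fun a' a'' => ?_)
  · rw [map_add]; exact Submodule.add_mem _ hx hy
  · rw [map_smul]; exact Submodule.smul_mem _ c hx
  · rw [bracket_star, bracket_d]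
    exact Submodule.add_mem _ (star_d_mem A B _ _) (star_d_mem A B _ _)

theorem bracket_mem' (u : B) (b : B) (hb : b ∈ AdA A B) : bracket A b u ∈ AdA A B := by
  rw [eq_sub_of_add_eq (bracket_add_bracket (A := A) b u)]
  exact Submodule.sub_mem _ (d_mem A B _) (bracket_mem A B u b hb)

theorem π_mem : ∀ b ∈ AdA A B, π (A := A) b = 0 := by
  refine AdA_induction A B (by simp) (fun x y hx hy => ?_) (fun c x hx => ?_) (fun a' a'' => ?_)
  · rw [map_add, hx, hy, add_zero]
  · rw [map_smul, hx, smul_zero]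
  · rw [π_star, π_d, smul_zero]

/-- The Lie `A`-algebroid `B / A∂A`. -/
def LieAlgd : Type _ := B ⧸ AdA A B

namespace LieAlgd

instance : AddCommGroup (LieAlgd A B) := inferInstanceAs (AddCommGroup (B ⧸ AdA A B))

instance : Module ℂ (LieAlgd A B) := inferInstanceAs (Module ℂ (B ⧸ AdA A B))

/-- The projection `B → B / A∂A`. -/
def mk : B →ₗ[ℂ] LieAlgd A B := (AdA A B).mkQ

theorem mk_surjective : Function.Surjective (mk A B) := Submodule.mkQ_surjective _

theorem mk_eq_zero (b : B) : mk A B b = 0 ↔ b ∈ AdA A B := Submodule.Quotient.mk_eq_zero _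

theorem mk_eq (b b' : B) : mk A B b = mk A B b' ↔ b - b' ∈ AdA A B := by
  rw [← sub_eq_zero, ← map_sub, mk_eq_zero]

instance : SMul A (LieAlgd A B) :=
  ⟨fun a => (AdA A B).mapQ (AdA A B) (star a) (star_mem A B a)⟩

theorem smul_mk (a : A) (b : B) : a • mk A B b = mk A B (star a b) := rfl

instance : Module A (LieAlgd A B) where
  one_smul x := by
    obtain ⟨b, rfl⟩ := mk_surjective A B x
    rw [smul_mk, one_star]
  mul_smul a a' x := by
    obtain ⟨b, rfl⟩ := mk_surjective A B x
    rw [smul_mk, smul_mk, smul_mk, eq_comm, mk_eq, star_star]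
    exact Submodule.add_mem _ (star_d_mem A B _ _) (star_d_mem A B _ _)
  smul_zero a := map_zero ((AdA A B).mapQ (AdA A B) (star a) (star_mem A B a))
  smul_add a := map_add ((AdA A B).mapQ (AdA A B) (star a) (star_mem A B a))
  add_smul a a' x := by
    obtain ⟨b, rfl⟩ := mk_surjective A B x
    rw [smul_mk, smul_mk, smul_mk, map_add, LinearMap.add_apply, map_add]
  zero_smul x := by
    obtain ⟨b, rfl⟩ := mk_surjective A B x
    rw [smul_mk, map_zero, LinearMap.zero_apply, map_zero]

instance : IsScalarTower ℂ A (LieAlgd A B) where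
  smul_assoc c a x := by
    obtain ⟨b, rfl⟩ := mk_surjective A B x
    rw [smul_mk, smul_mk, map_smul, LinearMap.smul_apply, map_smul]

/-- The bracket of `B / A∂A` as a bilinear map. -/
def bracketₗ : LieAlgd A B →ₗ[ℂ] LieAlgd A B →ₗ[ℂ] LieAlgd A B :=
  (AdA A B).liftQ
    { toFun := fun u => (AdA A B).mapQ (AdA A B) (bracket A u) (bracket_mem A B u)
      map_add' := fun u v => by
        apply LinearMap.ext; intro w
        obtain ⟨w, rfl⟩ := mk_surjective A B w
        change mk A B (bracket A (u + v) w) = _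
        rw [map_add]; rfl
      map_smul' := fun c u => by
        apply LinearMap.ext; intro w
        obtain ⟨w, rfl⟩ := mk_surjective A B w
        change mk A B (bracket A (c • u) w) = _
        rw [map_smul]; rfl }
    (by
      intro u hu
      apply LinearMap.ext; intro w
      obtain ⟨w, rfl⟩ := mk_surjective A B w
      exact (mk_eq_zero A B _).mpr (bracket_mem' A B w u hu))

instance : LieRing (LieAlgd A B) where
  bracket x y := bracketₗ A B x y
  add_lie x y z := by
    change bracketₗ A B (x + y) z = _
    rw [map_add]; rfl
  lie_add x y z := map_add _ y z
  lie_self x := by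
    obtain ⟨x, rfl⟩ := mk_surjective A B x
    have h : mk A B (bracket A x x + bracket A x x) = 0 := by
      rw [mk_eq_zero, bracket_add_bracket]
      exact d_mem A B _
    rw [map_add, ← two_smul ℂ] at h
    exact (smul_eq_zero.mp h).resolve_left two_ne_zero
  leibniz_lie x y z := by
    obtain ⟨x, rfl⟩ := mk_surjective A B x
    obtain ⟨y, rfl⟩ := mk_surjective A B y
    obtain ⟨z, rfl⟩ := mk_surjective A B z
    have h := congrArg (mk A B) (leibniz (A := A) x y z)
    rw [map_add] at h
    exact h

theorem lie_mk (u v : B) : ⁅mk A B u, mk A B v⁆ = mk A B (bracket A u v) := rfl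

instance : LieAlgebra ℂ (LieAlgd A B) where
  lie_smul c x y := map_smul (bracketₗ A B x) c y

/-- The action of `B / A∂A` on `A` by derivations. -/
def anchor : LieAlgd A B →ₗ[ℂ] Derivation ℂ A A := (AdA A B).liftQ π (π_mem A B)

theorem anchor_mk (b : B) : anchor A B (mk A B b) = π b := rfl

instance : LieRingModule (LieAlgd A B) A where
  bracket x a := anchor A B x a
  add_lie x y a := by
    change anchor A B (x + y) a = _
    rw [map_add]; rfl
  lie_add x a a' := map_add (anchor A B x) a a'
  leibniz_lie x y a := by
    obtain ⟨x, rfl⟩ := mk_surjective A B x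
    obtain ⟨y, rfl⟩ := mk_surjective A B y
    change π x (π y a) = π (bracket A x y) a + π y (π x a)
    rw [π_bracket, Derivation.commutator_apply, sub_add_cancel]

theorem mk_lie (b : B) (a : A) : ⁅mk A B b, a⁆ = π b a := rfl

instance : LieRinehartRing A (LieAlgd A B) where
  lie_smul_eq_mul' a b x := by
    obtain ⟨x, rfl⟩ := mk_surjective A B x
    rw [smul_mk, mk_lie, mk_lie, π_star]
    rfl
  leibniz_mul_right' x a b := by
    obtain ⟨x, rfl⟩ := mk_surjective A B x
    rw [mk_lie, mk_lie, mk_lie, Derivation.leibniz, smul_eq_mul, smul_eq_mul, mul_comm b]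
  leibniz_smul_right' x y a := by
    obtain ⟨x, rfl⟩ := mk_surjective A B x
    obtain ⟨y, rfl⟩ := mk_surjective A B y
    rw [smul_mk, lie_mk, lie_mk, mk_lie, smul_mk, smul_mk, bracket_star, map_add, add_comm]

instance : LieRinehartAlgebra ℂ A (LieAlgd A B) where
  smul_lie c x a := by
    change anchor A B (c • x) a = _
    rw [map_smul]; rfl
  lie_smul c x a := (anchor A B x).map_smul c a

end LieAlgd

end LieAlgebroid

end VertexAlgebroid

/-- A module structure on the vector space `W` for a Lie `A`-algebroid `L` (a Lie-Rinehart algebra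
over `A`): an `A`-module structure and an `L`-module structure with `u(aw) - a(uw) = (ua)w` and
`a(uw) = (au)w`. -/
structure LieAlgebroidModule (A L W : Type*) [CommRing A] [Algebra ℂ A] [LieRing L]
    [LieAlgebra ℂ L] [Module A L] [LieRingModule L A] [LieRinehartRing A L]
    [LieRinehartAlgebra ℂ A L] [AddCommGroup W] [Module ℂ W] where
  smul : A →ₐ[ℂ] Module.End ℂ W
  act : L →ₗ[ℂ] Module.End ℂ W
  act_lie : ∀ (u v : L) (w : W), act ⁅u, v⁆ w = act u (act v w) - act v (act u w)
  act_smul : ∀ (u : L) (a : A) (w : W), act u (smul a w) - smul a (act u w) = smul ⁅u, a⁆ w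
  smul_act : ∀ (a : A) (u : L) (w : W), smul a (act u w) = act (a • u) w

/-- A module for a Lie `A`-algebroid is simple if it is nonzero and has no subspaces stable under
`A` and `L` except `0` and the whole module. -/
def LieAlgebroidModule.IsSimple {A L W : Type*} [CommRing A] [Algebra ℂ A] [LieRing L]
    [LieAlgebra ℂ L] [Module A L] [LieRingModule L A] [LieRinehartRing A L]
    [LieRinehartAlgebra ℂ A L] [AddCommGroup W] [Module ℂ W]
    (𝓜 : LieAlgebroidModule A L W) : Prop :=
  Nontrivial W ∧ ∀ N : Submodule ℂ W, (∀ a, ∀ w ∈ N, 𝓜.smul a w ∈ N) →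
    (∀ u, ∀ w ∈ N, 𝓜.act u w ∈ N) → N = ⊥ ∨ N = ⊤

namespace VertexAlgebroid

section GradedModule

variable (A B : Type*) [CommRing A] [Algebra ℂ A] [AddCommGroup B] [Module ℂ B]
  [VertexAlgebroid A B] {M : Type*} [AddCommGroup M] [Module ℂ M] [VertexModule (VB A B) M]

/-- `M = ∐_{n ∈ ℕ} W(n)` is an `ℕ`-graded `V_B`-module: for `v ∈ (V_B)_(k)`, the operator `v_m` maps
`W(n)` to `W(k + n - m - 1)`, where `W(j) = 0` for `j < 0`. -/
structure IsNGraded (W : ℕ → Submodule ℂ M) : Prop where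
  isInternal : DirectSum.IsInternal W
  mode_mem : ∀ (k m : ℤ) (n j : ℕ), ∀ v ∈ VB.weight A B k, ∀ w ∈ W n,
    (j : ℤ) = k + n - m - 1 → VertexModule.Y v m w ∈ W j
  mode_eq_zero : ∀ (k m : ℤ) (n : ℕ), ∀ v ∈ VB.weight A B k, ∀ w ∈ W n,
    k + n - m - 1 < 0 → VertexModule.Y v m w = 0

/-- The `ℕ`-graded `V_B`-module `M = ∐ W(n)` is graded simple: it is nonzero and its only graded
`V_B`-submodules are `0` and `M`. -/
def IsGradedSimple (W : ℕ → Submodule ℂ M) : Prop :=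
  Nontrivial M ∧ ∀ N : Submodule ℂ M,
    (∀ (v : VB A B) (n : ℤ), ∀ w ∈ N, VertexModule.Y v n w ∈ N) →
    N = ⨆ n, N ⊓ W n → N = ⊥ ∨ N = ⊤

end GradedModule

end VertexAlgebroid

end

/-! Two special cases of the Jacobi identity carry the whole argument: the commutator formula for
`u_m` and `v_n`, and the iterate formula expressing the modes of `u_l v` through those of `u` and
`v`. For `u, v ∈ A ⊕ B` the products `u_n v` with `n ≥ 0` in `V_B` are `u_0 v`, `u_1 v` and zero, so
the modes of `A ⊕ B` on any `V_B`-module satisfy the relations of `𝓛` (`commutator_ofProd`). Passing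
to the quotient by `I_B` adds `e = 𝟏`, `a_{-1}a' = aa'` and `a_{-1}b = a * b`.

The operator `a_n` lowers degrees by `n + 1` and `b_n` lowers them by `n`. On the bottom level
`W(0)`, therefore, `a_n` with `n ≥ 0` and `b_n` with `n ≥ 1` vanish, while `a_{-1}` and `b_0`
preserve `W(0)`. The iterate formula collapses there to its leading term and gives `(aa')_{-1} =
a_{-1}a'_{-1}` and `(a * b)_0 = a_{-1}b_0` (`ofA_mul`, `ofB_star`). Since `(∂a)_0 = 0` on every
module (`ofB_d_zero`), the second identity shows that `A∂A` acts by zero, so `B / A∂A` acts. The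
other axioms are the commutators `[u_0, v_0]` and `[u_0, a_{-1}]`.

For simplicity, let `N ⊆ W(0)` be stable under `A` and `B / A∂A`. The point is that the
`V_B`-submodule generated by `N` meets `W(0)` only in `N`. In the spirit of a triangular
decomposition, one closes `N` only under the modes that strictly raise degrees. Everything added to
`N` lies in positive degrees (`raisingClosure_inf_le`), and the closure is a graded subspace
(`raisingClosure_eq_iSup`). It is also stable under all modes of `A ⊕ B`, because those send `N`
into the closure and commutators of modes are again combinations of modes
(`mode_mem_raisingClosure`). As `A ⊕ B` generates `V_B`, the closure is a graded `V_B`-submodule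
(`mode_mem_of_stable`). If `W` is graded simple, the closure is `0` or all of `W`, and intersecting
with `W(0)` gives `N = 0` or `N = W(0)`. -/

namespace VertexModule

/-! ### Commutator and iterate formulas for modules over a vertex algebra -/

variable {V : Type*} [AddCommGroup V] [Module ℂ V] [VertexAlgebra V]
  {W : Type*} [AddCommGroup W] [Module ℂ W] [VertexModule V W]

/-- The commutator formula `[u_m, v_n] = ∑ (m choose i) (u_i v)_{m+n-i}`. -/
theorem commutator (u v : V) (m n : ℤ) (w : W) :
    Y u m (Y v n w) - Y v n (Y u m w) =
      bsum m fun i => Y (VertexAlgebra.Y u i v) (m + n - i) w := by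
  -- At `l = 0` the binomials `(0 choose i)` leave only `i = 0` on the left, which is the
  -- commutator.
  have h := VertexModule.jacobi (V := V) (W := W) u v w 0 m n
  rw [finsum_eq_single _ 0 fun i hi => by rw [Ring.choose_zero_pos ℤ (Nat.pos_of_ne_zero hi)]; simp] at h
  simpa [bsum] using h

/-- The iterate formula for the modes of `u_l v`. -/
theorem iterate (u v : V) (l n : ℤ) (w : W) :
    Y (VertexAlgebra.Y u l v) n w =
      ∑ᶠ i : ℕ, ((-1) ^ i * Ring.choose l i) • (Y u (l - i) (Y v (n + i) w) -
        (l.negOnePow : ℤ) • Y v (n + l - i) (Y u i w)) := by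
  -- At `m = 0` it is the right-hand sum that reduces to its term `i = 0`, a single mode of `u_l v`.
  have h := VertexModule.jacobi (V := V) (W := W) u v w l 0 n
  rw [show (∑ᶠ i : ℕ, Ring.choose (0 : ℤ) i • Y (VertexAlgebra.Y u (l + i) v) (0 + n - i) w) = _
    from bsum_zero_left _] at h
  simpa using h.symm

end VertexModule

namespace VertexAlgebroid

/-! ### Products of elements of `A ⊕ B` in `V_B`, and their modes on a module -/

section ModesOnModule

variable {A B M : Type*} [CommRing A] [Algebra ℂ A] [AddCommGroup B] [Module ℂ B]
  [VertexAlgebroid A B] [AddCommGroup M] [Module ℂ M] [VertexModule (VB A B) M]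

variable (A B) in
/-- The image `u(-1)𝟏` of `u ∈ A ⊕ B` in `V_B`. -/
noncomputable def ofProd : A × B →ₗ[ℂ] VB A B where
  toFun u := toVB A B (VL.g A B u (-1) (VL.vac A B))
  map_add' u v := by rw [VL.g_add, LinearMap.add_apply, map_add]
  map_smul' c u := by rw [VL.g_smul, LinearMap.smul_apply, map_smul, RingHom.id_apply]

theorem ofProd_inl (a : A) : ofProd A B (a, 0) = ofA B a := rfl

theorem ofProd_inr (b : B) : ofProd A B (0, b) = ofB A b := rfl

/-- The projection to `V_B` respects all products, and in `V_𝓛` the modes of `u(-1)𝟏` are the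
operators `u(n)` by `VL.Y_mode`. Computations in `V_B` thereby reduce to computations with the Lie
algebra `𝓛`. -/
theorem Y_ofProd_toVB (u : A × B) (n : ℤ) (x : VL A B) :
    VertexAlgebra.Y (ofProd A B u) n (toVB A B x) = toVB A B (VL.g A B u n x) := by
  rw [← VL.Y_mode]
  exact toVB_Y A B _ _ _

/-- The method for this and the next two products: move `u(n)` past `v(-1)`, where it annihilates
the vacuum. Only the bracket `[u(n), v(-1)]` applied to `𝟏` survives. -/
theorem Y_ofProd_zero (u v : A × B) :
    VertexAlgebra.Y (ofProd A B u) 0 (ofProd A B v) = ofProd A B (op0 A B u v) := by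
  refine (Y_ofProd_toVB u 0 _).trans (congrArg (toVB A B) ?_)
  have h := VL.g_comm A B u v 0 (-1) (VL.vac A B)
  rw [VL.g_vac A B u 0 le_rfl, map_zero, sub_zero, zero_smul, add_zero, zero_add] at h
  exact h

theorem Y_ofProd_one (u v : A × B) :
    VertexAlgebra.Y (ofProd A B u) 1 (ofProd A B v) = ofProd A B (op1 A B u v) := by
  refine (Y_ofProd_toVB u 1 _).trans (congrArg (toVB A B) ?_)
  have h := VL.g_comm A B u v 1 (-1) (VL.vac A B)
  -- The term with `op0` has index `1 - 1 = 0` and also annihilates the vacuum; the term with `op1`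
  -- has index `-1` and coefficient `1`.
  rw [VL.g_vac A B u 1 zero_le_one, map_zero, sub_zero, one_smul,
    VL.g_vac A B _ (1 + -1) (by norm_num), zero_add] at h
  exact h

theorem Y_ofProd_of_two_le (u v : A × B) (n : ℤ) (hn : 2 ≤ n) :
    VertexAlgebra.Y (ofProd A B u) n (ofProd A B v) = 0 := by
  refine (Y_ofProd_toVB u n _).trans ?_
  have h := VL.g_comm A B u v n (-1) (VL.vac A B)
  -- The two terms of the bracket have indices `n - 1` and `n - 2`, nonnegative as soon as `n ≥ 2`.
  rw [VL.g_vac A B u n (by omega), map_zero, sub_zero, VL.g_vac A B _ (n + -1) (by omega),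
    VL.g_vac A B _ (n + -1 - 1) (by omega), smul_zero, add_zero] at h
  rw [h, map_zero]

/-- The modes of `A ⊕ B` on a `V_B`-module satisfy the relations of `𝓛`. -/
theorem commutator_ofProd (u v : A × B) (m n : ℤ) (w : M) :
    VertexModule.Y (ofProd A B u) m (VertexModule.Y (ofProd A B v) n w) -
        VertexModule.Y (ofProd A B v) n (VertexModule.Y (ofProd A B u) m w) =
      VertexModule.Y (ofProd A B (op0 A B u v)) (m + n) w +
        m • VertexModule.Y (ofProd A B (op1 A B u v)) (m + n - 1) w := by
  -- Only `i = 0` and `i = 1` contribute, with binomial weights `1` and `m`.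
  rw [VertexModule.commutator, bsum_eq_range m 2 fun i hi => by
    rw [Y_ofProd_of_two_le u v i (by omega)]; simp]
  simp [Finset.sum_range_succ, Y_ofProd_zero, Y_ofProd_one]

/-- This and the next two identities are the generators of `I_B` themselves, taken with exponent `0`
of `𝓓`. -/
theorem ofA_one : ofA B (1 : A) = (VertexAlgebra.vac : VB A B) := by
  rw [← toVB_vac, VL.vac_eq, ofA, ← sub_eq_zero, ← map_sub]
  exact (Submodule.Quotient.mk_eq_zero _).mpr (Submodule.subset_span ⟨0, _, .one, rfl⟩)

theorem Y_ofA_ofA (a a' : A) :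
    VertexAlgebra.Y (ofA B a) (-1) (ofA B a') = ofA B (a * a') := by
  refine (Y_ofProd_toVB (a, 0) (-1) _).trans ?_
  rw [ofA, ← sub_eq_zero, ← map_sub]
  exact (Submodule.Quotient.mk_eq_zero _).mpr (Submodule.subset_span ⟨0, _, .mul a a', rfl⟩)

theorem Y_ofA_ofB (a : A) (b : B) :
    VertexAlgebra.Y (ofA B a) (-1) (ofB A b) = ofB A (star a b) := by
  refine (Y_ofProd_toVB (a, 0) (-1) _).trans ?_
  rw [ofB, ← sub_eq_zero, ← map_sub]
  exact (Submodule.Quotient.mk_eq_zero _).mpr (Submodule.subset_span ⟨0, _, .star a b, rfl⟩)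

/-- The defining relation of `𝓛` at `n = -1` is `(∂a)(-1) = a(-2)`. Having `∂a` as a product with
the vacuum makes the iterate formula applicable to it. -/
theorem ofB_d (a : A) :
    ofB A (d a : B) = VertexAlgebra.Y (ofA B a) (-2) (VertexAlgebra.vac : VB A B) := by
  refine Eq.trans ?_ (Y_ofProd_toVB (a, 0) (-2) (VL.vac A B)).symm
  rw [ofB, VL.g_d]
  simp

/-- The zero mode of `∂a` vanishes on every `V_B`-module. -/
theorem ofB_d_zero (a : A) (w : M) : VertexModule.Y (ofB A (d a : B)) 0 w = 0 := by
  rw [ofB_d, VertexModule.iterate]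
  refine finsum_eq_zero_of_forall_eq_zero fun i => ?_
  -- The modes of `𝟏` that occur have indices `i` and `-2 - i`, and neither equals `-1`, the only
  -- index with a nonzero mode.
  rw [VertexModule.vac_left, VertexModule.vac_left, if_neg (by omega), if_neg (by omega)]
  simp

/-- The weights `0` of `A` and `1` of `B` turn the grading axioms into statements about the modes
`a_m` and `b_m`. -/
theorem ofA_mem_weight (a : A) : ofA B a ∈ VB.weight A B 0 :=
  Submodule.mem_map_of_mem (Submodule.subset_span
    (show VL.Monomial A B 0 _ by simpa using VL.Monomial.ofA (B := B) a (-1) 0 _ .vac))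

theorem ofB_mem_weight (b : B) : ofB A b ∈ VB.weight A B 1 :=
  Submodule.mem_map_of_mem (Submodule.subset_span
    (show VL.Monomial A B 1 _ by simpa using VL.Monomial.ofB (A := A) b (-1) 0 _ .vac))

/-- A subspace stable under the modes of `A ⊕ B` is a `V_B`-submodule. -/
theorem mode_mem_of_stable (Q : Submodule ℂ M)
    (hQ : ∀ u n, ∀ x ∈ Q, VertexModule.Y (ofProd A B u) n x ∈ Q) (v : VB A B) :
    ∀ n : ℤ, ∀ x ∈ Q, VertexModule.Y v n x ∈ Q := by
  -- The condition is pulled back to `V_𝓛`, for which generation from the vacuum (`VL.ind`) is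
  -- available.
  let T : Submodule ℂ (VL A B) :=
    { carrier := {v | ∀ n : ℤ, ∀ x ∈ Q, VertexModule.Y (toVB A B v) n x ∈ Q}
      add_mem' := fun {v v'} hv hv' n x hx => by
        rw [map_add, map_add, Pi.add_apply, LinearMap.add_apply]
        exact Q.add_mem (hv n x hx) (hv' n x hx)
      zero_mem' := fun n x _ => by
        rw [map_zero, map_zero, Pi.zero_apply, LinearMap.zero_apply]
        exact Q.zero_mem
      smul_mem' := fun c v hv n x hx => by
        rw [map_smul, map_smul, Pi.smul_apply, LinearMap.smul_apply]
        exact Q.smul_mem c (hv n x hx) }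
  obtain ⟨v, rfl⟩ := Submodule.mkQ_surjective _ v
  refine VL.ind A B T (fun n x hx => ?_) (fun u l v hv n x hx => ?_) v
  · rw [← VL.vac_eq, toVB_vac, VertexModule.vac_left]
    split_ifs
    exacts [hx, Q.zero_mem]
  -- The iterate formula writes the modes of `u_l v` through those of `u ∈ A ⊕ B`, for which
  -- stability is assumed, and those of `v`, for which it is the induction hypothesis.
  · rw [← Y_ofProd_toVB, VertexModule.iterate]
    -- No finiteness has to be checked: a `finsum` with infinite support is `0` by convention, and
    -- `0 ∈ Q`.
    refine finsum_induction (· ∈ Q) Q.zero_mem (fun _ _ => Q.add_mem) fun i => ?_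
    exact zsmul_mem (Q.sub_mem (hQ _ _ _ (hv _ _ hx)) (zsmul_mem (hv _ _ (hQ _ _ _ hx)) _)) _

end ModesOnModule

/-! ### The bottom level `W(0)` as a module for the Lie algebroid `B / A∂A` -/

namespace IsNGraded

variable {A B M : Type*} [CommRing A] [Algebra ℂ A] [AddCommGroup B] [Module ℂ B]
  [VertexAlgebroid A B] [AddCommGroup M] [Module ℂ M] [VertexModule (VB A B) M]
  {W : ℕ → Submodule ℂ M}

theorem ofA_mem (hW : IsNGraded A B W)
    (a : A) (m : ℤ) (n j : ℕ) (h : (j : ℤ) = n - m - 1) {w : M} (hw : w ∈ W n) :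
    VertexModule.Y (ofA B a) m w ∈ W j :=
  hW.mode_mem 0 m n j _ (ofA_mem_weight a) w hw (by omega)

theorem ofB_mem (hW : IsNGraded A B W)
    (b : B) (m : ℤ) (n j : ℕ) (h : (j : ℤ) = n - m) {w : M} (hw : w ∈ W n) :
    VertexModule.Y (ofB A b) m w ∈ W j :=
  hW.mode_mem 1 m n j _ (ofB_mem_weight b) w hw (by omega)

/-- The image would have degree `-m - 1 < 0`; for `b_m` in the next lemma it would have degree `-m`,
whence the different bounds on `m`. -/
theorem ofA_eq_zero (hW : IsNGraded A B W) (a : A) (m : ℤ) (hm : 0 ≤ m) {w : M} (hw : w ∈ W 0) :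
    VertexModule.Y (ofA B a) m w = 0 :=
  hW.mode_eq_zero 0 m 0 _ (ofA_mem_weight a) w hw (by push_cast; omega)

theorem ofB_eq_zero (hW : IsNGraded A B W) (b : B) (m : ℤ) (hm : 1 ≤ m) {w : M} (hw : w ∈ W 0) :
    VertexModule.Y (ofB A b) m w = 0 :=
  hW.mode_eq_zero 1 m 0 _ (ofB_mem_weight b) w hw (by push_cast; omega)

/-- In `V_B` one has `aa' = a_{-1}a'`, and its mode of index `-1` is a sum over `i` of terms
`a_{-1-i} a'_{-1+i} w` and `a'_{-2-i} a_i w`. On the bottom level only `a_{-1} a'_{-1} w` survives;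
in higher degrees multiplicativity may fail. -/
theorem ofA_mul (hW : IsNGraded A B W) (a a' : A) {w : M} (hw : w ∈ W 0) :
    VertexModule.Y (ofA B (a * a')) (-1) w =
      VertexModule.Y (ofA B a) (-1) (VertexModule.Y (ofA B a') (-1) w) := by
  -- For `i > 0` both `a'_{-1+i}` and `a_i` annihilate `w`.
  rw [← Y_ofA_ofA, VertexModule.iterate, finsum_eq_single _ 0 fun i hi => by
    rw [hW.ofA_eq_zero a' (-1 + i) (by omega) hw, hW.ofA_eq_zero a i (by omega) hw]; simp]
  -- The term `i = 0` still contains `a'_{-2} a_0 w`, which vanishes because `a_0 w = 0`.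
  have h := hW.ofA_eq_zero a 0 le_rfl hw
  simp [h]

/-- The same collapse for `a * b = a_{-1}b`: the terms are `a_{-1-i} b_i w` and `b_{-1-i} a_i w`,
and only `a_{-1} b_0 w` is nonzero. This gives both the `A`-linearity of the action and the
vanishing of `A∂A`. -/
theorem ofB_star (hW : IsNGraded A B W) (a : A) (b : B) {w : M} (hw : w ∈ W 0) :
    VertexModule.Y (ofB A (star a b)) 0 w =
      VertexModule.Y (ofA B a) (-1) (VertexModule.Y (ofB A b) 0 w) := by
  rw [← Y_ofA_ofB, VertexModule.iterate, finsum_eq_single _ 0 fun i hi => by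
    rw [hW.ofB_eq_zero b (0 + i) (by omega) hw, hW.ofA_eq_zero a i (by omega) hw]; simp]
  have h := hW.ofA_eq_zero a 0 le_rfl hw
  simp [h]

/-- By `ofB_star`, `(a * ∂a')_0 = a_{-1} (∂a')_0` on `W(0)`, and the right factor is zero. Thus the
zero modes of `B` descend to `B / A∂A`. -/
theorem ofB_eq_zero_of_mem_AdA (hW : IsNGraded A B W) {w : M} (hw : w ∈ W 0) :
    ∀ b ∈ AdA A B, VertexModule.Y (ofB A b) 0 w = 0 := by
  refine AdA_induction A B ?_ (fun x y hx hy => ?_) (fun c x hx => ?_) fun a a' => ?_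
  -- `ofB` is a bare function, so its linearity is read off from the linear map `ofProd`.
  · rw [← ofProd_inr, Prod.mk_zero_zero, map_zero, map_zero]; rfl
  · rw [← ofProd_inr] at hx hy ⊢
    rw [show ((0, x + y) : A × B) = (0, x) + (0, y) by simp, map_add, map_add, Pi.add_apply,
      LinearMap.add_apply, hx, hy, add_zero]
  · rw [← ofProd_inr] at hx ⊢
    rw [show ((0, c • x) : A × B) = c • (0, x) by simp, map_smul, map_smul, Pi.smul_apply,
      LinearMap.smul_apply, hx, smul_zero]
  · rw [hW.ofB_star a _ hw, ofB_d_zero, map_zero]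

/-- The algebra `A` acts on `W(0)` by `a ↦ a_{-1}`. -/
noncomputable def smulHom (hW : IsNGraded A B W) : A →ₐ[ℂ] Module.End ℂ (W 0) :=
  AlgHom.ofLinearMap
    { toFun := fun a => (VertexModule.Y (ofA B a) (-1)).restrict
        fun _ hw => hW.ofA_mem a (-1) 0 0 (by simp) hw
      map_add' := fun a a' => by
        ext w
        have h : ofA B (a + a') = ofA B a + ofA B a' := by
          simp only [← ofProd_inl, ← map_add, Prod.mk_add_mk, add_zero]
        simp [LinearMap.restrict_apply, h]
      map_smul' := fun c a => by
        ext w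
        have h : ofA B (c • a) = c • ofA B a := by
          simp only [← ofProd_inl, ← map_smul, Prod.smul_mk, smul_zero]
        simp [LinearMap.restrict_apply, h] }
    (by
      -- The unit of `A` acts as the identity because `e = 𝟏` in `V_B` and `𝟏_{-1}` is the identity.
      ext w
      simp [LinearMap.restrict_apply, ofA_one, VertexModule.vac_left])
    (fun a a' => by
      ext w
      exact hW.ofA_mul a a' w.2)

theorem coe_smulHom (hW : IsNGraded A B W) (a : A) (w : W 0) :
    (hW.smulHom a w : M) = VertexModule.Y (ofA B a) (-1) (w : M) := rfl

/-- The Lie algebroid `B / A∂A` acts on `W(0)` by `b ↦ b_0`. -/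
noncomputable def actHom (hW : IsNGraded A B W) : LieAlgd A B →ₗ[ℂ] Module.End ℂ (W 0) :=
  (AdA A B).liftQ
    { toFun := fun b => (VertexModule.Y (ofB A b) 0).restrict
        fun _ hw => hW.ofB_mem b 0 0 0 (by simp) hw
      map_add' := fun b b' => by
        ext w
        have h : ofB A (b + b') = ofB A b + ofB A b' := by
          simp only [← ofProd_inr, ← map_add, Prod.mk_add_mk, add_zero]
        simp [LinearMap.restrict_apply, h]
      map_smul' := fun c b => by
        ext w
        have h : ofB A (c • b) = c • ofB A b := by
          simp only [← ofProd_inr, ← map_smul, Prod.smul_mk, smul_zero]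
        simp [LinearMap.restrict_apply, h] }
    (fun b hb => by
      rw [LinearMap.mem_ker]
      ext w
      exact hW.ofB_eq_zero_of_mem_AdA w.2 b hb)

theorem coe_actHom_mk (hW : IsNGraded A B W) (b : B) (w : W 0) :
    (hW.actHom (LieAlgd.mk A B b) w : M) = VertexModule.Y (ofB A b) 0 (w : M) := rfl

/-- The `B / A∂A`-module structure on `W(0)`. -/
noncomputable def lieAlgebroidModule (hW : IsNGraded A B W)
    : LieAlgebroidModule A (LieAlgd A B) (W 0) where
  smul := hW.smulHom
  act := hW.actHom
  act_lie u v w := by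
    obtain ⟨u, rfl⟩ := LieAlgd.mk_surjective A B u
    obtain ⟨v, rfl⟩ := LieAlgd.mk_surjective A B v
    ext
    -- With first index `0` the pairing term, weighted by that index, drops out, leaving `[u_0, v_0]
    -- = [u, v]_0`.
    have h := commutator_ofProd ((0, u) : A × B) (0, v) 0 0 (w : M)
    simp only [op0_apply, map_zero, sub_zero, zero_smul, add_zero, ofProd_inr] at h
    rw [LieAlgd.lie_mk, Submodule.coe_sub]
    simp only [coe_actHom_mk]
    exact h.symm
  act_smul u a w := by
    obtain ⟨u, rfl⟩ := LieAlgd.mk_surjective A B u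
    ext
    -- The zero mode of `u` acts on `a_{-1}` through the anchor: `[u_0, a_{-1}] = (π(u)a)_{-1}`.
    have h := commutator_ofProd ((0, u) : A × B) (a, 0) 0 (-1) (w : M)
    simp only [op0_apply, map_zero, sub_zero, zero_smul, add_zero, zero_add, ofProd_inr,
      ofProd_inl] at h
    rw [LieAlgd.mk_lie, Submodule.coe_sub]
    simp only [coe_actHom_mk, coe_smulHom]
    exact h
  smul_act a u w := by
    obtain ⟨u, rfl⟩ := LieAlgd.mk_surjective A B u
    ext
    rw [LieAlgd.smul_mk]
    simp only [coe_actHom_mk, coe_smulHom]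
    -- Unlike the two previous axioms, this one is not a commutator relation and depends on `w`
    -- being in degree zero.
    exact (hW.ofB_star a u w.2).symm

end IsNGraded

/-! ### The closure of a subspace under the raising operators -/

section Raising

variable (A B : Type*) {M : Type*} [CommRing A] [Algebra ℂ A] [AddCommGroup B] [Module ℂ B]
  [VertexAlgebroid A B] [AddCommGroup M] [Module ℂ M] [VertexModule (VB A B) M]

/-- The operators `a_n` (`n ≤ -2`) and `b_n` (`n ≤ -1`), those which raise degrees. -/
inductive IsRaising : A × B → ℤ → Prop
  | ofA (a : A) (n : ℤ) (hn : n ≤ -2) : IsRaising (a, 0) n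
  | ofB (b : B) (n : ℤ) (hn : n ≤ -1) : IsRaising (0, b) n

/-- The smallest subspace containing `N` and stable under the raising operators. -/
def raisingClosure (N : Submodule ℂ M) : Submodule ℂ M :=
  sInf {S | N ≤ S ∧ ∀ u n, IsRaising A B u n →
    ∀ x ∈ S, VertexModule.Y (ofProd A B u) n x ∈ S}

variable {A B} {N : Submodule ℂ M}

theorem le_raisingClosure : N ≤ raisingClosure A B N := le_sInf fun _ hS => hS.1

theorem raising_mem_raisingClosure {u : A × B} {n : ℤ} (h : IsRaising A B u n) {x : M}
    (hx : x ∈ raisingClosure A B N) :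
    VertexModule.Y (ofProd A B u) n x ∈ raisingClosure A B N := by
  rw [raisingClosure, Submodule.mem_sInf] at hx ⊢
  exact fun S hS => hS.2 u n h x (hx S hS)

theorem raisingClosure_le {S : Submodule ℂ M} (hN : N ≤ S)
    (hS : ∀ u n, IsRaising A B u n → ∀ x ∈ S, VertexModule.Y (ofProd A B u) n x ∈ S) :
    raisingClosure A B N ≤ S := sInf_le ⟨hN, hS⟩

/-- Lowering and degree-preserving modes can be moved to the right past raising ones, at the cost of
commutators that are again modes of `A ⊕ B`, until they reach `N`. Hence it is enough to control all
modes on `N`. The induction below replaces a normal ordering of monomials as in the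
Poincaré–Birkhoff–Witt theorem. -/
theorem mode_mem_raisingClosure
    (hN : ∀ u n, ∀ x ∈ N, VertexModule.Y (ofProd A B u) n x ∈ raisingClosure A B N)
    (u : A × B) (n : ℤ) (x : M) (hx : x ∈ raisingClosure A B N) :
    VertexModule.Y (ofProd A B u) n x ∈ raisingClosure A B N := by
  -- `T` imposes the condition for all modes at once, since the commutator of `u_n` with a raising
  -- operator involves modes of other elements at other indices.
  let T : Submodule ℂ M := raisingClosure A B N ⊓ ⨅ (u : A × B) (n : ℤ),
    (raisingClosure A B N).comap (VertexModule.Y (ofProd A B u) n)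
  have hT : ∀ x, x ∈ T ↔ x ∈ raisingClosure A B N ∧
      ∀ u n, VertexModule.Y (ofProd A B u) n x ∈ raisingClosure A B N := fun x => by
    simp [T, Submodule.mem_iInf]
  suffices h : raisingClosure A B N ≤ T from ((hT x).mp (h hx)).2 u n
  refine raisingClosure_le (fun x hx => (hT x).mpr ⟨le_raisingClosure hx, fun u n => hN u n x hx⟩)
    fun v m hv x hx => ?_
  rw [hT] at hx ⊢
  refine ⟨raising_mem_raisingClosure hv hx.1, fun u n => ?_⟩
  -- Write `u_n v_m x = [u_n, v_m] x + v_m u_n x`. The commutator consists of modes applied to `x ∈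
  -- T`; in the last term `u_n x` is in the closure, which the raising operator `v_m` preserves.
  rw [sub_eq_iff_eq_add.mp (commutator_ofProd u v n m x)]
  exact add_mem (add_mem (hx.2 _ _) (zsmul_mem (hx.2 _ _) n))
    (raising_mem_raisingClosure hv (hx.2 u n))

end Raising

/-! ### The grading of the closure and the simplicity of `W(0)` -/

namespace IsNGraded

variable {A B M : Type*} [CommRing A] [Algebra ℂ A] [AddCommGroup B] [Module ℂ B]
  [VertexAlgebroid A B] [AddCommGroup M] [Module ℂ M] [VertexModule (VB A B) M]
  {W : ℕ → Submodule ℂ M}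

/-- The target degree is `n - m - 1` with `m ≤ -2`, or `n - m` with `m ≤ -1`. In both cases it is at
least `n + 1`, so `toNat` truncates nothing. That the degree is homogeneous and that it is never `0`
are the only two facts needed later. -/
theorem raising_mem (hW : IsNGraded A B W) {u : A × B} {m : ℤ} (h : IsRaising A B u m) (n : ℕ) :
    ∃ j : ℕ, j ≠ 0 ∧ ∀ w ∈ W n, VertexModule.Y (ofProd A B u) m w ∈ W j := by
  cases h with
  | ofA a m hm =>
    exact ⟨(n - m - 1).toNat, by omega, fun w hw => hW.ofA_mem a m n _ (by omega) hw⟩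
  | ofB b m hm => exact ⟨(n - m).toNat, by omega, fun w hw => hW.ofB_mem b m n _ (by omega) hw⟩

/-- Splitting `x` into homogeneous components reduces this to `raising_mem`. The supremum over `j ≠
0` is the one that occurs in the independence of the family `W`. -/
theorem raising_mem_iSup (hW : IsNGraded A B W)
    {u : A × B} {m : ℤ} (h : IsRaising A B u m) (x : M) :
    VertexModule.Y (ofProd A B u) m x ∈ ⨆ j, ⨆ (_ : j ≠ 0), W j := by
  have hx : x ∈ ⨆ n, W n := hW.isInternal.submodule_iSup_eq_top ▸ Submodule.mem_top
  induction hx using Submodule.iSup_induction' with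
  | mem n w hw =>
    obtain ⟨j, hj, hj'⟩ := hW.raising_mem h n
    exact Submodule.mem_iSup_of_mem j (Submodule.mem_iSup_of_mem hj (hj' w hw))
  | zero => rw [map_zero]; exact zero_mem _
  | add x y _ _ hx hy => rw [map_add]; exact add_mem hx hy

/-- Applying raising operators creates nothing new in degree zero. This is what lets `N` be
recovered from the submodule that it generates. -/
theorem raisingClosure_inf_le (hW : IsNGraded A B W) {N : Submodule ℂ M} (hN : N ≤ W 0) :
    raisingClosure A B N ⊓ W 0 ≤ N := by
  rintro w ⟨hw, hw0⟩
  -- The right-hand side contains `N`, and it is stable for a trivial reason: raising operators send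
  -- all of `M` into its second summand.
  have h : raisingClosure A B N ≤ N ⊔ ⨆ j, ⨆ (_ : j ≠ 0), W j :=
    raisingClosure_le le_sup_left fun u n hu x _ =>
      Submodule.mem_sup_right (hW.raising_mem_iSup hu x)
  obtain ⟨x, hx, y, hy, rfl⟩ := Submodule.mem_sup.mp (h hw)
  -- The component `y` of positive degree is a difference of two elements of `W(0)`, so it vanishes
  -- by independence of the graded pieces.
  have hy0 : y ∈ W 0 := by simpa using sub_mem hw0 (hN hx)
  have h0 := Submodule.disjoint_def.mp (hW.isInternal.submodule_iSupIndep 0) y hy0 hy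
  rwa [h0, add_zero]

/-- The span of the homogeneous elements of the closure contains `N`, which sits in degree zero, and
is stable because raising operators are homogeneous. By minimality it is the whole closure. -/
theorem raisingClosure_eq_iSup (hW : IsNGraded A B W) {N : Submodule ℂ M} (hN : N ≤ W 0) :
    raisingClosure A B N = ⨆ n, raisingClosure A B N ⊓ W n := by
  refine le_antisymm (raisingClosure_le ?_ fun u m hu x hx => ?_) (iSup_le fun n => inf_le_left)
  · exact (le_inf le_raisingClosure hN).trans (le_iSup (fun n => raisingClosure A B N ⊓ W n) 0)
  · induction hx using Submodule.iSup_induction' with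
    | mem n w hw =>
      obtain ⟨j, -, hj⟩ := hW.raising_mem hu n
      exact Submodule.mem_iSup_of_mem j ⟨raising_mem_raisingClosure hu hw.1, hj w hw.2⟩
    | zero => rw [map_zero]; exact zero_mem _
    | add x y _ _ hx hy => rw [map_add]; exact add_mem hx hy

/-- On `N ⊆ W(0)` the modes of `A` and of `B` fall into three kinds: raising ones, for which the
closure is built; the degree-preserving `a_{-1}` and `b_0`, under which `N` is stable; and lowering
ones, which are zero on `W(0)`. This is the input to `mode_mem_raisingClosure`. -/
theorem mode_mem_raisingClosure_of_mem (hW : IsNGraded A B W) {N : Submodule ℂ M} (hN : N ≤ W 0)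
    (hA : ∀ a : A, ∀ w ∈ N, VertexModule.Y (ofA B a) (-1) w ∈ N)
    (hB : ∀ b : B, ∀ w ∈ N, VertexModule.Y (ofB A b) 0 w ∈ N) (u : A × B) (n : ℤ) (x : M)
    (hx : x ∈ N) : VertexModule.Y (ofProd A B u) n x ∈ raisingClosure A B N := by
  obtain ⟨a, b⟩ := u
  -- The two components are treated apart because the degree-preserving index is `-1` for `A` and
  -- `0` for `B`.
  rw [← Prod.fst_add_snd (a, b), map_add, map_add, Pi.add_apply, LinearMap.add_apply]
  refine add_mem ?_ ?_
  · rcases lt_trichotomy n (-1) with h | rfl | h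
    · exact raising_mem_raisingClosure (.ofA a n (by omega)) (le_raisingClosure hx)
    · exact le_raisingClosure (hA a x hx)
    · rw [ofProd_inl, hW.ofA_eq_zero a n (by omega) (hN hx)]
      exact zero_mem _
  · rcases lt_trichotomy n 0 with h | rfl | h
    · exact raising_mem_raisingClosure (.ofB b n (by omega)) (le_raisingClosure hx)
    · exact le_raisingClosure (hB b x hx)
    · rw [ofProd_inr, hW.ofB_eq_zero b n (by omega) (hN hx)]
      exact zero_mem _

/-- A stable subspace of `W(0)` is the degree-zero part of the graded `V_B`-submodule it generates,
and graded simplicity leaves only two choices for the latter. -/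
theorem isSimple_lieAlgebroidModule (hW : IsNGraded A B W)
    (hW0 : W 0 ≠ ⊥) (hs : IsGradedSimple A B W) :
    hW.lieAlgebroidModule.IsSimple := by
  refine ⟨(Submodule.nontrivial_iff_ne_bot).mpr hW0, fun N hA hL => ?_⟩
  -- `N` is a subspace of the subtype `W 0`; the closure has to be formed in `M`.
  let N' : Submodule ℂ M := N.map (W 0).subtype
  have hN' : N' ≤ W 0 := Submodule.map_subtype_le _ _
  have hstable := mode_mem_raisingClosure (hW.mode_mem_raisingClosure_of_mem hN'
    (by rintro a _ ⟨w, hw, rfl⟩; exact ⟨_, hA a w hw, rfl⟩)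
    (by rintro b _ ⟨w, hw, rfl⟩; exact ⟨_, hL (LieAlgd.mk A B b) w hw, rfl⟩))
  rcases hs.2 (raisingClosure A B N') (mode_mem_of_stable _ hstable)
    (hW.raisingClosure_eq_iSup hN') with h | h
  · left
    have h' : N' ≤ ⊥ := h ▸ le_raisingClosure
    exact eq_bot_iff.mpr fun w hw => Subtype.ext (h' ⟨w, hw, rfl⟩)
  · right
    rw [eq_top_iff]
    rintro w -
    -- The closure is now all of `M`, so its intersection with `W(0)` is `W(0)`, and this
    -- intersection is contained in `N'`.
    obtain ⟨w', hw', hww'⟩ := hW.raisingClosure_inf_le hN' ⟨h ▸ Submodule.mem_top, w.2⟩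
    rwa [← Subtype.ext hww']

end IsNGraded

end VertexAlgebroid

theorem proposition4p8 {A B M : Type*} [CommRing A] [Algebra ℂ A] [AddCommGroup B] [Module ℂ B]
    [VertexAlgebroid A B] [AddCommGroup M] [Module ℂ M] [VertexModule (VertexAlgebroid.VB A B) M]
    (W : ℕ → Submodule ℂ M) (hW : VertexAlgebroid.IsNGraded A B W) (hW0 : W 0 ≠ ⊥) :
    ∃ 𝓜 : LieAlgebroidModule A (VertexAlgebroid.LieAlgd A B) (W 0),
      (∀ (a : A) (w : W 0),
        (𝓜.smul a w : M) = VertexModule.Y (VertexAlgebroid.ofA B a) (-1) (w : M)) ∧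
      (∀ (b : B) (w : W 0),
        (𝓜.act (VertexAlgebroid.LieAlgd.mk A B b) w : M) =
          VertexModule.Y (VertexAlgebroid.ofB A b) 0 (w : M)) ∧
      (VertexAlgebroid.IsGradedSimple A B W → 𝓜.IsSimple) :=
  ⟨hW.lieAlgebroidModule, fun _ _ => rfl, fun _ _ => rfl, hW.isSimple_lieAlgebroidModule hW0⟩
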